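/- **Conventions.** A graph $\Gamma$ is a finite 1-dimensional CW complex (loops and multiple edges allowed), every edge being identified with $[0,1]$ with ends glued to vertices; a half-edge is an edge together with one of its two ends, and it is incident on the vertex to which that end is attached. $\mathrm{Conf}_n(X)\subseteq X^n$ is the space of $n$-tuples of distinct points and $\mathrm{UConf}_n(X)=\mathrm{Conf}_n(X)/S_n$. Fix a vertex $v$ of $\Gamma$, a set $H$ of half-edges incident on $v$, and $0<\rho\le 1/2$, where $\rho<1/2$ if $H$ contains both half-edges of some loop. A half-edge $h$ is regarded as the open subset of $\Gamma$ of the points of its edge $e(h)$ at distance strictly between $0$ and $\rho$ from its end; $\Gamma\setminus\cup H$ is the closed subspace obtained by removing these open intervals for $h\in H$ (so $v$ remains), and $\iota_H$ denotes the maps of configuration spaces induced by $\Gamma\setminus\cup H\subseteq\Gamma$. Let $s:\Gamma\setminus\{v\}\to\Gamma\setminus\cup H$ be the embedding that fixes the vertices and shrinks every edge affinely onto the part of it that is not removed. The map $add_v:\mathrm{UConf}_{n-1}(\Gamma\setminus\{v\})\to \mathrm{UConf}_n(\Gamma\setminus\cup H)$ applies $s$ to the configuration and adds the point $v$; for $h\in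 H$ the map $add_h$ applies $s$ and adds the point of $e(h)$ at distance $\rho$ from $v$ along $h$, which is then the closest one to $v$ along $h$. A generalized cohomology (homology) theory is a $\mathbb Z$-graded theory on pairs of topological spaces that satisfies the Eilenberg–Steenrod axioms without the dimension axiom. **Theorem 1.1.** Let $n\ge 1$. For every generalized cohomology theory $E$ there are homomorphisms $d$, defined for all $(\Gamma,v,H)$ as above and all $i\in\mathbb Z$, such that the following sequence is exact: $$\cdots\to E^i(\mathrm{UConf}_n(\Gamma))\xrightarrow{\iota_H^*}E^i(\mathrm{UConf}_n(\Gamma\setminus\cup H))\xrightarrow{\oplus_h(add_v^*-add_h^*)}E^i(\mathrm{UConf}_{n-1}(\Gamma\setminus\{v\}))^{\oplus |H|}\xrightarrow{\ d\ }E^{i+1}(\mathrm{UConf}_n(\Gamma))\xrightarrow{\iota_H^*}E^{i+1}(\mathrm{UConf}_n(\Gamma\setminus\cup H))\to\cdots$$ (a) *Naturality.* The sequence is natural with respect to graph embeddings $f:\Gamma\to\Gamma'$ (injective incidence-preserving maps of vertices and edges, in particular automorphisms) with $f(v)=v'$ such that every half-edge that $f$ sends into $H'$ lies in $H$, and $\rho'\le\rho$.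 On the third terms, the summand $h'\in H'$ is sent to the summand $h$ by $f^*$ if $f(h)=h'$, and the component at $h\in H$ is zero if $f(h)\notin H'$. (b) *Operations.* The homomorphisms $\iota_H^*$ commute with all cohomology operations $\theta:E^i\to F^j$ (natural transformations of set-valued functors on pairs), and $\oplus_h(add_v^*-add_h^*)$ with the additive ones. If $\theta:E^i\to F^j$ and $\theta':E^{i+1}\to F^{j+1}$ satisfy $\theta'\delta=\varepsilon\,\delta\theta$ for the coboundaries of pairs, with a sign $\varepsilon=\pm1$ (for instance consecutive members of a stable operation), then $\theta'd=\varepsilon\, d\,\theta$. (c) *Homology.* For every generalized homology theory $E$ there are exact sequences $$\cdots\to E_{i+1}(\mathrm{UConf}_n(\Gamma))\xrightarrow{d}E_i(\mathrm{UConf}_{n-1}(\Gamma\setminus\{v\}))^{\oplus|H|}\xrightarrow{\sum_h((add_v)_*-(add_h)_*)}E_i(\mathrm{UConf}_n(\Gamma\setminus\cup H))\xrightarrow{(\iota_H)_*}E_i(\mathrm{UConf}_n(\Gamma))\to\cdots$$ with the analogous naturality and compatibility with additive homology operations. (d) *Ordered configurations.* For every $n\ge 0$ the analogous sequences, with the same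 properties, exist in cohomology and homology for $\mathrm{Conf}_n(\Gamma)$ and $\mathrm{Conf}_n(\Gamma\setminus\cup H)$. Here the remaining term is the direct sum over $(k,h)\in\{1,\dots,n\}\times H$ of the (co)homology groups of the space of configurations in $\Gamma\setminus\{v\}$ of $n-1$ points with the labels in $\{1,\dots,n\}\setminus\{k\}$, the maps $add_v$, $add_h$ on the summand $(k,h)$ giving the new point the label $k$. These sequences are $S_n$-equivariant, where $S_n$ permutes the labels (and so the summands, which makes this term the representation induced from $S_{n-1}$ to $S_n$). -/

import Mathlib

open Set Function

universe u w

set_option linter.checkUnivs false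
set_option linter.unusedVariables false

noncomputable section

/-! ## Pairs of spaces, generalized cohomology and homology theories -/

/-- A pair `(X, A)` of a topological space `X` and a subspace `A`. -/
structure SpacePair where
  X : Type u
  [top : TopologicalSpace X]
  A : Set X

attribute [instance] SpacePair.top

namespace SpacePair

/-- A map of pairs: a continuous map `f : X → Y` with `f A ⊆ B`. -/
structure Hom (P Q : SpacePair.{u}) where
  toMap : C(P.X, Q.X)
  mapsTo : MapsTo toMap P.A Q.A

def Hom.id (P : SpacePair.{u}) : Hom P P := ⟨ContinuousMap.id _, mapsTo_id _⟩

def Hom.comp {P Q R : SpacePair.{u}} (g : Hom Q R) (f : Hom P Q) : Hom P R :=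
  ⟨g.toMap.comp f.toMap, g.mapsTo.comp f.mapsTo⟩

/-- Homotopy of maps of pairs: a homotopy that keeps `A` inside `B` at all times. -/
def Homotopic {P Q : SpacePair.{u}} (f g : Hom P Q) : Prop :=
  ∃ F : C(unitInterval × P.X, Q.X), (∀ x, F (0, x) = f.toMap x) ∧ (∀ x, F (1, x) = g.toMap x) ∧
    ∀ t, ∀ a ∈ P.A, F (t, a) ∈ Q.A

/-- The pair `(X, ∅)`. -/
abbrev of (X : Type u) [TopologicalSpace X] : SpacePair.{u} := ⟨X, ∅⟩

/-- A continuous map, as a map of pairs `(X, ∅) → (Y, ∅)`. -/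
def ofMap {X Y : Type u} [TopologicalSpace X] [TopologicalSpace Y] (f : C(X, Y)) :
    Hom (of X) (of Y) := ⟨f, fun _ h => h.elim⟩

/-- The inclusion `(A, ∅) → (X, ∅)`. -/
def incl (P : SpacePair.{u}) : Hom (of P.A) (of P.X) :=
  ofMap ⟨Subtype.val, continuous_subtype_val⟩

/-- The map `(X, ∅) → (X, A)` given by the identity. -/
def toRel (P : SpacePair.{u}) : Hom (of P.X) P := ⟨ContinuousMap.id _, fun _ h => h.elim⟩

/-- The restriction `(A, ∅) → (B, ∅)` of a map of pairs `(X, A) → (Y, B)`. -/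
def Hom.restrict {P Q : SpacePair.{u}} (f : Hom P Q) : Hom (of P.A) (of Q.A) :=
  ofMap ⟨f.mapsTo.restrict f.toMap P.A Q.A, f.toMap.continuous.restrict f.mapsTo⟩

/-- The pair `(X ∖ Z, A ∖ Z)`. -/
def excise (P : SpacePair.{u}) (Z : Set P.X) : SpacePair.{u} :=
  ⟨{x : P.X // x ∉ Z}, {x | x.1 ∈ P.A}⟩

/-- The inclusion `(X ∖ Z, A ∖ Z) → (X, A)`. -/
def exciseIncl (P : SpacePair.{u}) (Z : Set P.X) : Hom (P.excise Z) P :=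
  ⟨⟨Subtype.val, continuous_subtype_val⟩, fun _ h => h⟩

end SpacePair

open SpacePair

/-- A generalized cohomology theory: the Eilenberg–Steenrod axioms for pairs of topological
spaces, without the dimension axiom. -/
structure CohomologyTheory where
  /-- The group `Eⁱ(X, A)`. -/
  obj : ℤ → SpacePair.{u} → Type w
  [grp : ∀ i P, AddCommGroup (obj i P)]
  map : ∀ (i : ℤ) {P Q : SpacePair.{u}}, Hom P Q → obj i Q →+ obj i P
  map_id : ∀ i P x, map i (Hom.id P) x = x
  map_comp : ∀ i {P Q R : SpacePair.{u}} (g : Hom Q R) (f : Hom P Q) x,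
    map i (g.comp f) x = map i f (map i g x)
  /-- The coboundary `Eⁱ(A) → Eⁱ⁺¹(X, A)`. -/
  δ : ∀ (i : ℤ) (P : SpacePair.{u}), obj i (of P.A) →+ obj (i + 1) P
  δ_natural : ∀ i {P Q : SpacePair.{u}} (f : Hom P Q) x,
    δ i P (map i f.restrict x) = map (i + 1) f (δ i Q x)
  homotopy : ∀ i {P Q : SpacePair.{u}} (f g : Hom P Q), Homotopic f g → map i f = map i g
  exact_pair : ∀ i (P : SpacePair.{u}), Exact (map i P.toRel) (map i P.incl)
  exact_sub : ∀ i (P : SpacePair.{u}), Exact (map i P.incl) (δ i P)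
  exact_rel : ∀ i (P : SpacePair.{u}), Exact (δ i P) (map (i + 1) P.toRel)
  excision : ∀ i (P : SpacePair.{u}) (Z : Set P.X), closure Z ⊆ interior P.A →
    Bijective (map i (P.exciseIncl Z))

attribute [instance] CohomologyTheory.grp

/-- A generalized homology theory: the Eilenberg–Steenrod axioms for pairs of topological
spaces, without the dimension axiom. -/
structure HomologyTheory where
  /-- The group `Eᵢ(X, A)`. -/
  obj : ℤ → SpacePair.{u} → Type w
  [grp : ∀ i P, AddCommGroup (obj i P)]
  map : ∀ (i : ℤ) {P Q : SpacePair.{u}}, Hom P Q → obj i P →+ obj i Q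
  map_id : ∀ i P x, map i (Hom.id P) x = x
  map_comp : ∀ i {P Q R : SpacePair.{u}} (g : Hom Q R) (f : Hom P Q) x,
    map i (g.comp f) x = map i g (map i f x)
  /-- The boundary `Eᵢ₊₁(X, A) → Eᵢ(A)`. -/
  δ : ∀ (i : ℤ) (P : SpacePair.{u}), obj (i + 1) P →+ obj i (of P.A)
  δ_natural : ∀ i {P Q : SpacePair.{u}} (f : Hom P Q) x,
    δ i Q (map (i + 1) f x) = map i f.restrict (δ i P x)
  homotopy : ∀ i {P Q : SpacePair.{u}} (f g : Hom P Q), Homotopic f g → map i f = map i g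
  exact_pair : ∀ i (P : SpacePair.{u}), Exact (map i P.incl) (map i P.toRel)
  exact_sub : ∀ i (P : SpacePair.{u}), Exact (δ i P) (map i P.incl)
  exact_rel : ∀ i (P : SpacePair.{u}), Exact (map (i + 1) P.toRel) (δ i P)
  excision : ∀ i (P : SpacePair.{u}) (Z : Set P.X), closure Z ⊆ interior P.A →
    Bijective (map i (P.exciseIncl Z))

attribute [instance] HomologyTheory.grp

/-- The absolute group `Eⁱ(X) = Eⁱ(X, ∅)`. -/
abbrev CohomologyTheory.abs (E : CohomologyTheory.{u, w}) (i : ℤ) (X : Type u)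
    [TopologicalSpace X] : Type w := E.obj i (of X)

/-- The induced homomorphism `f^* : Eⁱ(Y) → Eⁱ(X)`. -/
def CohomologyTheory.pull (E : CohomologyTheory.{u, w}) (i : ℤ) {X Y : Type u}
    [TopologicalSpace X] [TopologicalSpace Y] (f : C(X, Y)) : E.abs i Y →+ E.abs i X :=
  E.map i (ofMap f)

/-- The absolute group `Eᵢ(X) = Eᵢ(X, ∅)`. -/
abbrev HomologyTheory.abs (E : HomologyTheory.{u, w}) (i : ℤ) (X : Type u)
    [TopologicalSpace X] : Type w := E.obj i (of X)

/-- The induced homomorphism `f_* : Eᵢ(X) → Eᵢ(Y)`. -/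
def HomologyTheory.push (E : HomologyTheory.{u, w}) (i : ℤ) {X Y : Type u}
    [TopologicalSpace X] [TopologicalSpace Y] (f : C(X, Y)) : E.abs i X →+ E.abs i Y :=
  E.map i (ofMap f)

/-- A cohomology operation `Eⁱ → Fʲ`: a natural transformation of set-valued functors on pairs.
It is not required to be additive, nor to be part of a stable family. -/
structure CohomologyOperation (E F : CohomologyTheory.{u, w}) (i j : ℤ) where
  app : ∀ P : SpacePair.{u}, E.obj i P → F.obj j P
  natural : ∀ {P Q : SpacePair.{u}} (f : Hom P Q) x,
    app P (E.map i f x) = F.map j f (app Q x)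

/-- The operation is additive. -/
def CohomologyOperation.Additive {E F : CohomologyTheory.{u, w}} {i j : ℤ}
    (θ : CohomologyOperation E F i j) : Prop :=
  ∀ P x y, θ.app P (x + y) = θ.app P x + θ.app P y

/-- Operations in two consecutive degrees commute with the coboundary up to the sign `ε`, as
consecutive members of a stable operation do (such as the Steenrod squares with `ε = 1`, or the
Bockstein operation with `ε = -1`). -/
def CohomologyOperation.Compatible {E F : CohomologyTheory.{u, w}} {i j : ℤ}
    (θ : CohomologyOperation E F i j) (θ' : CohomologyOperation E F (i + 1) (j + 1)) (ε : ℤˣ) :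
    Prop :=
  ∀ P x, θ'.app P (E.δ i P x) = (ε : ℤ) • F.δ j P (θ.app (of P.A) x)

/-- An (additive) homology operation `Eᵢ → Fⱼ`: a natural homomorphism on pairs. -/
structure HomologyOperation (E F : HomologyTheory.{u, w}) (i j : ℤ) where
  app : ∀ P : SpacePair.{u}, E.obj i P →+ F.obj j P
  natural : ∀ {P Q : SpacePair.{u}} (f : Hom P Q) x,
    app Q (E.map i f x) = F.map j f (app P x)

/-- Operations in two consecutive degrees commute with the boundary up to the sign `ε`. -/
def HomologyOperation.Compatible {E F : HomologyTheory.{u, w}} {i j : ℤ}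
    (θ : HomologyOperation E F i j) (θ' : HomologyOperation E F (i + 1) (j + 1)) (ε : ℤˣ) :
    Prop :=
  ∀ P x, θ.app (of P.A) (E.δ i P x) = (ε : ℤ) • F.δ j P (θ'.app P x)

/-! ## Graphs and their configuration spaces -/

/-- A finite graph; loops and multiple edges are allowed. The edge `e` is a copy of `[0, 1]`, whose
end `0` is attached to the vertex `ends e false` and whose end `1` to `ends e true`. A half-edge is
a pair `(e, b)` of an edge and one of its two ends; it is incident on the vertex `ends e b`. -/
structure FinGraph where
  V : Type u
  E : Type u
  [finV : Finite V]
  [finE : Finite E]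
  ends : E → Bool → V

namespace FinGraph

attribute [instance] finV finE

variable (Γ : FinGraph.{u})

instance : TopologicalSpace Γ.V := ⊥
instance : DiscreteTopology Γ.V := ⟨rfl⟩
instance : TopologicalSpace Γ.E := ⊥
instance : DiscreteTopology Γ.E := ⟨rfl⟩

/-- The disjoint union of the (discrete) vertex set and of the closed edges. -/
abbrev Pieces : Type u := Γ.V ⊕ Γ.E × unitInterval

open Classical in
/-- Replaces each end of a closed edge by the vertex to which it is attached. -/
def attach : Γ.Pieces → Γ.Pieces
  | .inl w => .inl w
  | .inr (e, t) =>
      if t = 0 then .inl (Γ.ends e false) else if t = 1 then .inl (Γ.ends e true) else .inr (e, t)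

/-- The topological space of the graph, a finite 1-dimensional CW complex: the quotient of the
disjoint union of the vertices and closed edges that glues the ends of the edges to the vertices. -/
def Space : Type u := Quotient (Setoid.ker Γ.attach)

instance : TopologicalSpace Γ.Space :=
  inferInstanceAs (TopologicalSpace (Quotient (Setoid.ker Γ.attach)))

variable {Γ}

def proj (x : Γ.Pieces) : Γ.Space := Quotient.mk (Setoid.ker Γ.attach) x

/-- The point of the space of the graph given by a vertex. -/
def vert (w : Γ.V) : Γ.Space := proj (.inl w)

/-- The point with parameter `t` on the edge `e`. -/
def pt (e : Γ.E) (t : unitInterval) : Γ.Space := proj (.inr (e, t))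

theorem proj_eq {x y : Γ.Pieces} : proj x = proj y ↔ Γ.attach x = Γ.attach y :=
  Quotient.eq (r := Setoid.ker Γ.attach)

theorem isQuotientMap_proj : Topology.IsQuotientMap (proj : Γ.Pieces → Γ.Space) :=
  isQuotientMap_quotient_mk'

theorem attach_zero (e : Γ.E) : Γ.attach (.inr (e, 0)) = .inl (Γ.ends e false) := by
  simp [attach]

theorem attach_one (e : Γ.E) : Γ.attach (.inr (e, 1)) = .inl (Γ.ends e true) := by
  simp [attach]

theorem attach_interior (e : Γ.E) {t : unitInterval} (h0 : t ≠ 0) (h1 : t ≠ 1) :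
    Γ.attach (.inr (e, t)) = .inr (e, t) := by
  simp [attach, h0, h1]

/-- The parameter of the point at distance `s` from the end `b` of an edge. -/
def fromEnd (b : Bool) (s : unitInterval) : unitInterval := if b then unitInterval.symm s else s

theorem continuous_fromEnd (b : Bool) : Continuous (fromEnd b) := by
  cases b
  · exact continuous_id
  · exact unitInterval.continuous_symm

/-- The half-edge `h = (e, b)`, of length `ρ`, as an open subset of the space of the graph: the
points of `e` at distance strictly between `0` and `ρ` from the end `b`. -/
def halfEdge (ρ : ℝ) (h : Γ.E × Bool) : Set Γ.Space :=
  {p | ∃ s : unitInterval, 0 < (s : ℝ) ∧ (s : ℝ) < ρ ∧ p = pt h.1 (fromEnd h.2 s)}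

end FinGraph

open FinGraph

/-- An embedding of graphs: an injective map on vertices and on edges that preserves incidence.
The edge `e` goes to the edge `onE e`, with its direction reversed if `flip e` holds. The graph
automorphisms are among these. -/
structure GraphEmbedding (Γ Γ' : FinGraph.{u}) where
  onV : Γ.V → Γ'.V
  onE : Γ.E → Γ'.E
  flip : Γ.E → Bool
  injV : Injective onV
  injE : Injective onE
  incidence : ∀ e b, Γ'.ends (onE e) (xor b (flip e)) = onV (Γ.ends e b)

namespace GraphEmbedding

variable {Γ Γ' : FinGraph.{u}} (f : GraphEmbedding Γ Γ')

/-- The induced map on half-edges. -/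
def onHalf (h : Γ.E × Bool) : Γ'.E × Bool := (f.onE h.1, xor h.2 (f.flip h.1))

def onPieces : Γ.Pieces → Γ'.Pieces
  | .inl w => .inl (f.onV w)
  | .inr (e, t) => .inr (f.onE e, fromEnd (f.flip e) t)

theorem attach_onPieces (x : Γ.Pieces) :
    Γ'.attach (f.onPieces x) = f.onPieces (Γ.attach x) := by
  rcases x with w | ⟨e, t⟩
  · rfl
  · by_cases h0 : t = 0
    · subst h0
      rw [attach_zero]
      have := f.incidence e false
      cases hf : f.flip e <;> simp [hf, onPieces, fromEnd, attach_zero, attach_one] at this ⊢ <;>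
        exact this
    by_cases h1 : t = 1
    · subst h1
      rw [attach_one]
      have := f.incidence e true
      cases hf : f.flip e <;> simp [hf, onPieces, fromEnd, attach_zero, attach_one] at this ⊢ <;>
        exact this
    · rw [attach_interior e h0 h1]
      simp only [onPieces]
      apply attach_interior
      · cases hf : f.flip e
        · simpa [fromEnd] using h0
        · simpa [fromEnd] using h1
      · cases hf : f.flip e
        · simpa [fromEnd] using h1
        · simpa [fromEnd] using h0

theorem fromEnd_injective (b : Bool) : Injective (fromEnd b) := by
  cases b
  · exact fun _ _ h => h
  · exact fun x y h => by simpa [fromEnd] using h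

theorem onPieces_injective : Injective f.onPieces := by
  rintro (w | ⟨e, t⟩) (w' | ⟨e', t'⟩) h
  · simp only [onPieces, Sum.inl.injEq] at h
    rw [f.injV h]
  · simp [onPieces] at h
  · simp [onPieces] at h
  · simp only [onPieces, Sum.inr.injEq, Prod.mk.injEq] at h
    obtain rfl := f.injE h.1
    rw [fromEnd_injective _ h.2]

/-- The induced embedding of spaces. -/
def onSpace : C(Γ.Space, Γ'.Space) where
  toFun := Quotient.lift (fun x => proj (f.onPieces x)) (by
    intro x y h
    have h' : Γ.attach x = Γ.attach y := h
    rw [proj_eq, attach_onPieces, attach_onPieces, h'])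
  continuous_toFun := by
    refine Continuous.quotient_lift ?_ _
    refine isQuotientMap_proj.continuous.comp (continuous_sum_dom.2 ⟨?_, ?_⟩)
    · exact continuous_inl.comp continuous_of_discreteTopology
    · refine continuous_inr.comp (f := fun x : Γ.E × unitInterval =>
        (f.onE x.1, fromEnd (f.flip x.1) x.2)) ?_
      exact continuous_prod_of_discrete_left.2 fun e =>
        (continuous_const (y := f.onE e)).prodMk (continuous_fromEnd (f.flip e))

theorem onSpace_proj (x : Γ.Pieces) : f.onSpace (proj x) = proj (f.onPieces x) := rfl

theorem onSpace_injective : Injective f.onSpace := by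
  intro p q h
  obtain ⟨x, rfl⟩ := isQuotientMap_proj.surjective p
  obtain ⟨y, rfl⟩ := isQuotientMap_proj.surjective q
  rw [onSpace_proj, onSpace_proj, proj_eq, attach_onPieces, attach_onPieces] at h
  exact proj_eq.2 (f.onPieces_injective h)

end GraphEmbedding

/-- The space of ordered configurations of points of `X` with labels in `ι`; the space of ordered
configurations of `n` points is the case `ι = Fin n`. -/
def Conf (ι : Type*) (X : Type*) : Type _ := {x : ι → X // Injective x}

namespace Conf

variable {ι ι' X Y : Type*} [TopologicalSpace X] [TopologicalSpace Y]

instance : TopologicalSpace (Conf ι X) := inferInstanceAs (TopologicalSpace {x : ι → X // _})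

/-- The symmetric group acts by permuting the labels. -/
instance {X : Type*} : MulAction (Equiv.Perm ι) (Conf ι X) where
  smul σ x := ⟨fun j => x.1 (σ⁻¹ j), x.2.comp (σ⁻¹).injective⟩
  one_smul _ := rfl
  mul_smul σ τ x := Subtype.ext (funext fun j => by
    change x.1 ((σ * τ)⁻¹ j) = x.1 (τ⁻¹ (σ⁻¹ j))
    rw [mul_inv_rev]; rfl)

/-- Applies the injective continuous map `f` to all points, and the bijection `σ` to the labels. -/
def map (f : C(X, Y)) (hf : Injective f) (σ : ι ≃ ι') : C(Conf ι X, Conf ι' Y) where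
  toFun x := ⟨fun j => f (x.1 (σ.symm j)), hf.comp (x.2.comp σ.symm.injective)⟩
  continuous_toFun := Continuous.subtype_mk (continuous_pi fun j =>
    f.continuous.comp ((continuous_apply _).comp continuous_subtype_val)) _

open Classical in
/-- Applies `f` to all points and adds the point `a`, with the label `k`. -/
def insert (k : ι) (f : C(X, Y)) (hf : Injective f) (a : Y) (ha : ∀ x, f x ≠ a) :
    C(Conf {j : ι // j ≠ k} X, Conf ι Y) where
  toFun x := ⟨fun j => if h : j = k then a else f (x.1 ⟨j, h⟩), by
    intro i j hij
    by_cases hi : i = k <;> by_cases hj : j = k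
    · rw [hi, hj]
    · simp only [hi, hj, dite_true, dite_false] at hij
      exact absurd hij.symm (ha _)
    · simp only [hi, hj, dite_true, dite_false] at hij
      exact absurd hij (ha _)
    · simp only [hi, hj, dite_false] at hij
      exact congrArg Subtype.val (x.2 (hf hij))⟩
  continuous_toFun := by
    refine Continuous.subtype_mk (continuous_pi fun j => ?_) _
    by_cases h : j = k
    · simp only [h, dite_true]
      exact continuous_const
    · simp only [h, dite_false]
      exact f.continuous.comp ((continuous_apply _).comp continuous_subtype_val)

end Conf

/-- The space of unordered configurations of `n` points: the quotient of the space of ordered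
configurations by the symmetric group. -/
abbrev UConf (n : ℕ) (X : Type*) [TopologicalSpace X] : Type _ :=
  MulAction.orbitRel.Quotient (Equiv.Perm (Fin n)) (Conf (Fin n) X)

namespace UConf

variable {n : ℕ} {X Y : Type*} [TopologicalSpace X] [TopologicalSpace Y]

/-- Applies the injective continuous map `f` to all points. -/
def map (f : C(X, Y)) (hf : Injective f) : C(UConf n X, UConf n Y) where
  toFun := Quotient.map (Conf.map f hf (Equiv.refl _)) (by
    rintro x y ⟨σ, rfl⟩
    exact ⟨σ, rfl⟩)
  continuous_toFun := Continuous.quotient_map' (Conf.map f hf _).continuous _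

/-- Applies `f` to all points and adds the point `a` to the configuration. -/
def insert (f : C(X, Y)) (hf : Injective f) (a : Y) (ha : ∀ x, f x ≠ a) :
    C(UConf n X, UConf (n + 1) Y) where
  toFun := Quotient.map (fun x => ⟨Fin.cons a fun j => f (x.1 j),
      Fin.cons_injective_iff.2 ⟨by rintro ⟨j, hj⟩; exact ha _ hj, hf.comp x.2⟩⟩) (by
    rintro x y ⟨σ, rfl⟩
    refine ⟨Equiv.Perm.decomposeFin.symm (0, σ), Subtype.ext (funext fun j => ?_)⟩
    obtain ⟨j, rfl⟩ := (Equiv.Perm.decomposeFin.symm (0, σ)).surjective j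
    change Fin.cons (α := fun _ => Y) a (fun j => f (y.1 j))
      ((Equiv.Perm.decomposeFin.symm (0, σ)).symm (Equiv.Perm.decomposeFin.symm (0, σ) j)) = _
    rw [Equiv.symm_apply_apply]
    refine Fin.cases ?_ (fun j => ?_) j
    · simp
    · rw [Equiv.Perm.decomposeFin_symm_apply_succ]
      simp only [Equiv.swap_self, Equiv.refl_apply, Fin.cons_succ]
      change f (y.1 j) = f (y.1 (σ.symm (σ j)))
      rw [Equiv.symm_apply_apply])
  continuous_toFun := by
    refine Continuous.quotient_map' (Continuous.subtype_mk (continuous_pi fun j => ?_) _) _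
    refine Fin.cases ?_ (fun j => ?_) j
    · simp only [Fin.cons_zero]
      exact continuous_const
    · simp only [Fin.cons_succ]
      exact f.continuous.comp ((continuous_apply _).comp continuous_subtype_val)

end UConf

/-! ## Deletion of half-edges -/

/-- A finite graph with a vertex `v` and a set `H` of half-edges incident on `v`. The half-edges are
regarded as open intervals of length `ρ`, where `0 < ρ ≤ 1/2`; the length `1/2` is not allowed if
`H` contains both half-edges of a loop (their removal would leave a single point of the loop). -/
structure HalfEdgeData where
  Γ : FinGraph.{u}
  v : Γ.V
  H : Finset (Γ.E × Bool)
  incident : ∀ h ∈ H, Γ.ends h.1 h.2 = v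
  ρ : ℝ
  ρ_pos : 0 < ρ
  ρ_le : ρ ≤ 1 / 2
  loops : ∀ e, (e, false) ∈ H → (e, true) ∈ H → ρ < 1 / 2

namespace HalfEdgeData

variable (D : HalfEdgeData.{u})

/-- `Γ ∖ ∪H`: the graph with the (open) half-edges in `H` removed. -/
abbrev Deleted : Type u := {p : D.Γ.Space // ∀ h ∈ D.H, p ∉ halfEdge D.ρ h}

/-- `Γ ∖ {v}`: the graph with the vertex `v` removed. -/
abbrev Punctured : Type u := {p : D.Γ.Space // p ≠ vert D.v}

open Classical in
/-- The length that is removed from the edge `e` at its end `b`. -/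
def cut (e : D.Γ.E) (b : Bool) : ℝ := if (e, b) ∈ D.H then D.ρ else 0

theorem cut_nonneg (e : D.Γ.E) (b : Bool) : 0 ≤ D.cut e b := by
  unfold cut
  split_ifs
  · exact D.ρ_pos.le
  · exact le_rfl

theorem cut_le (e : D.Γ.E) (b : Bool) : D.cut e b ≤ 1 / 2 := by
  unfold cut
  split_ifs
  · exact D.ρ_le
  · norm_num

theorem cut_add_lt (e : D.Γ.E) : D.cut e false + D.cut e true < 1 := by
  have h1 := D.ρ_le
  unfold cut
  split_ifs with h h'
  · linarith [D.loops e h h']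
  all_goals linarith

/-- The affine bijection from `[0, 1]` to the part `[cut e false, 1 - cut e true]` of `e`. -/
def shrink (e : D.Γ.E) (t : unitInterval) : unitInterval :=
  ⟨D.cut e false + (1 - D.cut e false - D.cut e true) * t, by
    have h0 := D.cut_nonneg e false
    have h1 := D.cut_nonneg e true
    have h2 := D.cut_add_lt e
    have := t.2.1
    have := t.2.2
    constructor <;> nlinarith⟩

theorem continuous_shrink (e : D.Γ.E) : Continuous (D.shrink e) := by
  unfold shrink
  fun_prop

def shrinkPieces : D.Γ.Pieces → D.Γ.Pieces
  | .inl w => .inl w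
  | .inr (e, t) => .inr (e, D.shrink e t)

/-- The map `Γ ∖ {v} → Γ`, extended to `v ↦ v` without continuity there, that fixes the vertices
and shrinks every edge affinely and away from `v` to the part of it that is not removed. -/
def shrinkFun : D.Γ.Space → D.Γ.Space :=
  Quotient.lift (fun x => proj (D.shrinkPieces (D.Γ.attach x))) (by
    intro x y h
    have h' : D.Γ.attach x = D.Γ.attach y := h
    rw [h'])

theorem shrinkFun_proj (x : D.Γ.Pieces) :
    D.shrinkFun (proj x) = proj (D.shrinkPieces (D.Γ.attach x)) := rfl

theorem cut_eq_zero {e : D.Γ.E} {b : Bool} (h : D.Γ.ends e b ≠ D.v) : D.cut e b = 0 :=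
  if_neg fun h' => h (D.incident _ h')

/-- Every point is a vertex or lies in the interior of an edge. -/
theorem exists_rep (p : D.Γ.Space) : (∃ w, p = vert w) ∨
    ∃ e, ∃ t : unitInterval, t ≠ 0 ∧ t ≠ 1 ∧ p = pt e t := by
  obtain ⟨w | ⟨e, t⟩, rfl⟩ := isQuotientMap_proj.surjective p
  · exact .inl ⟨w, rfl⟩
  by_cases h0 : t = 0
  · subst h0
    exact .inl ⟨D.Γ.ends e false, proj_eq.2 (by rw [attach_zero]; rfl)⟩
  by_cases h1 : t = 1
  · subst h1
    exact .inl ⟨D.Γ.ends e true, proj_eq.2 (by rw [attach_one]; rfl)⟩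
  exact .inr ⟨e, t, h0, h1, rfl⟩

theorem shrinkFun_vert (w : D.Γ.V) : D.shrinkFun (vert w) = vert w := rfl

theorem shrinkFun_pt (e : D.Γ.E) {t : unitInterval} (h0 : t ≠ 0) (h1 : t ≠ 1) :
    D.shrinkFun (pt e t) = pt e (D.shrink e t) := by
  change proj (D.shrinkPieces (D.Γ.attach (.inr (e, t)))) = _
  rw [attach_interior e h0 h1]
  rfl

theorem pt_ne_vert (e : D.Γ.E) {t : unitInterval} (h0 : t ≠ 0) (h1 : t ≠ 1) (w : D.Γ.V) :
    pt e t ≠ vert w := by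
  intro h
  have := proj_eq.1 h
  rw [attach_interior e h0 h1] at this
  simp [attach] at this

theorem pt_inj {e e' : D.Γ.E} {t t' : unitInterval} (h0 : t ≠ 0) (h1 : t ≠ 1)
    (h : pt e' t' = pt e t) : e' = e ∧ t' = t := by
  have := proj_eq.1 h
  rw [attach_interior e h0 h1] at this
  by_cases h0' : t' = 0
  · subst h0'
    rw [attach_zero] at this
    simp at this
  by_cases h1' : t' = 1
  · subst h1'
    rw [attach_one] at this
    simp at this
  rw [attach_interior e' h0' h1'] at this
  simpa using this

theorem interior_iff {t : unitInterval} : (t ≠ 0 ∧ t ≠ 1) ↔ 0 < (t : ℝ) ∧ (t : ℝ) < 1 := by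
  constructor
  · rintro ⟨h0, h1⟩
    exact ⟨unitInterval.pos_iff_ne_zero.2 h0, unitInterval.lt_one_iff_ne_one.2 h1⟩
  · rintro ⟨h0, h1⟩
    exact ⟨unitInterval.pos_iff_ne_zero.1 h0, unitInterval.lt_one_iff_ne_one.1 h1⟩

theorem shrink_mem (e : D.Γ.E) {t : unitInterval} (h0 : t ≠ 0) (h1 : t ≠ 1) :
    D.cut e false < (D.shrink e t : ℝ) ∧ (D.shrink e t : ℝ) < 1 - D.cut e true := by
  obtain ⟨h0', h1'⟩ := interior_iff.1 ⟨h0, h1⟩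
  have h2 := D.cut_add_lt e
  change _ < D.cut e false + (1 - D.cut e false - D.cut e true) * (t : ℝ) ∧
    D.cut e false + (1 - D.cut e false - D.cut e true) * (t : ℝ) < _
  constructor <;> nlinarith

theorem shrink_interior (e : D.Γ.E) {t : unitInterval} (h0 : t ≠ 0) (h1 : t ≠ 1) :
    D.shrink e t ≠ 0 ∧ D.shrink e t ≠ 1 := by
  have := D.shrink_mem e h0 h1
  have := D.cut_nonneg e false
  have := D.cut_nonneg e true
  exact interior_iff.2 ⟨by linarith, by linarith⟩

/-- A point of `e` lies in `Γ ∖ ∪H` if it is not within the removed distance from the ends. -/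
theorem pt_notMem (e : D.Γ.E) (t : unitInterval) (h0 : D.cut e false ≤ t)
    (h1 : (t : ℝ) ≤ 1 - D.cut e true) : ∀ h ∈ D.H, (pt e t : D.Γ.Space) ∉ halfEdge D.ρ h := by
  rintro ⟨e', b⟩ hh ⟨s, hs0, hs1, hs⟩
  have hρ := D.ρ_le
  have hs' : s ≠ 0 ∧ s ≠ 1 := interior_iff.2 ⟨hs0, by linarith⟩
  have hi : fromEnd b s ≠ 0 ∧ fromEnd b s ≠ 1 := by
    cases b
    · simpa [fromEnd] using hs'
    · simpa [fromEnd] using hs'.symm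
  obtain ⟨rfl, rfl⟩ := D.pt_inj hi.1 hi.2 hs
  cases b
  · have hc : D.cut e false = D.ρ := if_pos hh
    simp only [fromEnd, Bool.false_eq_true, if_false] at h0
    linarith
  · have hc : D.cut e true = D.ρ := if_pos hh
    simp only [fromEnd, if_true, unitInterval.coe_symm_eq] at h1
    linarith

theorem vert_notMem (w : D.Γ.V) : ∀ h ∈ D.H, (vert w : D.Γ.Space) ∉ halfEdge D.ρ h := by
  rintro ⟨e', b⟩ _ ⟨s, hs0, hs1, hs⟩
  have hρ := D.ρ_le
  have hs' : s ≠ 0 ∧ s ≠ 1 := interior_iff.2 ⟨hs0, by linarith⟩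
  refine D.pt_ne_vert e' (t := fromEnd b s) ?_ ?_ w hs.symm
  · cases b
    · simpa [fromEnd] using hs'.1
    · simpa [fromEnd] using hs'.2
  · cases b
    · simpa [fromEnd] using hs'.2
    · simpa [fromEnd] using hs'.1

theorem shrinkFun_notMem (p : D.Γ.Space) : ∀ h ∈ D.H, D.shrinkFun p ∉ halfEdge D.ρ h := by
  rcases D.exists_rep p with ⟨w, rfl⟩ | ⟨e, t, h0, h1, rfl⟩
  · exact D.vert_notMem w
  · rw [D.shrinkFun_pt e h0 h1]
    have := D.shrink_mem e h0 h1
    exact D.pt_notMem e _ this.1.le this.2.le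

theorem shrinkFun_injective : Injective D.shrinkFun := by
  intro p q h
  rcases D.exists_rep p with ⟨w, rfl⟩ | ⟨e, t, h0, h1, rfl⟩ <;>
    rcases D.exists_rep q with ⟨w', rfl⟩ | ⟨e', t', h0', h1', rfl⟩
  · exact h
  · rw [D.shrinkFun_vert, D.shrinkFun_pt e' h0' h1'] at h
    exact absurd h.symm
      (D.pt_ne_vert e' (D.shrink_interior e' h0' h1').1 (D.shrink_interior e' h0' h1').2 w)
  · rw [D.shrinkFun_vert, D.shrinkFun_pt e h0 h1] at h
    exact absurd h
      (D.pt_ne_vert e (D.shrink_interior e h0 h1).1 (D.shrink_interior e h0 h1).2 w')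
  · rw [D.shrinkFun_pt e h0 h1, D.shrinkFun_pt e' h0' h1'] at h
    have hi := D.shrink_interior e' h0' h1'
    obtain ⟨rfl, ht⟩ := D.pt_inj hi.1 hi.2 h
    have h2 := D.cut_add_lt e
    have ht' : D.cut e false + (1 - D.cut e false - D.cut e true) * (t : ℝ) =
      D.cut e false + (1 - D.cut e false - D.cut e true) * (t' : ℝ) := congrArg Subtype.val ht
    have : (t : ℝ) = t' := by
      have h3 : (1 - D.cut e false - D.cut e true) ≠ 0 := by linarith
      exact mul_left_cancel₀ h3 (by linarith)
    rw [Subtype.ext this]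

theorem shrinkFun_ne (p : D.Punctured) : D.shrinkFun p.1 ≠ vert D.v := fun h =>
  p.2 (D.shrinkFun_injective (h.trans (D.shrinkFun_vert D.v).symm))

theorem isOpen_punctured : IsOpen {p : D.Γ.Space | p ≠ vert D.v} := by
  rw [← isQuotientMap_proj.isOpen_preimage, ← isClosed_compl_iff]
  have : (proj ⁻¹' {p : D.Γ.Space | p ≠ vert D.v})ᶜ = Sum.inl '' {D.v} ∪ Sum.inr ''
      ((⋃ e ∈ {e | D.Γ.ends e false = D.v}, {(e, 0)}) ∪
        ⋃ e ∈ {e | D.Γ.ends e true = D.v}, {(e, (1 : unitInterval))}) := by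
    ext x
    rcases x with w | ⟨e, t⟩
    · simp [vert, proj_eq, attach]
    · by_cases h0 : t = 0
      · subst h0
        simp [vert, proj_eq, attach]
      · by_cases h1 : t = 1
        · subst h1
          simp [vert, proj_eq, attach]
        · simp [vert, proj_eq, attach, h0, h1]
  rw [this]
  refine .union (isClosedMap_inl _ isClosed_singleton) (isClosedMap_inr _ (.union ?_ ?_))
  · exact (toFinite _).isClosed_biUnion fun _ _ => isClosed_singleton
  · exact (toFinite _).isClosed_biUnion fun _ _ => isClosed_singleton

theorem continuousOn_shrinkFun : ContinuousOn D.shrinkFun {p | p ≠ vert D.v} := by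
  have hq := isQuotientMap_proj (Γ := D.Γ)
  rw [hq.continuousOn_isOpen_iff D.isOpen_punctured]
  have hc : Continuous fun x : D.Γ.Pieces => (proj (D.shrinkPieces x) : D.Γ.Space) := by
    refine hq.continuous.comp (continuous_sum_dom.2 ⟨continuous_inl, ?_⟩)
    refine continuous_inr.comp (f := fun x : D.Γ.E × unitInterval => (x.1, D.shrink x.1 x.2)) ?_
    refine continuous_prod_of_discrete_left.2 fun e => ?_
    exact continuous_const.prodMk (D.continuous_shrink e)
  refine hc.continuousOn.congr ?_
  rintro (w | ⟨e, t⟩) hx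
  · rfl
  change proj (D.shrinkPieces (D.Γ.attach (.inr (e, t)))) = _
  by_cases h0 : t = 0
  · subst h0
    have hv : D.Γ.ends e false ≠ D.v := fun h => hx (proj_eq.2 (by rw [attach_zero, h]; rfl))
    have : D.shrink e 0 = 0 := Subtype.ext (by simp [shrink, D.cut_eq_zero hv])
    rw [attach_zero]
    simp only [shrinkPieces, this]
    exact proj_eq.2 (by rw [attach_zero]; rfl)
  by_cases h1 : t = 1
  · subst h1
    have hv : D.Γ.ends e true ≠ D.v := fun h => hx (proj_eq.2 (by rw [attach_one, h]; rfl))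
    have : D.shrink e 1 = 1 := Subtype.ext (by simp [shrink, D.cut_eq_zero hv])
    rw [attach_one]
    simp only [shrinkPieces, this]
    exact proj_eq.2 (by rw [attach_one]; rfl)
  rw [attach_interior e h0 h1]

/-- The embedding `Γ ∖ {v} → Γ ∖ ∪H`, isotopic to the identity in `Γ ∖ {v}`, that moves the points
on the edges of the half-edges in `H` away from `v` by shrinking these edges. -/
def shrinkMap : C(D.Punctured, D.Deleted) where
  toFun p := ⟨D.shrinkFun p.1, D.shrinkFun_notMem p.1⟩
  continuous_toFun := Continuous.subtype_mk
    (continuousOn_iff_continuous_domRestrict.1 D.continuousOn_shrinkFun) _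

theorem shrinkMap_injective : Injective D.shrinkMap := fun _ _ h =>
  Subtype.ext (D.shrinkFun_injective (congrArg Subtype.val h))

/-- The vertex `v`, as a point of `Γ ∖ ∪H`. -/
def vertexPt : D.Deleted := ⟨vert D.v, D.vert_notMem D.v⟩

theorem shrinkMap_ne_vertexPt (p : D.Punctured) : D.shrinkMap p ≠ D.vertexPt := fun h =>
  D.shrinkFun_ne p (congrArg Subtype.val h)

/-- The number `ρ`, as an element of `[0, 1]`. -/
def ρI : unitInterval := ⟨D.ρ, D.ρ_pos.le, by linarith [D.ρ_le]⟩

theorem endPt_notMem (h : D.H) :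
    ∀ h' ∈ D.H, (pt h.1.1 (fromEnd h.1.2 D.ρI) : D.Γ.Space) ∉ halfEdge D.ρ h' := by
  obtain ⟨⟨e, b⟩, hh⟩ := h
  have hρ := D.ρ_le
  cases b
  · have hc : D.cut e false = D.ρ := if_pos hh
    have := D.cut_le e true
    exact D.pt_notMem e _ hc.le (by change D.ρ ≤ _; linarith)
  · have hc : D.cut e true = D.ρ := if_pos hh
    have := D.cut_le e false
    exact D.pt_notMem e _ (by change _ ≤ 1 - D.ρ; linarith) (by change 1 - D.ρ ≤ _; linarith)

/-- The end point of the half-edge `h ∈ H` opposite to `v`. It is the point of `Γ ∖ ∪H` on the edge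
of `h` that comes first, starting from `v` along `h`. -/
def endPt (h : D.H) : D.Deleted := ⟨pt h.1.1 (fromEnd h.1.2 D.ρI), D.endPt_notMem h⟩

theorem shrinkMap_ne_endPt (h : D.H) (p : D.Punctured) : D.shrinkMap p ≠ D.endPt h := by
  intro hp
  have hp' : D.shrinkFun p.1 = pt h.1.1 (fromEnd h.1.2 D.ρI) := congrArg Subtype.val hp
  obtain ⟨⟨e, b⟩, hh⟩ := h
  have hρ := D.ρ_le
  have hρ0 := D.ρ_pos
  have hi : fromEnd b D.ρI ≠ 0 ∧ fromEnd b D.ρI ≠ 1 := by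
    apply interior_iff.2
    cases b
    · exact ⟨hρ0, by change D.ρ < 1; linarith⟩
    · exact ⟨by change 0 < 1 - D.ρ; linarith, by change 1 - D.ρ < 1; linarith⟩
  rcases D.exists_rep p.1 with ⟨w, hw⟩ | ⟨e', t, h0, h1, ht⟩
  · rw [hw, D.shrinkFun_vert] at hp'
    exact D.pt_ne_vert e hi.1 hi.2 w hp'.symm
  · rw [ht, D.shrinkFun_pt e' h0 h1] at hp'
    obtain ⟨rfl, h2⟩ := D.pt_inj hi.1 hi.2 hp'
    have h3 := D.shrink_mem e' h0 h1
    rw [h2] at h3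
    cases b
    · have hc : D.cut e' false = D.ρ := if_pos hh
      rw [hc] at h3
      exact lt_irrefl _ h3.1
    · have hc : D.cut e' true = D.ρ := if_pos hh
      rw [hc] at h3
      exact lt_irrefl _ h3.2

/-- The inclusion `Γ ∖ ∪H → Γ`. -/
def deletedIncl : C(D.Deleted, D.Γ.Space) := ⟨Subtype.val, continuous_subtype_val⟩

theorem deletedIncl_injective : Injective D.deletedIncl := Subtype.val_injective

end HalfEdgeData

/-! ## The long exact sequences -/

/-- The spaces and maps that enter a long exact sequence
`… → Eⁱ(X) → Eⁱ(A) → ⨁ⱼ Eⁱ(Yⱼ) → Eⁱ⁺¹(X) → …`,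
where the first map is induced by `inc : A → X` and the second one is `⨁ⱼ (pⱼ^* - qⱼ^*)`. -/
structure SequenceDiagram where
  X : Type u
  A : Type u
  J : Type u
  Y : J → Type u
  [topX : TopologicalSpace X]
  [topA : TopologicalSpace A]
  [topY : ∀ j, TopologicalSpace (Y j)]
  [finJ : Fintype J]
  inc : C(A, X)
  p : ∀ j, C(Y j, A)
  q : ∀ j, C(Y j, A)

namespace SequenceDiagram

attribute [instance] topX topA topY finJ

/-- Maps between the spaces of two diagrams. The map `idx` of the index sets is only partially
defined; where it is undefined, the summand is sent to `0`. No commutativity is required. -/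
structure Hom (S S' : SequenceDiagram.{u}) where
  onX : C(S.X, S'.X)
  onA : C(S.A, S'.A)
  idx : S.J → Option S'.J
  onY : ∀ j j', idx j = some j' → C(S.Y j, S'.Y j')

/-- The homomorphism `⨁ⱼ (pⱼ^* - qⱼ^*) : Eⁱ(A) → ⨁ⱼ Eⁱ(Yⱼ)`. -/
def codiff (S : SequenceDiagram.{u}) (E : CohomologyTheory.{u, w}) (i : ℤ) :
    E.abs i S.A →+ ∀ j, E.abs i (S.Y j) :=
  AddMonoidHom.pi fun j => E.pull i (S.p j) - E.pull i (S.q j)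

/-- The homomorphism `⨁ⱼ ((pⱼ)_* - (qⱼ)_*) : ⨁ⱼ Eᵢ(Yⱼ) → Eᵢ(A)`. -/
def diff (S : SequenceDiagram.{u}) (E : HomologyTheory.{u, w}) (i : ℤ) :
    (∀ j, E.abs i (S.Y j)) →+ E.abs i S.A :=
  ∑ j, (E.push i (S.p j) - E.push i (S.q j)).comp (Pi.evalAddMonoidHom _ j)

/-- The classes `y' ∈ ⨁ Eⁱ(Y'ⱼ)` and `y ∈ ⨁ Eⁱ(Yⱼ)` correspond under the homomorphism
`⨁ Eⁱ(Y'ⱼ) → ⨁ Eⁱ(Yⱼ)` induced by the maps `m`. -/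
def Hom.Pulls {S S' : SequenceDiagram.{u}} (m : Hom S S') (E : CohomologyTheory.{u, w}) (i : ℤ)
    (y' : ∀ j', E.abs i (S'.Y j')) (y : ∀ j, E.abs i (S.Y j)) : Prop :=
  ∀ j, (∀ j' (h : m.idx j = some j'), y j = E.pull i (m.onY j j' h) (y' j')) ∧
    (m.idx j = none → y j = 0)

open Classical in
/-- The homomorphism `⨁ Eᵢ(Yⱼ) → ⨁ Eᵢ(Y'ⱼ)` induced by the maps `m`. -/
def Hom.pushSum {S S' : SequenceDiagram.{u}} (m : Hom S S') (E : HomologyTheory.{u, w}) (i : ℤ)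
    (y : ∀ j, E.abs i (S.Y j)) : ∀ j', E.abs i (S'.Y j') :=
  fun j' => ∑ j, if h : m.idx j = some j' then E.push i (m.onY j j' h) (y j) else 0

end SequenceDiagram

/-- Long exact sequences in every generalized cohomology theory, for all members `S a` of a family
of diagrams, that are natural with respect to the given maps `m f` between the diagrams, and
compatible with cohomology operations. -/
structure CohomologySequence {𝓘 : Type*} {Mor : 𝓘 → 𝓘 → Type*} (S : 𝓘 → SequenceDiagram.{u})
    (m : ∀ {a b}, Mor a b → (S a).Hom (S b)) where
  /-- The connecting homomorphism. -/
  d : ∀ (E : CohomologyTheory.{u, w}) (a : 𝓘) (i : ℤ),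
    (∀ j, E.abs i ((S a).Y j)) →+ E.abs (i + 1) (S a).X
  exact_A : ∀ (E : CohomologyTheory.{u, w}) a i, Exact (E.pull i (S a).inc) ((S a).codiff E i)
  exact_Y : ∀ (E : CohomologyTheory.{u, w}) a i, Exact ((S a).codiff E i) (d E a i)
  exact_X : ∀ (E : CohomologyTheory.{u, w}) a i, Exact (d E a i) (E.pull (i + 1) (S a).inc)
  /-- The three squares of the map of long exact sequences induced by `m f` commute. -/
  natural_inc : ∀ (E : CohomologyTheory.{u, w}) a b (f : Mor a b) (i : ℤ) x,
    E.pull i (m f).onA (E.pull i (S b).inc x) = E.pull i (S a).inc (E.pull i (m f).onX x)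
  natural_codiff : ∀ (E : CohomologyTheory.{u, w}) a b (f : Mor a b) (i : ℤ) x,
    (m f).Pulls E i ((S b).codiff E i x) ((S a).codiff E i (E.pull i (m f).onA x))
  natural_d : ∀ (E : CohomologyTheory.{u, w}) a b (f : Mor a b) (i : ℤ) y' y, (m f).Pulls E i y' y →
    E.pull (i + 1) (m f).onX (d E b i y') = d E a i y
  /-- The three maps of the long exact sequence commute with cohomology operations. For the
  connecting homomorphism, which raises the degree, this refers to two operations in consecutive
  degrees that are compatible (up to a sign) with the coboundary of the theories. -/
  operation_inc : ∀ (E F : CohomologyTheory.{u, w}) (i k : ℤ) (θ : CohomologyOperation E F i k) a x,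
    θ.app _ (E.pull i (S a).inc x) = F.pull k (S a).inc (θ.app _ x)
  operation_codiff : ∀ (E F : CohomologyTheory.{u, w}) (i k : ℤ)
    (θ : CohomologyOperation E F i k), θ.Additive → ∀ a x j,
    θ.app _ ((S a).codiff E i x j) = (S a).codiff F k (θ.app _ x) j
  operation_d : ∀ (E F : CohomologyTheory.{u, w}) (i k : ℤ) (θ : CohomologyOperation E F i k)
    (θ' : CohomologyOperation E F (i + 1) (k + 1)) (ε : ℤˣ), θ.Compatible θ' ε → ∀ a y,
    θ'.app _ (d E a i y) = (ε : ℤ) • d F a k (fun j => θ.app _ (y j))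

/-- Long exact sequences `… → Eᵢ₊₁(X) → ⨁ⱼ Eᵢ(Yⱼ) → Eᵢ(A) → Eᵢ(X) → …` in every generalized
homology theory, for all members `S a` of a family of diagrams, that are natural with respect to
the given maps `m f` between the diagrams, and compatible with homology operations. -/
structure HomologySequence {𝓘 : Type*} {Mor : 𝓘 → 𝓘 → Type*} (S : 𝓘 → SequenceDiagram.{u})
    (m : ∀ {a b}, Mor a b → (S a).Hom (S b)) where
  /-- The connecting homomorphism. -/
  d : ∀ (E : HomologyTheory.{u, w}) (a : 𝓘) (i : ℤ),
    E.abs (i + 1) (S a).X →+ ∀ j, E.abs i ((S a).Y j)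
  exact_A : ∀ (E : HomologyTheory.{u, w}) a i, Exact ((S a).diff E i) (E.push i (S a).inc)
  exact_Y : ∀ (E : HomologyTheory.{u, w}) a i, Exact (d E a i) ((S a).diff E i)
  exact_X : ∀ (E : HomologyTheory.{u, w}) a i, Exact (E.push (i + 1) (S a).inc) (d E a i)
  /-- The three squares of the map of long exact sequences induced by `m f` commute. -/
  natural_inc : ∀ (E : HomologyTheory.{u, w}) a b (f : Mor a b) (i : ℤ) x,
    E.push i (m f).onX (E.push i (S a).inc x) = E.push i (S b).inc (E.push i (m f).onA x)
  natural_diff : ∀ (E : HomologyTheory.{u, w}) a b (f : Mor a b) (i : ℤ) y,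
    E.push i (m f).onA ((S a).diff E i y) = (S b).diff E i ((m f).pushSum E i y)
  natural_d : ∀ (E : HomologyTheory.{u, w}) a b (f : Mor a b) (i : ℤ) x,
    d E b i (E.push (i + 1) (m f).onX x) = (m f).pushSum E i (d E a i x)
  /-- The three maps of the long exact sequence commute with homology operations. -/
  operation_inc : ∀ (E F : HomologyTheory.{u, w}) (i k : ℤ) (θ : HomologyOperation E F i k) a x,
    θ.app _ (E.push i (S a).inc x) = F.push k (S a).inc (θ.app _ x)
  operation_diff : ∀ (E F : HomologyTheory.{u, w}) (i k : ℤ) (θ : HomologyOperation E F i k) a y,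
    θ.app _ ((S a).diff E i y) = (S a).diff F k (fun j => θ.app _ (y j))
  operation_d : ∀ (E F : HomologyTheory.{u, w}) (i k : ℤ) (θ : HomologyOperation E F i k)
    (θ' : HomologyOperation E F (i + 1) (k + 1)) (ε : ℤˣ), θ.Compatible θ' ε → ∀ a x j,
    θ.app _ (d E a i x j) = (ε : ℤ) • d F a k (θ'.app _ x) j

namespace HalfEdgeData

/-- The diagram
`UConf_n (Γ ∖ {v}) ⇉ UConf_{n+1} (Γ ∖ ∪H) → UConf_{n+1} (Γ)`,
with one copy of the space on the left for each `h ∈ H`. The map `p` is `add_v`, which adds the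
vertex `v` to a configuration, and `q` is `add_h`, which adds a new point to it that is the closest
one to `v` on the edge of `h`. Both first move the configuration into `Γ ∖ ∪H`, away from `v`. -/
def unordered (n : ℕ) (D : HalfEdgeData.{u}) : SequenceDiagram.{u} where
  X := UConf (n + 1) D.Γ.Space
  A := UConf (n + 1) D.Deleted
  J := D.H
  Y _ := UConf n D.Punctured
  inc := UConf.map D.deletedIncl D.deletedIncl_injective
  p _ := UConf.insert D.shrinkMap D.shrinkMap_injective D.vertexPt D.shrinkMap_ne_vertexPt
  q h := UConf.insert D.shrinkMap D.shrinkMap_injective (D.endPt h) (D.shrinkMap_ne_endPt h)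

/-- The diagram for ordered configurations of `n` points. Its left hand spaces are indexed by the
label `k` of the point that is added, and by `h ∈ H`; the space with index `(k, h)` consists of the
configurations in `Γ ∖ {v}` of `n - 1` points, with the labels different from `k`. Thus
`⨁ₖ Eⁱ(Yₖₕ)`, with the action of the symmetric group `S_n` that permutes the labels (see
`orderedHom`), is the representation of `S_n` induced from the representation of the stabilizer
`S_{n-1}` of a label on `Eⁱ(Conf_{n-1} (Γ ∖ {v}))`. -/
def ordered (n : ℕ) (D : HalfEdgeData.{u}) : SequenceDiagram.{u} where
  X := Conf (Fin n) D.Γ.Space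
  A := Conf (Fin n) D.Deleted
  J := Fin n × D.H
  Y kh := Conf {j : Fin n // j ≠ kh.1} D.Punctured
  inc := Conf.map D.deletedIncl D.deletedIncl_injective (Equiv.refl _)
  p kh := Conf.insert kh.1 D.shrinkMap D.shrinkMap_injective D.vertexPt D.shrinkMap_ne_vertexPt
  q kh := Conf.insert kh.1 D.shrinkMap D.shrinkMap_injective (D.endPt kh.2)
    (D.shrinkMap_ne_endPt kh.2)

/-- An embedding of graphs `Γ → Γ'` that takes `v` to `v'` and `Γ ∖ ∪H` into `Γ' ∖ ∪H'`. In
particular, `H'` may be the image of `H`, and `H` may be the set of all half-edges that go to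
`H'`. -/
structure Embedding (D D' : HalfEdgeData.{u}) extends GraphEmbedding D.Γ D'.Γ where
  map_v : onV D.v = D'.v
  mem_of_map_mem : ∀ h, toGraphEmbedding.onHalf h ∈ D'.H → h ∈ D.H
  ρ_le_ρ : D'.ρ ≤ D.ρ

namespace Embedding

variable {D D' : HalfEdgeData.{u}} (f : Embedding D D')

theorem onSpace_vert (w : D.Γ.V) : f.onSpace (vert w) = vert (f.onV w) := rfl

theorem onSpace_notMem {p : D.Γ.Space} (hp : ∀ h ∈ D.H, p ∉ halfEdge D.ρ h) :
    ∀ h' ∈ D'.H, f.onSpace p ∉ halfEdge D'.ρ h' := by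
  rintro ⟨e', b⟩ hh ⟨s, hs0, hs1, hs⟩
  have hρ := D'.ρ_le
  have hs' : s ≠ 0 ∧ s ≠ 1 := interior_iff.2 ⟨hs0, by linarith⟩
  have hi : fromEnd b s ≠ 0 ∧ fromEnd b s ≠ 1 := by
    cases b
    · simpa [fromEnd] using hs'
    · simpa [fromEnd] using hs'.symm
  rcases D.exists_rep p with ⟨w, rfl⟩ | ⟨e, t, h0, h1, rfl⟩
  · exact D'.pt_ne_vert e' hi.1 hi.2 _ hs.symm
  · have hs2 : pt (f.onE e) (fromEnd (f.flip e) t) = pt e' (fromEnd b s) := hs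
    obtain ⟨rfl, ht⟩ := D'.pt_inj hi.1 hi.2 hs2
    have ht' : t = fromEnd (xor b (f.flip e)) s := by
      apply GraphEmbedding.fromEnd_injective (f.flip e)
      rw [ht]
      cases b <;> cases f.flip e <;> simp [fromEnd]
    refine hp (e, xor b (f.flip e)) (f.mem_of_map_mem _ ?_) ⟨s, hs0, hs1.trans_le f.ρ_le_ρ, ?_⟩
    · simpa [GraphEmbedding.onHalf] using hh
    · rw [ht']

/-- The induced map `Γ ∖ ∪H → Γ' ∖ ∪H'`. -/
def onDeleted : C(D.Deleted, D'.Deleted) where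
  toFun p := ⟨f.onSpace p.1, f.onSpace_notMem p.2⟩
  continuous_toFun := Continuous.subtype_mk (f.onSpace.continuous.comp continuous_subtype_val) _

theorem onDeleted_injective : Injective f.onDeleted := fun _ _ h =>
  Subtype.ext (f.onSpace_injective (congrArg Subtype.val h))

/-- The induced map `Γ ∖ {v} → Γ' ∖ {v'}`. -/
def onPunctured : C(D.Punctured, D'.Punctured) where
  toFun p := ⟨f.onSpace p.1, fun h => p.2 (f.onSpace_injective (by
    rw [h, f.onSpace_vert, f.map_v]))⟩
  continuous_toFun := Continuous.subtype_mk (f.onSpace.continuous.comp continuous_subtype_val) _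

theorem onPunctured_injective : Injective f.onPunctured := fun _ _ h =>
  Subtype.ext (f.onSpace_injective (congrArg Subtype.val h))

open Classical in
/-- The induced map `H → H'`, where it is defined. -/
def onH (h : D.H) : Option D'.H :=
  if hh : f.onHalf h.1 ∈ D'.H then some ⟨f.onHalf h.1, hh⟩ else none

/-- The maps of the unordered configuration spaces induced by an embedding of graphs. -/
def unorderedHom (n : ℕ) : (D.unordered n).Hom (D'.unordered n) where
  onX := UConf.map f.onSpace f.onSpace_injective
  onA := UConf.map f.onDeleted f.onDeleted_injective
  idx := f.onH
  onY _ _ _ := UConf.map f.onPunctured f.onPunctured_injective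

theorem label_eq {n : ℕ} {σ : Equiv.Perm (Fin n)} {j : Fin n × D.H} {j' : Fin n × D'.H}
    (h : (f.onH j.2).map (fun h' => (σ j.1, h')) = some j') (i : Fin n) :
    i ≠ j.1 ↔ σ i ≠ j'.1 := by
  obtain ⟨h', _, rfl⟩ := Option.map_eq_some_iff.1 h
  exact not_congr σ.injective.eq_iff.symm

/-- The maps of the ordered configuration spaces induced by an embedding of graphs and by a
permutation `σ` of the labels. For the identity of a graph, these maps constitute the action of the
symmetric group; the summand of index `(k, h)` goes to the summand of index `(σ k, h)`. -/
def orderedHom (n : ℕ) (σ : Equiv.Perm (Fin n)) : (D.ordered n).Hom (D'.ordered n) where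
  onX := Conf.map f.onSpace f.onSpace_injective σ
  onA := Conf.map f.onDeleted f.onDeleted_injective σ
  idx j := (f.onH j.2).map fun h' => (σ j.1, h')
  onY _ _ h := Conf.map f.onPunctured f.onPunctured_injective (σ.subtypeEquiv (f.label_eq h))

end Embedding

end HalfEdgeData

end

/-! Let `X` be the configuration space of Γ and `A` that of Γ ∖ ∪H. The sequence is the exact
sequence of the pair `(X, A)`, once its relative group in degree `i + 1` is identified with the sum
of the groups of the `Yⱼ` in degree `i`. For every index `j` there is a track, a homotopy `Yⱼ × [0,
1] → X` in which the new point travels from `v` along the half-edge to its far end. Its two ends lie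
in `A` and are add_v and add_h, so it is a map of pairs from the cylinder relative to its ends.
Under the suspension isomorphism the coboundary of a cylinder is the difference of the values at the
two ends (`δ_cyl`), so the coboundary of `(X, A)` becomes the sum of the add_v^* − add_h^*
(`δ_pair`). What has to be shown is that restriction along the tracks is bijective on relative
groups; this is `Key`.

For `Key`, measure the distance to `v` in units of ρ/2 and truncate it at 1. Call a configuration
intermediate if some point in a half-edge of `H`, within ρ/2 of `v`, has between 1/3 and 2/3 of the
least distance of the other points. The configurations whose strictly nearest point to `v` lies
there, with given label and half-edge, form an open set that is the product of the space of the
other points with the interval (0, 1) of ratios (`isOpenMap_radial`). Up to relabelling these sets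
are disjoint open cylinders, and they contain all intermediate configurations. The remaining, good
configurations form an open set that deforms into `A`: a point of ratio at most 1/2 is contracted to
`v`, and all others flow outwards along the half-edges in `H`. The two rules meet at ratio 1/2,
where a good configuration has no point in `H`, and points near `v` outside `H` are fixed by both
(`continuous_deform`). The deformation does not create intermediate configurations
(`deform_not_intermediate`). Hence `(X, A)` may be replaced by `X` relative to the good part, and
excision and finite additivity reduce this to the open cylinders relative to their outer thirds
(`key_of_cylinders`). A homotopy in two stages (`stageOne`, `stageTwo`) connects these cylinders
with the tracks.

Homology follows by duality: characters with values in ℚ/ℤ turn a homology theory into a cohomology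
theory and detect bijectivity, so `Key` for the dual theory suffices. Naturality holds because
embeddings carry tracks to tracks up to homotopy of pairs (`Matches.compat`). Ordered and unordered
configurations are treated together, as quotients of ordered ones by a group of permutations of the
labels (`Presentation`). -/

noncomputable section

open SpacePair FinGraph

/-! ### Formal consequences of the axioms of a cohomology theory. -/

namespace CohomologyTheory

variable (E : CohomologyTheory.{u, w}) (i : ℤ)

theorem pull_comp {X Y Z : Type u} [TopologicalSpace X] [TopologicalSpace Y] [TopologicalSpace Z]
    (g : C(Y, Z)) (f : C(X, Y)) (x : E.abs i Z) :
    E.pull i (g.comp f) x = E.pull i f (E.pull i g x) :=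
  E.map_comp i (ofMap g) (ofMap f) x

theorem pull_id {X : Type u} [TopologicalSpace X] (x : E.abs i X) :
    E.pull i (ContinuousMap.id X) x = x :=
  E.map_id i (of X) x

/-- A map of pairs with a two-sided homotopy inverse induces bijections. -/
theorem bijective_of_homotopyEquiv {P Q : SpacePair.{u}} (f : SpacePair.Hom P Q)
    (g : SpacePair.Hom Q P)
    (h₁ : Homotopic (g.comp f) (SpacePair.Hom.id P))
    (h₂ : Homotopic (f.comp g) (SpacePair.Hom.id Q)) : Bijective (E.map i f) := by
  refine bijective_iff_has_inverse.2 ⟨E.map i g, fun x => ?_, fun x => ?_⟩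
  · rw [← E.map_comp, E.homotopy i _ _ h₂, E.map_id]
  · rw [← E.map_comp, E.homotopy i _ _ h₁, E.map_id]

theorem bijective_of_inverse {P Q : SpacePair.{u}} (f : SpacePair.Hom P Q)
    (g : SpacePair.Hom Q P) (h₁ : g.comp f = SpacePair.Hom.id P)
    (h₂ : f.comp g = SpacePair.Hom.id Q) : Bijective (E.map i f) := by
  refine bijective_iff_has_inverse.2 ⟨E.map i g, fun x => ?_, fun x => ?_⟩
  · rw [← E.map_comp, h₂, E.map_id]
  · rw [← E.map_comp, h₁, E.map_id]

theorem pull_homeomorph_bijective {X Y : Type u} [TopologicalSpace X] [TopologicalSpace Y]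
    (e : X ≃ₜ Y) : Bijective (E.pull i (e : C(X, Y))) := by
  refine bijective_iff_has_inverse.2 ⟨E.pull i (e.symm : C(Y, X)), fun x => ?_, fun x => ?_⟩
  · rw [← pull_comp]
    convert E.pull_id i x
    ext; simp
  · rw [← pull_comp]
    convert E.pull_id i x
    ext; simp

theorem δ_eq_zero_of_bijective (P : SpacePair.{u}) (h : Surjective (E.map i P.incl))
    (x : E.obj i (of P.A)) : E.δ i P x = 0 := by
  obtain ⟨y, rfl⟩ := h x
  exact (E.exact_sub i P).apply_apply_eq_zero y

/-- If the inclusion `A → X` induces bijections, then the groups of `(X, A)` vanish. -/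
theorem eq_zero_of_incl_bijective (P : SpacePair.{u}) (h : ∀ i, Bijective (E.map i P.incl))
    (x : E.obj i P) : x = 0 := by
  -- The coboundary lands in degrees of the form `k + 1`, so the degree has to be written this way
  -- before exactness applies.
  obtain ⟨k, rfl⟩ : ∃ k, i = k + 1 := ⟨i - 1, by ring⟩
  have h0 : E.map (k + 1) P.toRel x = 0 := by
    apply (h (k + 1)).1
    rw [map_zero, (E.exact_pair (k + 1) P).apply_apply_eq_zero]
  obtain ⟨a, rfl⟩ := (E.exact_rel k P x).1 h0
  exact E.δ_eq_zero_of_bijective k P (h k).2 a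

theorem incl_bijective_of_univ (P : SpacePair.{u}) (hP : P.A = univ) :
    Bijective (E.map i P.incl) := by
  have hm : ∀ x, x ∈ P.A := fun x => hP ▸ mem_univ x
  exact E.pull_homeomorph_bijective i
    { toFun := Subtype.val
      invFun := fun x => ⟨x, hm x⟩
      left_inv := fun _ => rfl
      right_inv := fun _ => rfl
      continuous_toFun := continuous_subtype_val
      continuous_invFun := by fun_prop : P.A ≃ₜ P.X }

theorem eq_zero_of_univ (P : SpacePair.{u}) (hP : P.A = univ) (x : E.obj i P) : x = 0 :=
  E.eq_zero_of_incl_bijective i P (fun i => E.incl_bijective_of_univ i P hP) x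

/-- A map of pairs that maps the whole space into the subspace induces zero. -/
theorem map_eq_zero {P Q : SpacePair.{u}} (f : SpacePair.Hom P Q) (hf : ∀ x, f.toMap x ∈ Q.A)
    (x : E.obj i Q) : E.map i f x = 0 := by
  -- The map factors through the pair of the whole space relative to itself, all of whose groups
  -- vanish.
  let R : SpacePair.{u} := ⟨P.X, univ⟩
  let g : SpacePair.Hom P R := ⟨ContinuousMap.id _, fun _ _ => mem_univ _⟩
  let h : SpacePair.Hom R Q := ⟨f.toMap, fun x _ => hf x⟩
  have : f = h.comp g := rfl
  rw [this, E.map_comp, E.eq_zero_of_univ i R rfl (E.map i h x), map_zero]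

/-- The five lemma for a map of pairs. -/
theorem bijective_of_abs {P Q : SpacePair.{u}} (f : SpacePair.Hom P Q)
    (hX : ∀ i, Bijective (E.pull i f.toMap)) (hA : ∀ i, Bijective (E.map i f.restrict)) :
    Bijective (E.map i f) := by
  obtain ⟨k, rfl⟩ : ∃ k, i = k + 1 := ⟨i - 1, by ring⟩
  refine AddMonoidHom.bijective_of_surjective_of_bijective_of_bijective_of_injective
    (E.map k Q.incl) (E.δ k Q) (E.map (k + 1) Q.toRel) (E.map (k + 1) Q.incl)
    (E.map k P.incl) (E.δ k P) (E.map (k + 1) P.toRel) (E.map (k + 1) P.incl)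
    (E.pull k f.toMap) (E.map k f.restrict) (E.map (k + 1) f) (E.pull (k + 1) f.toMap)
    (E.map (k + 1) f.restrict) ?_ ?_ ?_ ?_ (E.exact_sub k Q) (E.exact_rel k Q)
    (E.exact_pair (k + 1) Q) (E.exact_sub k P) (E.exact_rel k P) (E.exact_pair (k + 1) P)
    (hX k).2 (hA k) (hX (k + 1)) (hA (k + 1)).1
  · ext x
    change E.map k _ (E.map k _ x) = E.map k _ (E.map k _ x)
    rw [← E.map_comp, ← E.map_comp]; rfl
  · ext x
    exact E.δ_natural k f x
  · ext x
    change E.map (k + 1) _ (E.map (k + 1) _ x) = E.map (k + 1) _ (E.map (k + 1) _ x)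
    rw [← E.map_comp, ← E.map_comp]; rfl
  · ext x
    change E.map (k + 1) _ (E.map (k + 1) _ x) = E.map (k + 1) _ (E.map (k + 1) _ x)
    rw [← E.map_comp, ← E.map_comp]; rfl

/-! ### Finite additivity -/

section Additivity

set_option linter.unusedSectionVars false

variable {J : Type*} [Finite J] {X : Type u} [TopologicalSpace X] {Z : J → Type u}
  [∀ j, TopologicalSpace (Z j)]

theorem pull_eq_zero_of_isEmpty {X : Type u} [TopologicalSpace X] [IsEmpty X] (x : E.abs i X) :
    x = 0 :=
  E.eq_zero_of_univ i (of X) (Subsingleton.elim _ _) x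

/-- Excision of an open and closed subset of `A`, for a pair `(X, A)` with `X ∖ A` the image of an
open embedding. -/
theorem map_openEmbedding_bijective {P Q : SpacePair.{u}} (f : SpacePair.Hom P Q)
    (hf : Topology.IsOpenEmbedding f.toMap) (hcl : IsClosed (range f.toMap))
    (hA : P.A = f.toMap ⁻¹' Q.A) (hQ : (range f.toMap)ᶜ ⊆ Q.A) : Bijective (E.map i f) := by
  have ho : IsOpen (range f.toMap) := hf.isOpen_range
  -- The range is open and closed, so its complement is both its own closure and an open subset of
  -- `Q.A`, and can be excised.
  have hZ : closure (range f.toMap)ᶜ ⊆ interior Q.A := by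
    rw [ho.isClosed_compl.closure_eq]
    exact interior_maximal hQ hcl.isOpen_compl
  let e : P.X ≃ₜ range f.toMap := hf.toHomeomorph
  let g : SpacePair.Hom P (Q.excise (range f.toMap)ᶜ) :=
    ⟨⟨fun x => ⟨f.toMap x, fun h => h ⟨x, rfl⟩⟩, by fun_prop⟩, fun x hx => f.mapsTo hx⟩
  have hg : f = (Q.exciseIncl _).comp g := rfl
  have key : ∀ y : (Q.excise (range f.toMap)ᶜ).X, y.1 ∈ range f.toMap := fun y => not_not.1 y.2
  have hb : Bijective (E.map i g) := by
    let g' : SpacePair.Hom (Q.excise (range f.toMap)ᶜ) P :=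
      ⟨⟨fun y => e.symm ⟨y.1, key y⟩, by fun_prop⟩, fun y hy => by
        have h1 : f.toMap (e.symm ⟨y.1, key y⟩) = y.1 :=
          congrArg Subtype.val (e.apply_symm_apply ⟨y.1, key y⟩)
        change e.symm ⟨y.1, key y⟩ ∈ P.A
        rw [hA, mem_preimage, h1]; exact hy⟩
    refine E.bijective_of_inverse i g g' ?_ ?_
    · have : ∀ x, e.symm ⟨f.toMap x, x, rfl⟩ = x := fun x => e.symm_apply_apply x
      unfold SpacePair.Hom.comp SpacePair.Hom.id
      congr 1
      ext x
      exact this x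
    · have : ∀ y, f.toMap (e.symm ⟨y.1, key y⟩) = y.1 := fun y =>
        congrArg Subtype.val (e.apply_symm_apply ⟨y.1, key y⟩)
      unfold SpacePair.Hom.comp SpacePair.Hom.id
      congr 1
      ext y
      exact Subtype.ext (this y)
  rw [hg]
  have : ⇑(E.map i ((Q.exciseIncl _).comp g)) = E.map i g ∘ E.map i (Q.exciseIncl _) := by
    ext x; exact E.map_comp i _ _ x
  rw [this]
  exact hb.comp (E.excision i Q _ hZ)

variable (g : ∀ j, C(Z j, X))

theorem isClosed_range_of_cover (hg : ∀ j, Topology.IsOpenEmbedding (g j))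
    (hd : ∀ j j' z z', g j z = g j' z' → j = j') (hc : ∀ x, ∃ j z, g j z = x) (j : J) :
    IsClosed (range (g j)) := by
  rw [← isOpen_compl_iff]
  have : (range (g j))ᶜ = ⋃ j' ∈ {j' | j' ≠ j}, range (g j') := by
    ext x
    simp only [mem_compl_iff, mem_range, not_exists, mem_ofPred_eq, mem_iUnion, exists_prop]
    constructor
    · intro h
      obtain ⟨j', z, rfl⟩ := hc x
      exact ⟨j', fun hj => by subst hj; exact h z rfl, z, rfl⟩
    · rintro ⟨j', hj, z, rfl⟩ z' h
      exact hj (hd _ _ _ _ h).symm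
  rw [this]
  exact isOpen_biUnion fun j' _ => (hg j').isOpen_range

/-- Extension by zero: a class on the piece `Z j` comes by excision from one on `X` relative to `C`
and all other pieces. Its restriction to `(X, C)` vanishes on the other pieces, so the sum over `j`
has the prescribed components. -/
theorem sum_surjective (C : Set X) (hg : ∀ j, Topology.IsOpenEmbedding (g j))
    (hd : ∀ j j' z z', g j z = g j' z' → j = j') (hc : ∀ x, ∃ j z, g j z = x) :
    Surjective fun (x : E.obj i ⟨X, C⟩) j =>
      E.map i (P := ⟨Z j, g j ⁻¹' C⟩) ⟨g j, fun _ h => h⟩ x := by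
  classical
  cases nonempty_fintype J
  intro y
  let P : J → SpacePair.{u} := fun j => ⟨X, C ∪ (range (g j))ᶜ⟩
  let f : ∀ j, SpacePair.Hom ⟨Z j, g j ⁻¹' C⟩ (P j) := fun j => ⟨g j, fun z hz => Or.inl hz⟩
  have hb : ∀ j, Bijective (E.map i (f j)) := fun j => by
    refine E.map_openEmbedding_bijective i (f j) (hg j) (isClosed_range_of_cover g hg hd hc j) ?_ ?_
    · ext z
      simp [f, P]
    · exact subset_union_right
  choose z hz using fun j => (hb j).2 (y j)
  let t : ∀ j, SpacePair.Hom ⟨X, C⟩ (P j) := fun j => ⟨ContinuousMap.id _, fun _ h => Or.inl h⟩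
  refine ⟨∑ j, E.map i (t j) (z j), funext fun j => ?_⟩
  simp only [map_sum]
  rw [Finset.sum_eq_single j]
  · rw [← E.map_comp, ← hz j]; rfl
  · intro j' _ hj
    rw [← E.map_comp]
    -- The whole piece `j` lies in the complement of the range of `g j'`, which belongs to the
    -- subspace of `P j'`.
    refine E.map_eq_zero i ((t j').comp (P := ⟨Z j, g j ⁻¹' C⟩) ⟨g j, fun _ h => h⟩) (fun x => Or.inr ?_) _
    rintro ⟨x', hx'⟩
    exact hj (hd _ _ _ _ hx')
  · simp

/-- Induction over the pieces. Let `V` be `U` with one more piece. A class on `V` that vanishes on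
`U` comes from `(V, U)`, which excision identifies with the new piece; there it vanishes too. -/
theorem eq_zero_of_pull_eq_zero (hg : ∀ j, Topology.IsOpenEmbedding (g j))
    (hd : ∀ j j' z z', g j z = g j' z' → j = j') (hc : ∀ x, ∃ j z, g j z = x)
    (x : E.abs i X) (hx : ∀ j, E.pull i (g j) x = 0) : x = 0 := by
  classical
  cases nonempty_fintype J
  have key : ∀ s : Finset J, ∃ U : Set X, U = (⋃ j ∈ s, range (g j)) ∧
      E.pull i (⟨Subtype.val, continuous_subtype_val⟩ : C(U, X)) x = 0 := by
    intro s
    induction s using Finset.induction_on with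
    | empty =>
      refine ⟨∅, by simp, ?_⟩
      exact E.pull_eq_zero_of_isEmpty i _
    | insert j s hj ih =>
      obtain ⟨U, hU, h0⟩ := ih
      set V : Set X := ⋃ l ∈ insert j s, range (g l) with hV
      refine ⟨V, hV, ?_⟩
      have hUV : U ⊆ V := by
        rw [hU, hV]
        exact biUnion_subset_biUnion_left (fun _ h => Finset.mem_insert_of_mem h)
      have hjV : ∀ z, g j z ∈ V := fun z =>
        mem_biUnion (Finset.mem_coe.2 (Finset.mem_insert_self j s)) ⟨z, rfl⟩
      let Q : SpacePair.{u} := ⟨V, {y | y.1 ∈ U}⟩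
      let gV : C(Z j, V) := ⟨fun z => ⟨g j z, hjV z⟩, by fun_prop⟩
      have hoV : Topology.IsOpenEmbedding gV := by
        refine ⟨?_, ?_⟩
        · exact Topology.IsEmbedding.of_comp gV.continuous continuous_subtype_val
            (hg j).isEmbedding
        · have : range gV = Subtype.val ⁻¹' range (g j) := by
            ext ⟨y, hy⟩
            simp [gV]
          rw [this]
          exact (hg j).isOpen_range.preimage continuous_subtype_val
      have hdisj : ∀ z, g j z ∉ U := by
        intro z hz
        rw [hU] at hz
        simp only [mem_iUnion, mem_range, exists_prop] at hz
        obtain ⟨j', hj', z', hz'⟩ := hz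
        exact hj ((hd _ _ _ _ hz') ▸ hj')
      let f : SpacePair.Hom (of (Z j)) Q := ⟨gV, fun _ h => h.elim⟩
      have hb : Bijective (E.map i f) := by
        refine E.map_openEmbedding_bijective i f hoV ?_ ?_ ?_
        · have : range f.toMap = Subtype.val ⁻¹' range (g j) := by
            ext ⟨y, hy⟩
            exact ⟨fun ⟨z, hz⟩ => ⟨z, congrArg Subtype.val hz⟩, fun ⟨z, hz⟩ => ⟨z, Subtype.ext hz⟩⟩
          rw [this]
          exact (isClosed_range_of_cover g hg hd hc j).preimage continuous_subtype_val
        · ext z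
          simp only [mem_preimage, mem_empty_iff_false, false_iff]
          exact hdisj z
        · rintro ⟨y, hy⟩ hy'
          simp only [hV, Finset.mem_insert, mem_iUnion, exists_prop] at hy
          obtain ⟨j', rfl | hj', z, rfl⟩ := hy
          · exact absurd ⟨z, rfl⟩ hy'
          · change g j' z ∈ U
            rw [hU]
            exact mem_biUnion (Finset.mem_coe.2 hj') ⟨z, rfl⟩
      set xV := E.pull i (⟨Subtype.val, continuous_subtype_val⟩ : C(V, X)) x
      have h1 : E.map i Q.incl xV = 0 := by
        let φ : C(Q.A, U) := ⟨fun y => ⟨(y.1 : V).1, y.2⟩, Continuous.subtype_mk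
          ((continuous_subtype_val (p := (· ∈ V))).comp continuous_subtype_val) _⟩
        have : E.map i Q.incl xV = E.pull i φ
            (E.pull i (⟨Subtype.val, continuous_subtype_val⟩ : C(U, X)) x) := by
          rw [← pull_comp]
          exact (E.pull_comp i _ _ x).symm
        rw [this, h0, map_zero]
      obtain ⟨z, hz⟩ := (E.exact_pair i Q xV).1 h1
      have h2 : E.map i f z = 0 := by
        have : E.map i f z = E.pull i gV (E.map i Q.toRel z) := by
          unfold pull
          rw [← E.map_comp]; rfl
        rw [this, hz, ← pull_comp]
        exact hx j
      rw [← map_zero (E.map i f)] at h2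
      rw [← hz, hb.1 h2, map_zero]
  obtain ⟨U, hU, h0⟩ := key Finset.univ
  have hU' : U = univ := by
    rw [hU]
    ext x
    obtain ⟨j, z, rfl⟩ := hc x
    simp only [Finset.mem_univ, iUnion_true, mem_iUnion, mem_univ, iff_true]
    exact ⟨j, z, rfl⟩
  exact (E.incl_bijective_of_univ i ⟨X, U⟩ hU').1 (by rw [map_zero]; exact h0)

theorem sum_bijective_abs (hg : ∀ j, Topology.IsOpenEmbedding (g j))
    (hd : ∀ j j' z z', g j z = g j' z' → j = j') (hc : ∀ x, ∃ j z, g j z = x) :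
    Bijective fun (x : E.abs i X) j => E.pull i (g j) x := by
  constructor
  · intro x y hxy
    rw [← sub_eq_zero]
    refine E.eq_zero_of_pull_eq_zero i g hg hd hc _ fun j => ?_
    rw [map_sub, sub_eq_zero]
    exact congrFun hxy j
  · exact E.sum_surjective i g ∅ hg hd hc

/-- Finite additivity for pairs. -/
theorem sum_bijective (C : Set X) (hg : ∀ j, Topology.IsOpenEmbedding (g j))
    (hd : ∀ j j' z z', g j z = g j' z' → j = j') (hc : ∀ x, ∃ j z, g j z = x) :
    Bijective fun (x : E.obj i ⟨X, C⟩) j =>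
      E.map i (P := ⟨Z j, g j ⁻¹' C⟩) ⟨g j, fun _ h => h⟩ x := by
  refine ⟨?_, E.sum_surjective i g C hg hd hc⟩
  obtain ⟨k, rfl⟩ : ∃ k, i = k + 1 := ⟨i - 1, by ring⟩
  let Q : SpacePair.{u} := ⟨X, C⟩
  let P : J → SpacePair.{u} := fun j => ⟨Z j, g j ⁻¹' C⟩
  let f : ∀ j, SpacePair.Hom (P j) Q := fun j => ⟨g j, fun _ h => h⟩
  suffices h : ∀ x : E.obj (k + 1) Q, (∀ j, E.map (k + 1) (f j) x = 0) → x = 0 by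
    intro x y hxy
    rw [← sub_eq_zero]
    refine h _ fun j => ?_
    rw [map_sub, sub_eq_zero]
    exact congrFun hxy j
  intro x hx
  have h0 : E.map (k + 1) Q.toRel x = 0 := by
    refine E.eq_zero_of_pull_eq_zero (k + 1) g hg hd hc _ fun j => ?_
    have : E.pull (k + 1) (g j) (E.map (k + 1) Q.toRel x) =
        E.map (k + 1) (P j).toRel (E.map (k + 1) (f j) x) := by
      unfold pull
      rw [← E.map_comp, ← E.map_comp]; rfl
    rw [this, hx, map_zero]
  obtain ⟨c, rfl⟩ := (E.exact_rel k Q x).1 h0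
  -- The coboundary of `c` vanishes on every piece, so there `c` extends from the subspace to the
  -- piece. Absolute additivity assembles the extensions to a class `a` on `X`, and absolute
  -- additivity for `C` shows that `a` restricts to `c`.
  have h1 : ∀ j, ∃ e, E.map k (P j).incl e = E.map k (f j).restrict c := fun j => by
    have := hx j
    rw [← E.δ_natural] at this
    exact (E.exact_sub k (P j) _).1 this
  choose e he using h1
  obtain ⟨a, ha⟩ := (E.sum_bijective_abs k g hg hd hc).2 e
  have h2 : c - E.map k Q.incl a = 0 := by
    refine E.eq_zero_of_pull_eq_zero (J := J) (X := C) k (fun j => (f j).restrict.toMap)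
      ?_ ?_ ?_ _ fun j => ?_
    · intro j
      have := (hg j).restrictPreimage C
      exact this
    · intro j j' z z' h
      exact hd j j' z.1 z'.1 (congrArg Subtype.val h)
    · rintro ⟨x, hx⟩
      obtain ⟨j, z, rfl⟩ := hc x
      exact ⟨j, ⟨z, hx⟩, rfl⟩
    · have h3 : E.pull k (f j).restrict.toMap c = E.map k (f j).restrict c := rfl
      have h4 : E.pull k (f j).restrict.toMap (E.map k Q.incl a) =
          E.map k (P j).incl (E.pull k (g j) a) := by
        unfold pull
        rw [← E.map_comp, ← E.map_comp]; rfl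
      rw [map_sub, h3, h4, ← he j, ← congrFun ha j, sub_self]
  rw [sub_eq_zero.1 h2]
  exact (E.exact_sub k Q).apply_apply_eq_zero a

end Additivity

end CohomologyTheory

/-! ### The cylinder relative to its ends, and the suspension isomorphism. -/

/-- Linear interpolation in the unit interval. -/
def lerp (s a b : unitInterval) : unitInterval :=
  ⟨(1 - s) * a + s * b, convex_Icc (0 : ℝ) 1 a.2 b.2 (by linarith [s.2.2]) s.2.1 (by ring)⟩

theorem coe_lerp (s a b : unitInterval) : (lerp s a b : ℝ) = (1 - s) * a + s * b := rfl

@[fun_prop]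
theorem Continuous.lerp {Z : Type*} [TopologicalSpace Z] {s a b : Z → unitInterval}
    (hs : Continuous s) (ha : Continuous a) (hb : Continuous b) :
    Continuous fun z => lerp (s z) (a z) (b z) := by
  refine Continuous.subtype_mk ?_ _
  fun_prop

@[simp] theorem lerp_zero (a b : unitInterval) : lerp 0 a b = a := Subtype.ext (by simp [lerp])

@[simp] theorem lerp_one (a b : unitInterval) : lerp 1 a b = b := Subtype.ext (by simp [lerp])

@[simp] theorem lerp_self (s a : unitInterval) : lerp s a a = a :=
  Subtype.ext (by rw [coe_lerp]; ring)

/-- The pair `(Y × [0, 1], Y × {0, 1})`. -/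
abbrev cylPair (Y : Type u) [TopologicalSpace Y] : SpacePair.{u} :=
  ⟨Y × unitInterval, {x | x.2 = 0 ∨ x.2 = 1}⟩

section Cylinder

variable {Y Y' : Type u} [TopologicalSpace Y] [TopologicalSpace Y']

def boolEnd (b : Bool) : unitInterval := if b then 1 else 0

/-- The inclusion of one of the two ends of the cylinder. -/
def cylEnd (Y : Type u) [TopologicalSpace Y] (b : Bool) : C(Y, (cylPair Y).A) where
  toFun y := ⟨(y, boolEnd b), by cases b; exacts [Or.inl rfl, Or.inr rfl]⟩
  continuous_toFun := Continuous.subtype_mk (by fun_prop) _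

/-- The inclusion of the slice of the cylinder at the parameter `t`. -/
def cylSlice (Y : Type u) [TopologicalSpace Y] (t : unitInterval) : C(Y, Y × unitInterval) :=
  ⟨fun y => (y, t), by fun_prop⟩

def cylMap (g : C(Y, Y')) : SpacePair.Hom (cylPair Y) (cylPair Y') where
  toMap := g.prodMap (ContinuousMap.id _)
  mapsTo _ h := h

theorem cylEnd_isOpenEmbedding (b : Bool) : Topology.IsOpenEmbedding (cylEnd Y b) := by
  refine ⟨?_, ?_⟩
  · refine Topology.IsEmbedding.of_comp (g := fun x : (cylPair Y).A => (x.1.1 : Y))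
      (cylEnd Y b).continuous ?_ ?_
    · exact continuous_fst.comp (X := (cylPair Y).A) continuous_subtype_val
    · exact Topology.IsEmbedding.id
  · have : range (cylEnd Y b) = {x : (cylPair Y).A | x.1.2 ≠ boolEnd !b} := by
      ext ⟨⟨y, t⟩, ht⟩
      have h01 : (0 : unitInterval) ≠ 1 := zero_ne_one
      constructor
      · rintro ⟨y', hy⟩
        have : boolEnd b = t := congrArg (fun x : (cylPair Y).A => x.1.2) hy
        change t ≠ boolEnd !b
        rw [← this]
        cases b <;> simp [boolEnd]
      · intro h
        refine ⟨y, Subtype.ext (Prod.ext rfl ?_)⟩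
        change boolEnd b = t
        change t ≠ boolEnd !b at h
        rcases ht with ht | ht <;> change t = _ at ht <;> subst ht <;> cases b <;>
          simp [boolEnd] at h ⊢
    rw [this]
    exact isOpen_ne.preimage (continuous_snd.comp (X := (cylPair Y).A) continuous_subtype_val)

theorem cylEnd_disjoint (b b' : Bool) (y y' : Y) (h : cylEnd Y b y = cylEnd Y b' y') : b = b' := by
  have : boolEnd b = boolEnd b' := congrArg (fun x : (cylPair Y).A => x.1.2) h
  cases b <;> cases b' <;> simp [boolEnd] at this ⊢

theorem cylEnd_cover (x : (cylPair Y).A) : ∃ b y, cylEnd Y b y = x := by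
  obtain ⟨⟨y, t⟩, ht | ht⟩ := x <;> change t = _ at ht <;> subst ht
  · exact ⟨false, y, rfl⟩
  · exact ⟨true, y, rfl⟩

theorem cylSlice_homotopic (t t' : unitInterval) :
    Homotopic (ofMap (cylSlice Y t)) (ofMap (cylSlice Y t')) := by
  refine ⟨⟨fun x => (x.2, lerp x.1 t t'), by fun_prop⟩, fun x => ?_, fun x => ?_, ?_⟩
  · exact Prod.ext rfl (lerp_zero _ _)
  · exact Prod.ext rfl (lerp_one _ _)
  · rintro t a ⟨⟩

end Cylinder

theorem SpacePair.Homotopic.restrict {P Q : SpacePair.{u}} {f g : SpacePair.Hom P Q}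
    (h : Homotopic f g) : Homotopic f.restrict g.restrict := by
  obtain ⟨F, h0, h1, h2⟩ := h
  refine ⟨⟨fun x => ⟨F (x.1, x.2.1), h2 _ _ x.2.2⟩, ?_⟩, ?_, ?_, ?_⟩
  · exact Continuous.subtype_mk (F.continuous.comp
      (continuous_fst.prodMk (continuous_subtype_val.comp continuous_snd))) _
  · intro x
    exact Subtype.ext (h0 _)
  · intro x
    exact Subtype.ext (h1 _)
  · rintro t a ⟨⟩

/-- An operation is only a map of sets, but the zero class is pulled back from the space relative to
itself, where the target group is trivial as well. -/
theorem CohomologyOperation.map_zero {E F : CohomologyTheory.{u, w}} {i j : ℤ}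
    (θ : CohomologyOperation E F i j) (P : SpacePair.{u}) : θ.app P 0 = 0 := by
  let R : SpacePair.{u} := ⟨P.X, univ⟩
  let g : SpacePair.Hom P R := ⟨ContinuousMap.id _, fun _ _ => mem_univ _⟩
  have := θ.natural g 0
  rw [_root_.map_zero, F.eq_zero_of_univ j R rfl (θ.app R 0), _root_.map_zero] at this
  exact this

namespace CohomologyTheory

variable (E : CohomologyTheory.{u, w}) (i : ℤ)
variable {Y Y' : Type u} [TopologicalSpace Y] [TopologicalSpace Y']

def cylEndsHom (Y : Type u) [TopologicalSpace Y] : E.abs i (cylPair Y).A →+ (Bool → E.abs i Y) :=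
  AddMonoidHom.pi fun b => E.pull i (cylEnd Y b)

theorem cylEndsHom_bijective : Bijective (E.cylEndsHom i Y) :=
  E.sum_bijective_abs i (fun b => cylEnd Y b) cylEnd_isOpenEmbedding cylEnd_disjoint cylEnd_cover

theorem cylEnds_ext {a a' : E.abs i (cylPair Y).A}
    (h0 : E.pull i (cylEnd Y false) a = E.pull i (cylEnd Y false) a')
    (h1 : E.pull i (cylEnd Y true) a = E.pull i (cylEnd Y true) a') : a = a' :=
  (E.cylEndsHom_bijective i).1 (funext fun b => by cases b <;> assumption)

/-- The class on the two ends of the cylinder that is `y` at `0` and `0` at `1`. -/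
def jump (Y : Type u) [TopologicalSpace Y] : E.abs i Y →+ E.abs i (cylPair Y).A :=
  (AddEquiv.ofBijective _ (E.cylEndsHom_bijective i)).symm.toAddMonoidHom.comp
    (AddMonoidHom.single (fun _ : Bool => E.abs i Y) false)

theorem cylEndsHom_jump (y : E.abs i Y) :
    E.cylEndsHom i Y (E.jump i Y y) = Pi.single false y :=
  (AddEquiv.ofBijective _ (E.cylEndsHom_bijective i)).apply_symm_apply _

theorem pull_false_jump (y : E.abs i Y) : E.pull i (cylEnd Y false) (E.jump i Y y) = y :=
  (congrFun (E.cylEndsHom_jump i y) false).trans (Pi.single_eq_same _ _)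

theorem pull_true_jump (y : E.abs i Y) : E.pull i (cylEnd Y true) (E.jump i Y y) = 0 :=
  (congrFun (E.cylEndsHom_jump i y) true).trans (Pi.single_eq_of_ne (by simp) _)

/-- The suspension homomorphism. -/
def susp (Y : Type u) [TopologicalSpace Y] : E.abs i Y →+ E.obj (i + 1) (cylPair Y) :=
  (E.δ i (cylPair Y)).comp (E.jump i Y)

theorem pull_cylEnd_incl (b : Bool) (c : E.abs i (cylPair Y).X) :
    E.pull i (cylEnd Y b) (E.map i (cylPair Y).incl c) = E.pull i (cylSlice Y (boolEnd b)) c :=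
  (E.pull_comp i _ _ c).symm

theorem pull_cylSlice_eq (t t' : unitInterval) : E.pull i (cylSlice Y t) = E.pull i (cylSlice Y t') :=
  E.homotopy i _ _ (cylSlice_homotopic t t')

/-- The projection of the cylinder to `Y` followed by the slice at `t` is homotopic to the identity.
-/
theorem pull_cylSlice_injective (t : unitInterval) : Injective (E.pull i (cylSlice Y t)) := by
  have h : Homotopic (ofMap ((cylSlice Y t).comp (ContinuousMap.fst (α := Y) (β := unitInterval))))
      (ofMap (ContinuousMap.id _)) := by
    refine ⟨⟨fun x => (x.2.1, lerp x.1 t x.2.2), by fun_prop⟩, fun x => ?_, fun x => ?_, ?_⟩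
    · exact Prod.ext rfl (lerp_zero _ _)
    · exact Prod.ext rfl (lerp_one _ _)
    · rintro t a ⟨⟩
  have h' := E.homotopy i _ _ h
  intro x y hxy
  have e : ∀ x, E.pull i ContinuousMap.fst (E.pull i (cylSlice Y t) x) = x := fun x => by
    rw [← pull_comp]
    exact (DFunLike.congr_fun h' x).trans (E.pull_id i x)
  rw [← e x, hxy, e]

/-- Subtracting the constant class with the value of `a` at the end 1 makes `a` a `jump`. Constant
classes extend over the cylinder, so the coboundary kills them. This fixes the sign convention: the
value at 0 minus the value at 1. -/
theorem δ_cyl (a : E.abs i (cylPair Y).A) : E.δ i (cylPair Y) a =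
    E.susp i Y (E.pull i (cylEnd Y false) a - E.pull i (cylEnd Y true) a) := by
  set c := E.pull i (cylEnd Y true) a with hc
  have h : a = E.jump i Y (E.pull i (cylEnd Y false) a - c) +
      E.map i (cylPair Y).incl (E.pull i (ContinuousMap.fst (α := Y) (β := unitInterval)) c) := by
    have h1 : ∀ b, E.pull i (cylEnd Y b) (E.map i (cylPair Y).incl
        (E.pull i (ContinuousMap.fst (α := Y) (β := unitInterval)) c)) = c := fun b => by
      rw [pull_cylEnd_incl]
      exact (E.pull_comp i _ _ c).symm.trans (E.pull_id i c)
    apply E.cylEnds_ext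
    · rw [map_add, pull_false_jump, h1, sub_add_cancel]
    · rw [map_add, pull_true_jump, h1, zero_add]
  conv_lhs => rw [h]
  rw [map_add, (E.exact_sub i (cylPair Y)).apply_apply_eq_zero, add_zero]
  rfl

/-- A class on the ends that extends over the cylinder has equal values at both of them, and a
`jump` with this property is zero. Conversely, restriction to a slice is injective on the cylinder,
so every relative class is a coboundary, and `δ_cyl` makes it a suspension. -/
theorem susp_bijective : Bijective (E.susp i Y) := by
  constructor
  · rw [injective_iff_map_eq_zero]
    intro y hy
    obtain ⟨b, hb⟩ := (E.exact_sub i (cylPair Y) _).1 hy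
    rw [← E.pull_false_jump i y, ← hb, pull_cylEnd_incl, E.pull_cylSlice_eq i _ (boolEnd true),
      ← pull_cylEnd_incl, hb, pull_true_jump]
  · intro z
    have h0 : E.map (i + 1) (cylPair Y).toRel z = 0 := by
      apply E.pull_cylSlice_injective (i + 1) (boolEnd false)
      rw [map_zero, ← pull_cylEnd_incl, (E.exact_pair (i + 1) (cylPair Y)).apply_apply_eq_zero,
        map_zero]
    obtain ⟨a, rfl⟩ := (E.exact_rel i (cylPair Y) z).1 h0
    exact ⟨_, (E.δ_cyl i a).symm⟩

theorem map_cylMap_susp (g : C(Y, Y')) (y : E.abs i Y') :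
    E.map (i + 1) (cylMap g) (E.susp i Y' y) = E.susp i Y (E.pull i g y) := by
  change E.map (i + 1) (cylMap g) (E.δ i _ (E.jump i Y' y)) = _
  rw [← E.δ_natural, δ_cyl]
  have h : ∀ b, E.pull i (cylEnd Y b) (E.map i (cylMap g).restrict (E.jump i Y' y)) =
      E.pull i g (E.pull i (cylEnd Y' b) (E.jump i Y' y)) := fun b =>
    (E.pull_comp i _ (cylEnd Y b) _).symm.trans (E.pull_comp i (cylEnd Y' b) g _)
  rw [h, h, pull_false_jump, pull_true_jump, map_zero, sub_zero]

/-- Valid for operations that are not additive: the class on the ends has only the values `y` and 0,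
and operations preserve 0. -/
theorem operation_susp {F : CohomologyTheory.{u, w}} {k : ℤ} (θ : CohomologyOperation E F i k)
    (θ' : CohomologyOperation E F (i + 1) (k + 1)) (ε : ℤˣ) (h : θ.Compatible θ' ε)
    (y : E.abs i Y) : θ'.app _ (E.susp i Y y) = (ε : ℤ) • F.susp k Y (θ.app _ y) := by
  refine (h (cylPair Y) _).trans ?_
  rw [F.δ_cyl]
  have h1 : ∀ b, F.pull k (cylEnd Y b) (θ.app _ (E.jump i Y y)) =
      θ.app _ (E.pull i (cylEnd Y b) (E.jump i Y y)) := fun b => (θ.natural _ _).symm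
  rw [h1, h1, pull_false_jump, pull_true_jump, θ.map_zero, sub_zero]

end CohomologyTheory

/-! ### The exact sequence of the pair of a diagram, in cohomology. -/

namespace SequenceDiagram

/-- The pair `(X, A)` of a diagram. -/
abbrev pair (S : SequenceDiagram.{u}) : SpacePair.{u} := ⟨S.X, range S.inc⟩

/-- Homotopies in `X` from `pⱼ` to `qⱼ`. -/
structure Tracks (S : SequenceDiagram.{u}) where
  emb : Topology.IsEmbedding S.inc
  T : ∀ j, C(S.Y j × unitInterval, S.X)
  T_zero : ∀ j y, T j (y, 0) = S.inc (S.p j y)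
  T_one : ∀ j y, T j (y, 1) = S.inc (S.q j y)

namespace Tracks

variable {S S' : SequenceDiagram.{u}} (t : S.Tracks) (t' : S'.Tracks)

def hom (j : S.J) : SpacePair.Hom (cylPair (S.Y j)) S.pair where
  toMap := t.T j
  mapsTo := by
    rintro ⟨y, s⟩ (h | h) <;> change s = _ at h <;> subst h
    · exact ⟨_, (t.T_zero j y).symm⟩
    · exact ⟨_, (t.T_one j y).symm⟩

def homeo : S.A ≃ₜ S.pair.A := t.emb.toHomeomorph

/-- The homotopies identify the cohomology of `(X, A)` with that of a suspension of `⨁ Yⱼ`. -/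
def Key : Prop := ∀ (E : CohomologyTheory.{u, w}) (i : ℤ),
  Bijective fun (z : E.obj i S.pair) j => E.map i (t.hom j) z

/-- The maps `m` respect the homotopies. -/
structure Compat (m : S.Hom S') : Prop where
  comm : ∀ a, m.onX (S.inc a) = S'.inc (m.onA a)
  -- Only a homotopy can be asked for, because an embedding of graphs need not carry the shrinking
  -- of the edges of Γ to that of Γ'. As its ends stay in the subspace, it is a homotopy of maps of
  -- pairs.
  homot : ∀ j j' (h : m.idx j = some j'), ∃ F : C(unitInterval × (S.Y j × unitInterval), S'.X),
    (∀ x, F (0, x) = m.onX (t.T j x)) ∧ (∀ x, F (1, x) = t'.T j' (m.onY j j' h x.1, x.2)) ∧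
    ∀ s y, F (s, (y, 0)) ∈ range S'.inc ∧ F (s, (y, 1)) ∈ range S'.inc
  none : ∀ j, m.idx j = none → ∀ x, m.onX (t.T j x) ∈ range S'.inc

variable {t t'}

def Compat.hom {m : S.Hom S'} (c : t.Compat t' m) : SpacePair.Hom S.pair S'.pair where
  toMap := m.onX
  mapsTo := by
    rintro _ ⟨a, rfl⟩
    exact ⟨_, (c.comm a).symm⟩

theorem Compat.homotopic {m : S.Hom S'} (c : t.Compat t' m) (j j') (h : m.idx j = some j') :
    Homotopic (c.hom.comp (t.hom j)) ((t'.hom j').comp (cylMap (m.onY j j' h))) := by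
  obtain ⟨F, h0, h1, h2⟩ := c.homot j j' h
  refine ⟨F, h0, h1, ?_⟩
  rintro s ⟨y, r⟩ (hr | hr) <;> change r = _ at hr <;> subst hr
  · exact (h2 s y).1
  · exact (h2 s y).2

end Tracks

end SequenceDiagram

namespace SequenceDiagram.Tracks

variable {S S' : SequenceDiagram.{u}} {t : S.Tracks} {t' : S'.Tracks}

section Cohomology

variable (E : CohomologyTheory.{u, w}) (i : ℤ)

def pullHom (t : S.Tracks) : E.obj i S.pair →+ ∀ j, E.obj i (cylPair (S.Y j)) :=
  AddMonoidHom.pi fun j => E.map i (t.hom j)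

def suspHom (S : SequenceDiagram.{u}) :
    (∀ j, E.abs i (S.Y j)) →+ ∀ j, E.obj (i + 1) (cylPair (S.Y j)) :=
  AddMonoidHom.pi fun j => (E.susp i (S.Y j)).comp (Pi.evalAddMonoidHom _ j)

def keyEquiv (k : Key.{u, w} t) :
    E.obj i S.pair ≃+ ∀ j, E.obj i (cylPair (S.Y j)) :=
  AddEquiv.ofBijective (t.pullHom E i) (k E i)

/-- The class on `(X, A)` given by the suspensions of classes on the spaces `Yⱼ`. -/
def relClass (k : Key.{u, w} t) : (∀ j, E.abs i (S.Y j)) →+ E.obj (i + 1) S.pair :=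
  (keyEquiv E (i + 1) k).symm.toAddMonoidHom.comp (suspHom E i S)

theorem map_relClass (k : Key.{u, w} t) (y : ∀ j, E.abs i (S.Y j)) (j : S.J) :
    E.map (i + 1) (t.hom j) (relClass E i k y) = E.susp i (S.Y j) (y j) :=
  congrFun ((keyEquiv E (i + 1) k).apply_symm_apply (suspHom E i S y)) j

theorem eq_relClass (k : Key.{u, w} t) {y : ∀ j, E.abs i (S.Y j)} {z : E.obj (i + 1) S.pair}
    (h : ∀ j, E.map (i + 1) (t.hom j) z = E.susp i (S.Y j) (y j)) : z = relClass E i k y :=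
  (k E (i + 1)).1 (funext fun j => (h j).trans (map_relClass E i k y j).symm)

theorem relClass_bijective (k : Key.{u, w} t) : Bijective (relClass E i k) := by
  refine (keyEquiv E (i + 1) k).symm.bijective.comp ⟨fun y y' h => funext fun j => ?_, fun z => ?_⟩
  · exact (E.susp_bijective i).1 (congrFun h j)
  · choose y hy using fun j => (E.susp_bijective i (Y := S.Y j)).2 (z j)
    exact ⟨y, funext hy⟩

/-- The isomorphism `Eⁱ(A) → Eⁱ(inc A)`. -/
theorem pull_homeo_bijective (t : S.Tracks) :
    Bijective (E.pull i (t.homeo : C(S.A, S.pair.A))) :=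
  E.pull_homeomorph_bijective i t.homeo

theorem pull_homeo_incl (t : S.Tracks) (x : E.abs i S.X) :
    E.pull i (t.homeo : C(S.A, S.pair.A)) (E.map i S.pair.incl x) = E.pull i S.inc x :=
  (E.pull_comp i _ _ x).symm

/-- The classes of the two ends of a homotopy that stays in `A`. -/
theorem pull_cylEnd_hom (t : S.Tracks) (x : E.abs i S.pair.A) (j : S.J) :
    E.pull i (cylEnd (S.Y j) false) (E.map i (t.hom j).restrict x) =
      E.pull i (S.p j) (E.pull i (t.homeo : C(S.A, S.pair.A)) x) ∧
    E.pull i (cylEnd (S.Y j) true) (E.map i (t.hom j).restrict x) =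
      E.pull i (S.q j) (E.pull i (t.homeo : C(S.A, S.pair.A)) x) := by
  have h0 : ((t.hom j).restrict.toMap).comp (cylEnd (S.Y j) false) =
      (t.homeo : C(S.A, S.pair.A)).comp (S.p j) := by
    ext y
    exact t.T_zero j y
  have h1 : ((t.hom j).restrict.toMap).comp (cylEnd (S.Y j) true) =
      (t.homeo : C(S.A, S.pair.A)).comp (S.q j) := by
    ext y
    exact t.T_one j y
  constructor
  · rw [← E.pull_comp, ← h0, E.pull_comp]; rfl
  · rw [← E.pull_comp, ← h1, E.pull_comp]; rfl

/-- By `Key` it suffices to compare both sides on every cylinder. The ends of the track are `p j`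
and `q j`, so there the coboundary is the suspension of the difference of the two pullbacks. -/
theorem δ_pair (k : Key.{u, w} t) (x : E.abs i S.pair.A) : E.δ i S.pair x =
    relClass E i k (S.codiff E i (E.pull i (t.homeo : C(S.A, S.pair.A)) x)) := by
  refine eq_relClass E i k fun j => ?_
  rw [← E.δ_natural, E.δ_cyl, (t.pull_cylEnd_hom E i x j).1, (t.pull_cylEnd_hom E i x j).2]
  rfl

/-- The connecting homomorphism of the long exact sequence in cohomology. -/
def codelta (k : Key.{u, w} t) : (∀ j, E.abs i (S.Y j)) →+ E.abs (i + 1) S.X :=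
  (E.map (i + 1) S.pair.toRel).comp (relClass E i k)

/-- This and the next two exactness statements are those of the pair, transported along the
isomorphism `relClass` and the homeomorphism of `A` with its image; `δ_pair` identifies the
coboundary. -/
theorem exact_inc_codiff (k : Key.{u, w} t) : Exact (E.pull i S.inc) (S.codiff E i) := by
  intro x
  obtain ⟨x, rfl⟩ := (t.pull_homeo_bijective E i).2 x
  have h := δ_pair E i k x
  rw [← map_eq_zero_iff (relClass E i k) (relClass_bijective E i k).1, ← h, E.exact_sub i S.pair x]
  constructor
  · rintro ⟨y, rfl⟩
    exact ⟨y, (t.pull_homeo_incl E i y).symm⟩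
  · rintro ⟨y, hy⟩
    refine ⟨y, (t.pull_homeo_bijective E i).1 ?_⟩
    rw [pull_homeo_incl, hy]

theorem exact_codiff_codelta (k : Key.{u, w} t) : Exact (S.codiff E i) (codelta E i k) := by
  intro y
  refine (E.exact_rel i S.pair (relClass E i k y)).trans ?_
  constructor
  · rintro ⟨x, hx⟩
    rw [δ_pair E i k] at hx
    exact ⟨_, (relClass_bijective E i k).1 hx⟩
  · rintro ⟨x, rfl⟩
    obtain ⟨x, rfl⟩ := (t.pull_homeo_bijective E i).2 x
    exact ⟨x, δ_pair E i k x⟩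

theorem exact_codelta_inc (k : Key.{u, w} t) : Exact (codelta E i k) (E.pull (i + 1) S.inc) := by
  intro x
  have h := E.exact_pair (i + 1) S.pair x
  rw [← map_eq_zero_iff _ (t.pull_homeo_bijective E (i + 1)).1, pull_homeo_incl] at h
  refine h.trans ?_
  constructor
  · rintro ⟨z, rfl⟩
    obtain ⟨y, rfl⟩ := (relClass_bijective E i k).2 z
    exact ⟨y, rfl⟩
  · rintro ⟨y, rfl⟩
    exact ⟨_, rfl⟩

variable {m : S.Hom S'}

theorem natural_inc (c : t.Compat t' m) (x : E.abs i S'.X) :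
    E.pull i m.onA (E.pull i S'.inc x) = E.pull i S.inc (E.pull i m.onX x) := by
  have : S'.inc.comp m.onA = m.onX.comp S.inc := by
    ext a
    exact (c.comm a).symm
  rw [← E.pull_comp, ← E.pull_comp, this]

/-- The identity already holds between relative classes, where it is tested on each cylinder. If the
index survives, the homotopy of pairs and naturality of the suspension give it; otherwise the whole
track is sent into the subspace, which induces zero. -/
theorem natural_codelta (c : t.Compat t' m) (k : Key.{u, w} t) (k' : Key.{u, w} t')
    (y' : ∀ j, E.abs i (S'.Y j)) (y : ∀ j, E.abs i (S.Y j)) (h : m.Pulls E i y' y) :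
    E.pull (i + 1) m.onX (codelta E i k' y') = codelta E i k y := by
  have h1 : E.pull (i + 1) m.onX (E.map (i + 1) S'.pair.toRel (relClass E i k' y')) =
      E.map (i + 1) S.pair.toRel (E.map (i + 1) c.hom (relClass E i k' y')) := by
    unfold CohomologyTheory.pull
    rw [← E.map_comp, ← E.map_comp]
    rfl
  refine h1.trans (congrArg _ (eq_relClass E i k fun j => ?_))
  rw [← E.map_comp]
  cases hj : m.idx j with
  | none => rw [(h j).2 hj, map_zero, E.map_eq_zero _ _ (c.none j hj)]
  | some j' =>
    rw [E.homotopy _ _ _ (c.homotopic j j' hj), E.map_comp, map_relClass, E.map_cylMap_susp,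
      (h j).1 j' hj]

/-- The components of `codiff` are differences of the two ends of a class on a cylinder, and these
are invariant under homotopies of pairs. Where the index is undefined, the image of the track stays
in the subspace, so its ends are two slices of one map from the cylinder and their classes cancel.
-/
theorem natural_codiff (c : t.Compat t' m) (x : E.abs i S'.A) :
    m.Pulls E i (S'.codiff E i x) (S.codiff E i (E.pull i m.onA x)) := by
  obtain ⟨x, rfl⟩ := (t'.pull_homeo_bijective E i).2 x
  have hA : E.pull i m.onA (E.pull i (t'.homeo : C(S'.A, S'.pair.A)) x) =
      E.pull i (t.homeo : C(S.A, S.pair.A)) (E.map i c.hom.restrict x) := by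
    have : (t'.homeo : C(S'.A, S'.pair.A)).comp m.onA =
        (c.hom.restrict.toMap).comp (t.homeo : C(S.A, S.pair.A)) := by
      ext a
      exact (c.comm a).symm
    rw [← E.pull_comp, this, E.pull_comp]
    rfl
  rw [hA]
  intro j
  change (∀ j' h, E.pull i (S.p j) _ - E.pull i (S.q j) _ = E.pull i _
    (E.pull i (S'.p j') _ - E.pull i (S'.q j') _)) ∧ (_ → E.pull i (S.p j) _ - E.pull i (S.q j) _ = 0)
  rw [← (t.pull_cylEnd_hom E i _ j).1, ← (t.pull_cylEnd_hom E i _ j).2]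
  have hr : E.map i (t.hom j).restrict (E.map i c.hom.restrict x) =
      E.map i (c.hom.comp (t.hom j)).restrict x := by
    rw [← E.map_comp]; rfl
  rw [hr]
  constructor
  · intro j' hj
    rw [← (t'.pull_cylEnd_hom E i _ j').1, ← (t'.pull_cylEnd_hom E i _ j').2,
      E.homotopy _ _ _ (c.homotopic j j' hj).restrict]
    have hs : ∀ b, E.pull i (cylEnd (S.Y j) b)
        (E.map i ((t'.hom j').comp (cylMap (m.onY j j' hj))).restrict x) =
        E.pull i (m.onY j j' hj) (E.pull i (cylEnd (S'.Y j') b) (E.map i (t'.hom j').restrict x)) := by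
      intro b
      unfold CohomologyTheory.pull
      rw [← E.map_comp, ← E.map_comp, ← E.map_comp]
      rfl
    rw [hs, hs, map_sub]
  · intro hj
    let F : C((cylPair (S.Y j)).X, S'.pair.A) :=
      ⟨fun y => ⟨m.onX (t.T j y), c.none j hj y⟩,
        Continuous.subtype_mk (m.onX.continuous.comp (t.T j).continuous) _⟩
    have hF : E.map i (c.hom.comp (t.hom j)).restrict x =
        E.map i (cylPair (S.Y j)).incl (E.pull i F x) := by
      unfold CohomologyTheory.pull
      rw [← E.map_comp]
      rfl
    rw [hF, E.pull_cylEnd_incl, E.pull_cylEnd_incl, E.pull_cylSlice_eq i _ (boolEnd true), sub_self]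

theorem operation_codelta {F : CohomologyTheory.{u, w}} {l : ℤ} (k : Key.{u, w} t)
    (θ : CohomologyOperation E F i l) (θ' : CohomologyOperation E F (i + 1) (l + 1)) (ε : ℤˣ)
    (h : θ.Compatible θ' ε) (y : ∀ j, E.abs i (S.Y j)) :
    θ'.app _ (codelta E i k y) = (ε : ℤ) • codelta F l k fun j => θ.app _ (y j) := by
  refine (θ'.natural _ _).trans ?_
  rw [← map_zsmul]
  refine congrArg (F.map (l + 1) S.pair.toRel) ?_
  refine eq_relClass F l k fun j => ?_
  rw [← θ'.natural, map_relClass, E.operation_susp i θ θ' ε h, ← map_zsmul]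
  rfl

end Cohomology

end SequenceDiagram.Tracks

theorem CohomologyOperation.app_sub {E F : CohomologyTheory.{u, w}} {i j : ℤ}
    (θ : CohomologyOperation E F i j) (h : θ.Additive) (P : SpacePair.{u}) (x y : E.obj i P) :
    θ.app P (x - y) = θ.app P x - θ.app P y := by
  rw [eq_sub_iff_add_eq, ← h, sub_add_cancel]

open SequenceDiagram Tracks in
/-- Long exact sequences in cohomology from compatible homotopies. -/
theorem nonempty_cohomologySequence {𝓘 : Type*} {Mor : 𝓘 → 𝓘 → Type*}
    {S : 𝓘 → SequenceDiagram.{u}} {m : ∀ {a b}, Mor a b → (S a).Hom (S b)}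
    (t : ∀ a, (S a).Tracks) (k : ∀ a, Key.{u, w} (t a))
    (c : ∀ a b (f : Mor a b), (t a).Compat (t b) (m f)) :
    Nonempty (CohomologySequence.{u, w} S (Mor := Mor) m) :=
  ⟨{ d := fun E a i => codelta E i (k a)
     exact_A := fun E a i => exact_inc_codiff E i (k a)
     exact_Y := fun E a i => exact_codiff_codelta E i (k a)
     exact_X := fun E a i => exact_codelta_inc E i (k a)
     natural_inc := fun E a b f i x => natural_inc E i (c a b f) x
     natural_codiff := fun E a b f i x => natural_codiff E i (c a b f) x
     natural_d := fun E a b f i y' y h => natural_codelta E i (c a b f) (k a) (k b) y' y h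
     operation_inc := fun E F i l θ a x => θ.natural _ _
     operation_codiff := fun E F i l θ hθ a x j => by
       refine (θ.app_sub hθ _ _ _).trans ?_
       exact congrArg₂ _ (θ.natural _ _) (θ.natural _ _)
     operation_d := fun E F i l θ θ' ε h a y => operation_codelta E i (k a) θ θ' ε h y }⟩

/-! ### Duality with the character groups -/

section Dual

variable {A B C : Type*} [AddCommGroup A] [AddCommGroup B] [AddCommGroup C]

/-- The homomorphism of character groups induced by a homomorphism of abelian groups. -/
def dualHom (f : A →+ B) : (B →+ AddCircle (1 : ℚ)) →+ (A →+ AddCircle (1 : ℚ)) where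
  toFun φ := φ.comp f
  map_zero' := rfl
  map_add' _ _ := rfl

/-- The group ℚ/ℤ is injective: a character that vanishes on the image of `f` factors through `B`
modulo the kernel of `g`, which embeds in `C`, and so extends to `C`. -/
theorem dualHom_exact {f : A →+ B} {g : B →+ C} (h : Exact f g) :
    Exact (dualHom g) (dualHom f) := by
  intro φ
  constructor
  · intro hφ
    have hk : g.ker ≤ φ.ker := by
      intro b hb
      obtain ⟨a, rfl⟩ := (h b).1 hb
      exact DFunLike.congr_fun hφ a
    obtain ⟨ψ, hψ⟩ := CharacterModule.dual_surjective_of_injective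
      (QuotientAddGroup.kerLift g).toIntLinearMap (QuotientAddGroup.kerLift_injective g)
      (QuotientAddGroup.lift g.ker φ hk)
    refine ⟨ψ, ?_⟩
    ext b
    exact DFunLike.congr_fun hψ (QuotientAddGroup.mk b)
  · rintro ⟨ψ, rfl⟩
    ext a
    change ψ (g (f a)) = 0
    rw [h.apply_apply_eq_zero, map_zero]

/-- Characters separate elements and ℚ/ℤ is injective, so bijectivity is detected by duals. This is
how facts about all cohomology theories pass to homology. -/
theorem bijective_of_dualHom {f : A →+ B} (h : Bijective (dualHom f)) : Bijective f :=
  CharacterModule.dual_bijective_iff_bijective (f := f.toIntLinearMap).1 h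

theorem dualHom_bijective {f : A →+ B} (h : Bijective f) : Bijective (dualHom f) :=
  CharacterModule.dual_bijective_iff_bijective (f := f.toIntLinearMap).2 h

/-- The homomorphism on a finite direct sum with given components. -/
def sumHom {J : Type*} [Fintype J] {M : J → Type*} [∀ j, AddCommGroup (M j)]
    (f : ∀ j, M j →+ B) : (∀ j, M j) →+ B :=
  ∑ j, (f j).comp (Pi.evalAddMonoidHom _ j)

theorem sumHom_apply {J : Type*} [Fintype J] {M : J → Type*} [∀ j, AddCommGroup (M j)]
    (f : ∀ j, M j →+ B) (y : ∀ j, M j) : sumHom f y = ∑ j, f j (y j) := by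
  simp [sumHom, AddMonoidHom.finsetSum_apply]

/-- A character of a finite direct sum is a family of characters of the summands. -/
theorem sumHom_bijective_of_dual {J : Type*} [Fintype J] {M : J → Type*}
    [∀ j, AddCommGroup (M j)] (f : ∀ j, M j →+ B)
    (h : Bijective fun (φ : B →+ AddCircle (1 : ℚ)) j => dualHom (f j) φ) :
    Bijective (sumHom f) := by
  classical
  refine bijective_of_dualHom ⟨fun φ φ' hφ => h.1 (funext fun j => ?_), fun ψ => ?_⟩
  · ext a
    have := DFunLike.congr_fun hφ (Pi.single j a)
    change φ (sumHom f _) = φ' (sumHom f _) at this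
    have hs : sumHom f (Pi.single j a) = f j a := by
      rw [sumHom_apply, Finset.sum_eq_single j]
      · rw [Pi.single_eq_same]
      · intro j' _ hj
        rw [Pi.single_eq_of_ne hj, map_zero]
      · simp
    rw [hs] at this
    exact this
  · obtain ⟨φ, hφ⟩ := h.2 fun j => ψ.comp (AddMonoidHom.single M j)
    refine ⟨φ, AddMonoidHom.ext fun y => ?_⟩
    change φ (sumHom f y) = ψ y
    have : y = ∑ j, Pi.single j (y j) := (Finset.univ_sum_single y).symm
    conv_rhs => rw [this]
    rw [sumHom_apply, map_sum, map_sum]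
    exact Finset.sum_congr rfl fun j _ => DFunLike.congr_fun (congrFun hφ j) (y j)

end Dual

/-! ### Homology theories through their dual cohomology theories, and desuspension. -/

namespace HomologyTheory

/-- The cohomology theory of the character groups of the groups of a homology theory. -/
def dual (E : HomologyTheory.{u, w}) : CohomologyTheory.{u, w} where
  obj i P := E.obj i P →+ AddCircle (1 : ℚ)
  map i _ _ f := dualHom (E.map i f)
  map_id i P φ := by
    ext x
    exact congrArg φ (E.map_id i P x)
  map_comp i _ _ _ g f φ := by
    ext x
    exact congrArg φ (E.map_comp i g f x)
  δ i P := dualHom (E.δ i P)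
  δ_natural i _ _ f φ := by
    ext x
    exact congrArg φ (E.δ_natural i f x).symm
  homotopy i _ _ f g h := by rw [E.homotopy i f g h]
  exact_pair i P := dualHom_exact (E.exact_pair i P)
  exact_sub i P := dualHom_exact (E.exact_sub i P)
  exact_rel i P := dualHom_exact (E.exact_rel i P)
  excision i P Z h := dualHom_bijective (E.excision i P Z h)

variable (E : HomologyTheory.{u, w}) (i : ℤ)

theorem push_comp {X Y Z : Type u} [TopologicalSpace X] [TopologicalSpace Y] [TopologicalSpace Z]
    (g : C(Y, Z)) (f : C(X, Y)) (x : E.abs i X) :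
    E.push i (g.comp f) x = E.push i g (E.push i f x) :=
  E.map_comp i (ofMap g) (ofMap f) x

theorem push_id {X : Type u} [TopologicalSpace X] (x : E.abs i X) :
    E.push i (ContinuousMap.id X) x = x :=
  E.map_id i (of X) x

theorem push_homeomorph_bijective {X Y : Type u} [TopologicalSpace X] [TopologicalSpace Y]
    (e : X ≃ₜ Y) : Bijective (E.push i (e : C(X, Y))) :=
  bijective_of_dualHom (E.dual.pull_homeomorph_bijective i e)

theorem map_eq_zero {P Q : SpacePair.{u}} (f : SpacePair.Hom P Q) (hf : ∀ x, f.toMap x ∈ Q.A)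
    (x : E.obj i P) : E.map i f x = 0 :=
  CharacterModule.eq_zero_of_character_apply fun φ =>
    DFunLike.congr_fun (F := E.obj i P →+ AddCircle (1 : ℚ)) (E.dual.map_eq_zero i f hf φ) x

variable {Y Y' : Type u} [TopologicalSpace Y] [TopologicalSpace Y']

/-- The homomorphism `Eᵢ(Y) ⊕ Eᵢ(Y) → Eᵢ(Y × {0, 1})`. -/
def cylEndsHom (Y : Type u) [TopologicalSpace Y] : (Bool → E.abs i Y) →+ E.abs i (cylPair Y).A :=
  sumHom fun b => E.push i (cylEnd Y b)

theorem cylEndsHom_bijective : Bijective (E.cylEndsHom i Y) :=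
  sumHom_bijective_of_dual _ (E.dual.cylEndsHom_bijective i)

theorem cylEndsHom_apply (y : Bool → E.abs i Y) : E.cylEndsHom i Y y =
    E.push i (cylEnd Y true) (y true) + E.push i (cylEnd Y false) (y false) := by
  rw [cylEndsHom, sumHom_apply, Fintype.sum_bool]

/-- The component of a class on the two ends of the cylinder at the end `0`. -/
def atZero (Y : Type u) [TopologicalSpace Y] : E.abs i (cylPair Y).A →+ E.abs i Y :=
  (Pi.evalAddMonoidHom (fun _ : Bool => E.abs i Y) false).comp
    (AddEquiv.ofBijective _ (E.cylEndsHom_bijective i)).symm.toAddMonoidHom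

theorem atZero_cylEndsHom (y : Bool → E.abs i Y) : E.atZero i Y (E.cylEndsHom i Y y) = y false :=
  congrFun ((AddEquiv.ofBijective _ (E.cylEndsHom_bijective i)).symm_apply_apply y) false

/-- The desuspension homomorphism. -/
def desusp (Y : Type u) [TopologicalSpace Y] : E.obj (i + 1) (cylPair Y) →+ E.abs i Y :=
  (E.atZero i Y).comp (E.δ i (cylPair Y))

/-- Both sides are determined by their values at the two ends of the cylinder, which are `φ` at 0
and zero at 1. Thus the dual of `desusp` is the suspension of the dual theory, and bijectivity is
inherited. -/
theorem dualHom_atZero (φ : E.abs i Y →+ AddCircle (1 : ℚ)) : dualHom (E.atZero i Y) φ = E.dual.jump i Y φ := by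
  have h : ∀ b y, E.atZero i Y (E.push i (cylEnd Y b) y) = if b = false then y else 0 := by
    intro b y
    have : E.push i (cylEnd Y b) y = E.cylEndsHom i Y (Pi.single b y) := by
      rw [cylEndsHom_apply]
      cases b <;> simp
    rw [this, atZero_cylEndsHom]
    cases b <;> simp
  apply E.dual.cylEnds_ext i
  · refine Eq.trans (AddMonoidHom.ext fun y => ?_) (E.dual.pull_false_jump i φ).symm
    exact congrArg φ ((h false y).trans (if_pos rfl))
  · refine Eq.trans (AddMonoidHom.ext fun y => ?_) (E.dual.pull_true_jump i φ).symm
    exact (congrArg φ ((h true y).trans (if_neg (by simp)))).trans (map_zero φ)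

theorem desusp_bijective : Bijective (E.desusp i Y) := by
  apply bijective_of_dualHom
  have : ⇑(dualHom (E.desusp i Y)) = E.dual.susp i Y := by
    funext φ
    exact congrArg (E.dual.δ i (cylPair Y)) (E.dualHom_atZero i φ)
  rw [this]
  exact E.dual.susp_bijective i

/-- A boundary dies in the cylinder. Projecting to `Y` adds its components at the two ends, so these
are opposite to each other. -/
theorem δ_cyl (z : E.obj (i + 1) (cylPair Y)) : E.δ i (cylPair Y) z =
    E.push i (cylEnd Y false) (E.desusp i Y z) - E.push i (cylEnd Y true) (E.desusp i Y z) := by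
  obtain ⟨y, hy⟩ := (E.cylEndsHom_bijective i).2 (E.δ i (cylPair Y) z)
  have h0 : E.desusp i Y z = y false := by
    change E.atZero i Y (E.δ i (cylPair Y) z) = _
    rw [← hy, atZero_cylEndsHom]
  have h1 : E.map i (cylPair Y).incl (E.δ i (cylPair Y) z) = 0 :=
    (E.exact_sub i (cylPair Y)).apply_apply_eq_zero z
  have h2 : ∀ b a, E.push i (ContinuousMap.fst (α := Y) (β := unitInterval))
      (E.map i (cylPair Y).incl (E.push i (cylEnd Y b) a)) = a := fun b a =>
    (congrArg _ (E.push_comp i _ _ a).symm).trans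
      ((E.push_comp i _ _ a).symm.trans (E.push_id i a))
  have h3 := congrArg (E.push i (ContinuousMap.fst (α := Y) (β := unitInterval))) h1
  rw [← hy, cylEndsHom_apply, map_add, map_add, h2, h2, map_zero] at h3
  rw [← hy, cylEndsHom_apply, h0, eq_neg_of_add_eq_zero_left h3, map_neg]
  abel

/-- Characterizes the desuspension by its boundary; naturality and compatibility with operations
become comparisons of boundaries. -/
theorem desusp_eq {z : E.obj (i + 1) (cylPair Y)} {y : E.abs i Y}
    (h : E.δ i (cylPair Y) z = E.push i (cylEnd Y false) y - E.push i (cylEnd Y true) y) :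
    E.desusp i Y z = y := by
  change E.atZero i Y (E.δ i (cylPair Y) z) = _
  have : E.δ i (cylPair Y) z = E.cylEndsHom i Y (fun b => if b then -y else y) := by
    rw [h, cylEndsHom_apply]
    simp [sub_eq_neg_add]
  rw [this, atZero_cylEndsHom]
  simp

theorem desusp_map_cylMap (g : C(Y, Y')) (z : E.obj (i + 1) (cylPair Y)) :
    E.desusp i Y' (E.map (i + 1) (cylMap g) z) = E.push i g (E.desusp i Y z) := by
  apply E.desusp_eq
  rw [E.δ_natural, δ_cyl, map_sub]
  have h : ∀ b a, E.map i (cylMap g).restrict (E.push i (cylEnd Y b) a) =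
      E.push i (cylEnd Y' b) (E.push i g a) := fun b a =>
    (E.push_comp i _ (cylEnd Y b) _).symm.trans (E.push_comp i (cylEnd Y' b) g _)
  rw [h, h]

theorem operation_desusp {F : HomologyTheory.{u, w}} {k : ℤ} (θ : HomologyOperation E F i k)
    (θ' : HomologyOperation E F (i + 1) (k + 1)) (ε : ℤˣ) (h : θ.Compatible θ' ε)
    (z : E.obj (i + 1) (cylPair Y)) :
    θ.app _ (E.desusp i Y z) = (ε : ℤ) • F.desusp k Y (θ'.app _ z) := by
  have h1 := h (cylPair Y) z
  rw [δ_cyl, map_sub] at h1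
  have h2 : ∀ b a, θ.app _ (E.push i (cylEnd Y b) a) = F.push k (cylEnd Y b) (θ.app _ a) :=
    fun b a => θ.natural _ _
  rw [h2, h2, ← map_zsmul] at h1
  have h3 : F.desusp k Y ((ε : ℤ) • θ'.app _ z) = θ.app _ (E.desusp i Y z) :=
    F.desusp_eq k h1.symm
  rw [← h3, map_zsmul]

end HomologyTheory

/-! ### The exact sequence of the pair of a diagram, in homology. -/

namespace SequenceDiagram.Tracks

variable {S S' : SequenceDiagram.{u}} {t : S.Tracks} {t' : S'.Tracks}
variable (E : HomologyTheory.{u, w}) (i : ℤ)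

def pushHom (t : S.Tracks) : (∀ j, E.obj i (cylPair (S.Y j))) →+ E.obj i S.pair :=
  sumHom fun j => E.map i (t.hom j)

/-- `Key` speaks of all cohomology theories, in particular of the dual of `E`. -/
theorem pushHom_bijective (k : Key.{u, w} t) : Bijective (t.pushHom E i) :=
  sumHom_bijective_of_dual _ (k E.dual i)

def desuspHom (S : SequenceDiagram.{u}) :
    (∀ j, E.obj (i + 1) (cylPair (S.Y j))) →+ ∀ j, E.abs i (S.Y j) :=
  AddMonoidHom.pi fun j => (E.desusp i (S.Y j)).comp (Pi.evalAddMonoidHom _ j)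

/-- The components in `⨁ⱼ Eᵢ(Yⱼ)` of a class on `(X, A)`. -/
def relCoord (k : Key.{u, w} t) : E.obj (i + 1) S.pair →+ ∀ j, E.abs i (S.Y j) :=
  (desuspHom E i S).comp
    (AddEquiv.ofBijective _ (t.pushHom_bijective E (i + 1) k)).symm.toAddMonoidHom

theorem relCoord_pushHom (k : Key.{u, w} t) (z : ∀ j, E.obj (i + 1) (cylPair (S.Y j))) :
    relCoord E i k (t.pushHom E (i + 1) z) = fun j => E.desusp i (S.Y j) (z j) :=
  congrArg (desuspHom E i S)
    ((AddEquiv.ofBijective _ (t.pushHom_bijective E (i + 1) k)).symm_apply_apply z)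

theorem relCoord_bijective (k : Key.{u, w} t) : Bijective (relCoord E i k) := by
  refine Bijective.comp (g := desuspHom E i S) ⟨fun y y' h => funext fun j => ?_, fun z => ?_⟩
    (AddEquiv.ofBijective _ (t.pushHom_bijective E (i + 1) k)).symm.bijective
  · exact (E.desusp_bijective i).1 (congrFun h j)
  · choose y hy using fun j => (E.desusp_bijective i (Y := S.Y j)).2 (z j)
    exact ⟨y, funext hy⟩

theorem relCoord_map_hom (k : Key.{u, w} t) (j : S.J) [DecidableEq S.J]
    (z : E.obj (i + 1) (cylPair (S.Y j))) :
    relCoord E i k (E.map (i + 1) (t.hom j) z) = Pi.single j (E.desusp i (S.Y j) z) := by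
  have : E.map (i + 1) (t.hom j) z = t.pushHom E (i + 1) (Pi.single j z) := by
    rw [pushHom, sumHom_apply, Finset.sum_eq_single j]
    · rw [Pi.single_eq_same]
    · intro j' _ hj
      rw [Pi.single_eq_of_ne hj, map_zero]
    · simp
  rw [this, relCoord_pushHom]
  funext j'
  by_cases hj : j' = j
  · subst hj
    simp
  · rw [Pi.single_eq_of_ne hj, Pi.single_eq_of_ne hj, map_zero]

theorem push_homeo_bijective (t : S.Tracks) :
    Bijective (E.push i (t.homeo : C(S.A, S.pair.A))) :=
  E.push_homeomorph_bijective i t.homeo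

theorem incl_push_homeo (t : S.Tracks) (x : E.abs i S.A) :
    E.map i S.pair.incl (E.push i (t.homeo : C(S.A, S.pair.A)) x) = E.push i S.inc x :=
  (E.push_comp i _ _ x).symm

theorem diff_apply (y : ∀ j, E.abs i (S.Y j)) :
    S.diff E i y = ∑ j, (E.push i (S.p j) (y j) - E.push i (S.q j) (y j)) := by
  simp [diff, AddMonoidHom.finsetSum_apply]

theorem δ_pair_homology (k : Key.{u, w} t) (z : E.obj (i + 1) S.pair) : E.δ i S.pair z =
    E.push i (t.homeo : C(S.A, S.pair.A)) (S.diff E i (relCoord E i k z)) := by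
  obtain ⟨z, rfl⟩ := (t.pushHom_bijective E (i + 1) k).2 z
  rw [relCoord_pushHom, diff_apply, pushHom, sumHom_apply, map_sum, map_sum]
  refine Finset.sum_congr rfl fun j _ => ?_
  have h0 : ((t.hom j).restrict.toMap).comp (cylEnd (S.Y j) false) =
      (t.homeo : C(S.A, S.pair.A)).comp (S.p j) := by
    ext y
    exact t.T_zero j y
  have h1 : ((t.hom j).restrict.toMap).comp (cylEnd (S.Y j) true) =
      (t.homeo : C(S.A, S.pair.A)).comp (S.q j) := by
    ext y
    exact t.T_one j y
  rw [E.δ_natural, E.δ_cyl, map_sub, map_sub, ← E.push_comp, ← E.push_comp, ← h0, ← h1,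
    E.push_comp, E.push_comp]
  rfl

/-- The connecting homomorphism of the long exact sequence in homology. -/
def delta (k : Key.{u, w} t) : E.abs (i + 1) S.X →+ ∀ j, E.abs i (S.Y j) :=
  (relCoord E i k).comp (E.map (i + 1) S.pair.toRel)

theorem exact_diff_inc (k : Key.{u, w} t) : Exact (S.diff E i) (E.push i S.inc) := by
  intro x
  rw [← t.incl_push_homeo]
  refine (E.exact_sub i S.pair _).trans ?_
  constructor
  · rintro ⟨z, hz⟩
    rw [δ_pair_homology E i k] at hz
    exact ⟨_, (t.push_homeo_bijective E i).1 hz⟩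
  · rintro ⟨y, rfl⟩
    obtain ⟨z, rfl⟩ := (relCoord_bijective E i k).2 y
    exact ⟨z, δ_pair_homology E i k z⟩

theorem exact_delta_diff (k : Key.{u, w} t) : Exact (delta E i k) (S.diff E i) := by
  intro y
  obtain ⟨z, rfl⟩ := (relCoord_bijective E i k).2 y
  rw [← map_eq_zero_iff _ (t.push_homeo_bijective E i).1, ← δ_pair_homology E i k,
    E.exact_rel i S.pair z]
  constructor
  · rintro ⟨x, rfl⟩
    exact ⟨x, rfl⟩
  · rintro ⟨x, hx⟩
    exact ⟨x, (relCoord_bijective E i k).1 hx⟩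

theorem exact_inc_delta (k : Key.{u, w} t) : Exact (E.push (i + 1) S.inc) (delta E i k) := by
  intro x
  refine (map_eq_zero_iff (relCoord E i k) (relCoord_bijective E i k).1).trans
    ((E.exact_pair (i + 1) S.pair x).trans ?_)
  constructor
  · rintro ⟨a, rfl⟩
    obtain ⟨a, rfl⟩ := (t.push_homeo_bijective E (i + 1)).2 a
    exact ⟨a, (t.incl_push_homeo E (i + 1) a).symm⟩
  · rintro ⟨a, rfl⟩
    exact ⟨_, t.incl_push_homeo E (i + 1) a⟩

variable {m : S.Hom S'}

theorem push_natural_inc (c : t.Compat t' m) (x : E.abs i S.A) :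
    E.push i m.onX (E.push i S.inc x) = E.push i S'.inc (E.push i m.onA x) := by
  have : S'.inc.comp m.onA = m.onX.comp S.inc := by
    ext a
    exact (c.comm a).symm
  rw [← E.push_comp, ← E.push_comp, this]

/-- Relative classes are sums of classes coming from single cylinders, so the check is made on one
track at a time. It contributes to one summand, or to none if the track is sent into the subspace.
-/
theorem relCoord_natural (c : t.Compat t' m) (k : Key.{u, w} t) (k' : Key.{u, w} t')
    (z : E.obj (i + 1) S.pair) :
    relCoord E i k' (E.map (i + 1) c.hom z) = m.pushSum E i (relCoord E i k z) := by
  classical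
  obtain ⟨z, rfl⟩ := (t.pushHom_bijective E (i + 1) k).2 z
  rw [relCoord_pushHom, pushHom, sumHom_apply, map_sum, map_sum]
  funext j'
  rw [Finset.sum_apply]
  refine Finset.sum_congr rfl fun j _ => ?_
  rw [← E.map_comp]
  split_ifs with h
  · rw [E.homotopy _ _ _ (c.homotopic j j' h), E.map_comp, relCoord_map_hom, Pi.single_eq_same,
      E.desusp_map_cylMap]
  · cases hj : m.idx j with
    | none => rw [E.map_eq_zero _ _ (c.none j hj), map_zero, Pi.zero_apply]
    | some l =>
      rw [E.homotopy _ _ _ (c.homotopic j l hj), E.map_comp, relCoord_map_hom,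
        Pi.single_eq_of_ne]
      rintro rfl
      exact h hj

theorem natural_delta (c : t.Compat t' m) (k : Key.{u, w} t) (k' : Key.{u, w} t')
    (x : E.abs (i + 1) S.X) :
    delta E i k' (E.push (i + 1) m.onX x) = m.pushSum E i (delta E i k x) := by
  refine Eq.trans ?_ (relCoord_natural E i c k k' (E.map (i + 1) S.pair.toRel x))
  refine congrArg (relCoord E i k') ?_
  unfold HomologyTheory.push
  rw [← E.map_comp, ← E.map_comp]
  rfl

/-- Every family `y` consists of the coordinates of a relative class, and `diff` is then its
boundary. The square thus reduces to naturality of the boundary. -/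
theorem natural_diff (c : t.Compat t' m) (k : Key.{u, w} t) (k' : Key.{u, w} t')
    (y : ∀ j, E.abs i (S.Y j)) :
    E.push i m.onA (S.diff E i y) = S'.diff E i (m.pushSum E i y) := by
  obtain ⟨z, rfl⟩ := (relCoord_bijective E i k).2 y
  apply (t'.push_homeo_bijective E i).1
  rw [← relCoord_natural E i c k k', ← δ_pair_homology E i k', E.δ_natural,
    δ_pair_homology E i k]
  have : (t'.homeo : C(S'.A, S'.pair.A)).comp m.onA =
      (c.hom.restrict.toMap).comp (t.homeo : C(S.A, S.pair.A)) := by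
    ext a
    exact (c.comm a).symm
  rw [← E.push_comp, this, E.push_comp]
  rfl

theorem operation_delta {F : HomologyTheory.{u, w}} {l : ℤ} (k : Key.{u, w} t)
    (θ : HomologyOperation E F i l) (θ' : HomologyOperation E F (i + 1) (l + 1)) (ε : ℤˣ)
    (h : θ.Compatible θ' ε) (x : E.abs (i + 1) S.X) (j : S.J) :
    θ.app _ (delta E i k x j) = (ε : ℤ) • delta F l k (θ'.app _ x) j := by
  change θ.app _ (relCoord E i k (E.map (i + 1) S.pair.toRel x) j) =
    (ε : ℤ) • relCoord F l k (F.map (l + 1) S.pair.toRel (θ'.app _ x)) j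
  have h1 : F.map (l + 1) S.pair.toRel (θ'.app _ x) = θ'.app _ (E.map (i + 1) S.pair.toRel x) :=
    (θ'.natural _ _).symm
  rw [h1]
  obtain ⟨z, hz⟩ := (t.pushHom_bijective E (i + 1) k).2 (E.map (i + 1) S.pair.toRel x)
  have h2 : θ'.app _ (t.pushHom E (i + 1) z) =
      t.pushHom F (l + 1) (fun j => θ'.app _ (z j)) := by
    rw [pushHom, pushHom, sumHom_apply, sumHom_apply, map_sum]
    exact Finset.sum_congr rfl fun j _ => θ'.natural _ _
  rw [← hz, h2, relCoord_pushHom, relCoord_pushHom]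
  exact E.operation_desusp i θ θ' ε h (z j)

end SequenceDiagram.Tracks

open SequenceDiagram Tracks in
/-- Long exact sequences in homology from compatible homotopies. -/
theorem nonempty_homologySequence {𝓘 : Type*} {Mor : 𝓘 → 𝓘 → Type*}
    {S : 𝓘 → SequenceDiagram.{u}} {m : ∀ {a b}, Mor a b → (S a).Hom (S b)}
    (t : ∀ a, (S a).Tracks) (k : ∀ a, Key.{u, w} (t a))
    (c : ∀ a b (f : Mor a b), (t a).Compat (t b) (m f)) :
    Nonempty (HomologySequence.{u, w} S (Mor := Mor) m) :=
  ⟨{ d := fun E a i => delta E i (k a)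
     exact_A := fun E a i => exact_diff_inc E i (k a)
     exact_Y := fun E a i => exact_delta_diff E i (k a)
     exact_X := fun E a i => exact_inc_delta E i (k a)
     natural_inc := fun E a b f i x => push_natural_inc E i (c a b f) x
     natural_diff := fun E a b f i x => natural_diff E i (c a b f) (k a) (k b) x
     natural_d := fun E a b f i x => natural_delta E i (c a b f) (k a) (k b) x
     operation_inc := fun E F i l θ a x => θ.natural _ _
     operation_diff := fun E F i l θ a y => by
       rw [diff_apply, diff_apply, map_sum]
       refine Finset.sum_congr rfl fun j _ => (map_sub _ _ _).trans ?_
       exact congrArg₂ _ (θ.natural _ _) (θ.natural _ _)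
     operation_d := fun E F i l θ θ' ε h a x j => operation_delta E i (k a) θ θ' ε h x j }⟩

/-! ### A criterion for `Key` in terms of open cylinders. -/

/-- The open unit interval. -/
abbrev OpenInterval : Type := {q : unitInterval // 0 < (q : ℝ) ∧ (q : ℝ) < 1}

/-- The parameter `(1 + 2 t) / 4`. -/
def middle (t : unitInterval) : unitInterval :=
  -- The image is [1/4, 3/4]. It has [1/3, 2/3] in its interior, so the ends of the cylinder go to
  -- the open outer thirds.
  ⟨(1 + 2 * t) / 4, by have := t.2.1; linarith, by have := t.2.2; linarith⟩

theorem coe_middle (t : unitInterval) : (middle t : ℝ) = (1 + 2 * t) / 4 := rfl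

theorem continuous_middle : Continuous middle := by
  refine Continuous.subtype_mk ?_ _
  fun_prop

/-- The cylinder, as the middle part of the open cylinder. -/
def middleOpen (t : unitInterval) : OpenInterval :=
  ⟨middle t, by rw [coe_middle]; have := t.2.1; linarith,
    by rw [coe_middle]; have := t.2.2; linarith⟩

theorem continuous_middleOpen : Continuous middleOpen := Continuous.subtype_mk continuous_middle _

section OpenCylinder

variable {Y : Type u} [TopologicalSpace Y]

/-- The open cylinder, relative to its two outer thirds. -/
abbrev openCylPair (Y : Type u) [TopologicalSpace Y] (C : Set (Y × OpenInterval)) :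
    SpacePair.{u} := ⟨Y × OpenInterval, C⟩

def middleHom (C : Set (Y × OpenInterval))
    (hC : ∀ x, x ∈ C ↔ (x.2.1 : ℝ) < 1 / 3 ∨ 2 / 3 < (x.2.1 : ℝ)) :
    SpacePair.Hom (cylPair Y) (openCylPair Y C) where
  toMap := ⟨fun x => (x.1, middleOpen x.2), continuous_fst.prodMk
    (continuous_middleOpen.comp continuous_snd)⟩
  mapsTo := by
    rintro ⟨y, t⟩ (h | h) <;> change t = _ at h <;> subst h
    · refine (hC _).2 (Or.inl ?_)
      change (1 + 2 * ((0 : unitInterval) : ℝ)) / 4 < 1 / 3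
      norm_num
    · refine (hC _).2 (Or.inr ?_)
      change 2 / 3 < (1 + 2 * ((1 : unitInterval) : ℝ)) / 4
      norm_num

/-- A homotopy inverse of `middle`: it collapses the outer thirds to the ends and stretches the
middle third. -/
def stretch (q : ℝ) : unitInterval := projIcc 0 1 zero_le_one (3 * q - 1)

theorem continuous_stretch : Continuous stretch := by
  unfold stretch
  fun_prop

theorem stretch_of_le {q : ℝ} (h : q ≤ 1 / 3) : stretch q = 0 :=
  projIcc_of_le_left _ (by linarith)

theorem stretch_of_ge {q : ℝ} (h : 2 / 3 ≤ q) : stretch q = 1 :=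
  projIcc_of_right_le _ (by linarith)

def lerpOpen (s : unitInterval) (a b : OpenInterval) : OpenInterval :=
  ⟨lerp s a.1 b.1, by
    have := convex_Ioo (0 : ℝ) 1 a.2 b.2 (by linarith [s.2.2] : 0 ≤ 1 - (s : ℝ)) s.2.1 (by ring)
    exact this⟩

/-- Both composites with `stretch` are homotopic to the identity along straight lines. The ends of
the closed cylinder are fixed, and the outer thirds are preserved because each of them is convex. -/
theorem middleHom_bijective (C : Set (Y × OpenInterval))
    (hC : ∀ x, x ∈ C ↔ (x.2.1 : ℝ) < 1 / 3 ∨ 2 / 3 < (x.2.1 : ℝ))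
    (E : CohomologyTheory.{u, w}) (i : ℤ) : Bijective (E.map i (middleHom C hC)) := by
  let g : SpacePair.Hom (openCylPair Y C) (cylPair Y) :=
    { toMap := ⟨fun x => (x.1, stretch x.2.1), continuous_fst.prodMk (continuous_stretch.comp
        (continuous_subtype_val.comp (continuous_subtype_val.comp continuous_snd)))⟩
      mapsTo := by
        intro x hx
        rcases (hC x).1 hx with h | h
        · exact Or.inl (stretch_of_le h.le)
        · exact Or.inr (stretch_of_ge h.le) }
  refine E.bijective_of_homotopyEquiv i (middleHom C hC) g ?_ ?_
  · refine ⟨⟨fun x => (x.2.1, lerp x.1 (stretch (middle x.2.2)) x.2.2), ?_⟩, fun x => ?_,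
      fun x => ?_, ?_⟩
    · refine (continuous_fst.comp continuous_snd).prodMk (Continuous.lerp continuous_fst ?_ ?_)
      · exact continuous_stretch.comp (continuous_subtype_val.comp
          (continuous_middle.comp (continuous_snd.comp continuous_snd)))
      · exact continuous_snd.comp continuous_snd
    · exact Prod.ext rfl (lerp_zero _ _)
    · exact Prod.ext rfl (lerp_one _ _)
    · rintro s ⟨y, t⟩ (h | h) <;> change t = _ at h <;> subst h
      · refine Or.inl ?_
        change lerp s (stretch (middle 0)) 0 = 0
        rw [stretch_of_le (by rw [coe_middle]; norm_num), lerp_self]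
      · refine Or.inr ?_
        change lerp s (stretch (middle 1)) 1 = 1
        rw [stretch_of_ge (by rw [coe_middle]; norm_num), lerp_self]
  · refine ⟨⟨fun x => (x.2.1, lerpOpen x.1 (middleOpen (stretch x.2.2.1)) x.2.2), ?_⟩, fun x => ?_,
      fun x => ?_, ?_⟩
    · refine (continuous_fst.comp continuous_snd).prodMk (Continuous.subtype_mk
        (Continuous.lerp continuous_fst ?_ ?_) _)
      · exact continuous_middle.comp (continuous_stretch.comp (continuous_subtype_val.comp
          (continuous_subtype_val.comp (continuous_snd.comp continuous_snd))))
      · exact continuous_subtype_val.comp (continuous_snd.comp continuous_snd)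
    · exact Prod.ext rfl (Subtype.ext (lerp_zero _ _))
    · exact Prod.ext rfl (Subtype.ext (lerp_one _ _))
    · rintro s ⟨y, q⟩ h
      refine (hC _).2 ?_
      change ((lerp s (middle (stretch q.1)) q.1 : unitInterval) : ℝ) < 1 / 3 ∨
        2 / 3 < ((lerp s (middle (stretch q.1)) q.1 : unitInterval) : ℝ)
      rw [coe_lerp]
      rcases (hC _).1 h with h | h
      · left
        change (q.1 : ℝ) < 1 / 3 at h
        rw [stretch_of_le h.le, coe_middle]
        have := convex_Iio (𝕜 := ℝ) (1 / 3 : ℝ) (show (1 + 2 * ((0 : unitInterval) : ℝ)) / 4 ∈ _ by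
          norm_num) h (by linarith [s.2.2] : 0 ≤ 1 - (s : ℝ)) s.2.1 (by ring)
        exact this
      · right
        change 2 / 3 < (q.1 : ℝ) at h
        rw [stretch_of_ge h.le, coe_middle]
        have := convex_Ioi (𝕜 := ℝ) (2 / 3 : ℝ) (show (1 + 2 * ((1 : unitInterval) : ℝ)) / 4 ∈ _ by
          norm_num) h (by linarith [s.2.2] : 0 ≤ 1 - (s : ℝ)) s.2.1 (by ring)
        exact this

end OpenCylinder

namespace SequenceDiagram.Tracks

variable {S : SequenceDiagram.{u}} {t : S.Tracks}

/-- A neighbourhood `B` of the subspace `A` that deforms into `A` and contains the complement of a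
disjoint union of open cylinders on the spaces `Yⱼ` computes the cohomology of `(X, A)`. -/
theorem key_of_cylinders (B Z : Set S.X) (hB : IsOpen B) (hZ : IsClosed Z) (hZB : Z ⊆ B)
    (hAB : range S.inc ⊆ B)
    (R : C(unitInterval × B, B)) (R0 : ∀ x, R (0, x) = x) (R1 : ∀ x, (R (1, x)).1 ∈ range S.inc)
    (RA : ∀ s x, x.1 ∈ range S.inc → (R (s, x)).1 ∈ range S.inc)
    (κ : ∀ j, C(S.Y j × OpenInterval, S.X)) (κ_emb : ∀ j, Topology.IsOpenEmbedding (κ j))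
    (κ_disj : ∀ j j' z z', κ j z = κ j' z' → j = j')
    (κ_cover : ∀ x, x ∉ Z ↔ ∃ j z, κ j z = x)
    (κ_B : ∀ j x, κ j x ∈ B ↔ (x.2.1 : ℝ) < 1 / 3 ∨ 2 / 3 < (x.2.1 : ℝ))
    (hom : ∀ j, ∃ F G : C(unitInterval × (S.Y j × unitInterval), S.X),
      (∀ x, F (1, x) = t.T j x) ∧ (∀ x, F (0, x) = G (1, x)) ∧
      (∀ x, G (0, x) = κ j (x.1, middleOpen x.2)) ∧
      ∀ s y, F (s, (y, 0)) ∈ B ∧ F (s, (y, 1)) ∈ B ∧ G (s, (y, 0)) ∈ B ∧ G (s, (y, 1)) ∈ B) :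
    Key.{u, w} t := by
  intro E i
  let Q : SpacePair.{u} := ⟨S.X, B⟩
  let ι : SpacePair.Hom S.pair Q := ⟨ContinuousMap.id _, hAB⟩
  -- The deformation makes the inclusion of the image of `A` in `B` a homotopy equivalence, so the
  -- five lemma allows the subspace to be enlarged to `B`. Points of `A` may move during the
  -- deformation, but they stay in `A`.
  have hι : Bijective (E.map i ι) := by
    refine E.bijective_of_abs i ι (fun i => ?_) (fun i => ?_)
    · have : ⇑(E.pull i ι.toMap) = id := by
        ext x
        exact E.pull_id i x
      rw [this]
      exact bijective_id
    · let r : SpacePair.Hom (of Q.A) (of S.pair.A) := ofMap ⟨fun x => ⟨(R (1, x)).1, R1 x⟩,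
        Continuous.subtype_mk (continuous_subtype_val.comp (R.continuous.comp (by fun_prop))) _⟩
      let sw : C(unitInterval, unitInterval) := ⟨unitInterval.symm, unitInterval.continuous_symm⟩
      refine E.bijective_of_homotopyEquiv i ι.restrict r ?_ ?_
      · refine ⟨⟨fun x => ⟨(R (unitInterval.symm x.1, ⟨x.2.1, hAB x.2.2⟩)).1, RA _ _ x.2.2⟩, ?_⟩,
          fun x => ?_, fun x => ?_, ?_⟩
        · refine Continuous.subtype_mk (continuous_subtype_val.comp (R.continuous.comp ?_)) _
          exact (unitInterval.continuous_symm.comp continuous_fst).prodMk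
            (Continuous.subtype_mk (continuous_subtype_val.comp continuous_snd) _)
        · simp only [unitInterval.symm_zero, ContinuousMap.coe_mk]
          rfl
        · refine Subtype.ext ?_
          simp only [unitInterval.symm_one, ContinuousMap.coe_mk, R0]
          rfl
        · rintro s x ⟨⟩
      · refine ⟨⟨fun x => R (unitInterval.symm x.1, x.2), R.continuous.comp
          ((unitInterval.continuous_symm.comp continuous_fst).prodMk continuous_snd)⟩,
          fun x => ?_, fun x => ?_, ?_⟩
        · simp only [unitInterval.symm_zero, ContinuousMap.coe_mk]
          rfl
        · simp only [unitInterval.symm_one, ContinuousMap.coe_mk, R0]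
          rfl
        · rintro s x ⟨⟩
  -- Excising `Z` leaves the disjoint union of the open cylinders, in which `B` consists of the
  -- outer thirds.
  have hex : Bijective (E.map i (Q.exciseIncl Z)) := by
    refine E.excision i Q Z ?_
    rw [hZ.closure_eq, hB.interior_eq]
    exact hZB
  let N := Q.excise Z
  let κN : ∀ j, C(S.Y j × OpenInterval, N.X) := fun j =>
    ⟨fun x => ⟨κ j x, (κ_cover _).2 ⟨j, x, rfl⟩⟩, Continuous.subtype_mk (κ j).continuous _⟩
  have hκN : ∀ j, Topology.IsOpenEmbedding (κN j) := by
    intro j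
    refine ⟨Topology.IsEmbedding.of_comp (κN j).continuous continuous_subtype_val
      (κ_emb j).isEmbedding, ?_⟩
    have : range (κN j) = Subtype.val ⁻¹' range (κ j) := by
      ext ⟨y, hy⟩
      exact ⟨fun ⟨z, hz⟩ => ⟨z, congrArg Subtype.val hz⟩, fun ⟨z, hz⟩ => ⟨z, Subtype.ext hz⟩⟩
    rw [this]
    exact (κ_emb j).isOpen_range.preimage continuous_subtype_val
  have hsum := E.sum_bijective i κN N.A hκN
    (fun j j' z z' h => κ_disj j j' z z' (congrArg Subtype.val h)) (fun x => by
      obtain ⟨j, z, hz⟩ := (κ_cover x.1).1 x.2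
      exact ⟨j, z, Subtype.ext hz⟩)
  have hC : ∀ j (x : S.Y j × OpenInterval), x ∈ κN j ⁻¹' N.A ↔
      (x.2.1 : ℝ) < 1 / 3 ∨ 2 / 3 < (x.2.1 : ℝ) := fun j x => κ_B j x
  have hmid : Bijective fun (y : ∀ j, E.obj i (openCylPair (S.Y j) (κN j ⁻¹' N.A))) j =>
      E.map i (middleHom _ (hC j)) (y j) := by
    refine ⟨fun y y' h => funext fun j => ?_, fun z => ?_⟩
    · exact (middleHom_bijective _ (hC j) E i).1 (congrFun h j)
    · choose y hy using fun j => (middleHom_bijective _ (hC j) E i).2 (z j)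
      exact ⟨y, funext hy⟩
  have hall := hmid.comp (hsum.comp hex)
  -- The composite of the isomorphisms above is restriction along the tracks: `G` followed by `F` is
  -- a homotopy of maps to `(X, B)` from the middle part of each open cylinder to the track.
  have heq : (fun (z : E.obj i S.pair) j => E.map i (t.hom j) z) ∘ E.map i ι =
      (fun (y : ∀ j, E.obj i (openCylPair (S.Y j) (κN j ⁻¹' N.A))) j =>
        E.map i (middleHom _ (hC j)) (y j)) ∘
      (fun (x : E.obj i ⟨N.X, N.A⟩) j => E.map i (P := ⟨S.Y j × OpenInterval, κN j ⁻¹' N.A⟩)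
        ⟨κN j, fun _ h => h⟩ x) ∘ E.map i (Q.exciseIncl Z) := by
    funext z j
    change E.map i _ (E.map i _ z) = E.map i _ (E.map i _ (E.map i _ z))
    rw [← E.map_comp, ← E.map_comp, ← E.map_comp]
    obtain ⟨F, G, hF1, hFG, hG0, hb⟩ := hom j
    let f : SpacePair.Hom (cylPair (S.Y j)) Q :=
      ⟨F.comp ⟨fun x => (0, x), by fun_prop⟩, by
        rintro ⟨y, r⟩ (h | h) <;> change r = _ at h <;> subst h
        · exact (hb 0 y).1
        · exact (hb 0 y).2.1⟩
    have e1 : Homotopic f (ι.comp (t.hom j)) := by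
      refine ⟨F, fun x => rfl, fun x => hF1 x, ?_⟩
      rintro s ⟨y, r⟩ (h | h) <;> change r = _ at h <;> subst h
      · exact (hb s y).1
      · exact (hb s y).2.1
    have e2 : Homotopic (((Q.exciseIncl Z).comp (SpacePair.Hom.comp
        (Q := openCylPair (S.Y j) (κN j ⁻¹' N.A)) ⟨κN j, fun _ h => h⟩ (middleHom _ (hC j))))) f := by
      refine ⟨G, fun x => hG0 x, fun x => (hFG x).symm, ?_⟩
      rintro s ⟨y, r⟩ (h | h) <;> change r = _ at h <;> subst h
      · exact (hb s y).2.2.1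
      · exact (hb s y).2.2.2
    rw [← E.homotopy i _ _ e1, ← E.homotopy i _ _ e2]
  rw [← heq] at hall
  exact (Bijective.of_comp_iff _ hι).1 hall

end SequenceDiagram.Tracks

namespace FinGraph

variable {Γ : FinGraph.{u}}

/-! ### Maps out of the space of a graph -/

/-- The saturation of a closed set differs from it only by vertices and ends of edges, which form a
finite and hence closed set. -/
theorem isClosedMap_proj : IsClosedMap (proj : Γ.Pieces → Γ.Space) := by
  intro C hC
  rw [← isQuotientMap_proj.isClosed_preimage]
  have hfin : {x : Γ.Pieces | Γ.attach x ≠ x ∨ ∃ w, x = .inl w}.Finite := by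
    refine Finite.subset (s := range (Sum.inl : Γ.V → Γ.Pieces) ∪
      (range (fun e => Sum.inr (e, 0)) ∪ range (fun e => Sum.inr (e, 1)))) (by
        exact (finite_range _).union ((finite_range _).union (finite_range _))) ?_
    rintro (w | ⟨e, t⟩) hx
    · exact Or.inl ⟨w, rfl⟩
    rcases hx with hx | ⟨w, hw⟩
    · by_cases h0 : t = 0
      · subst h0; exact Or.inr (Or.inl ⟨e, rfl⟩)
      by_cases h1 : t = 1
      · subst h1; exact Or.inr (Or.inr ⟨e, rfl⟩)
      exact absurd (attach_interior e h0 h1) hx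
    · cases hw
  have : proj ⁻¹' (proj '' C) = C ∪ (proj ⁻¹' (proj '' C) ∩
      {x : Γ.Pieces | Γ.attach x ≠ x ∨ ∃ w, x = .inl w}) := by
    apply Subset.antisymm
    · rintro x ⟨y, hy, hyx⟩
      by_cases hx : x ∈ {x : Γ.Pieces | Γ.attach x ≠ x ∨ ∃ w, x = .inl w}
      · exact Or.inr ⟨⟨y, hy, hyx⟩, hx⟩
      · left
        have hx1 : Γ.attach x = x := by
          by_contra h
          exact hx (Or.inl h)
        have h := proj_eq.1 hyx
        rw [hx1] at h
        rcases y with w | ⟨e, t⟩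
        · exact absurd (Or.inr ⟨w, h.symm⟩) hx
        by_cases h0 : t = 0
        · subst h0; rw [attach_zero] at h; exact absurd (Or.inr ⟨_, h.symm⟩) hx
        by_cases h1 : t = 1
        · subst h1; rw [attach_one] at h; exact absurd (Or.inr ⟨_, h.symm⟩) hx
        rw [attach_interior e h0 h1] at h
        exact h ▸ hy
    · rintro x (hx | hx)
      · exact ⟨x, hx, rfl⟩
      · exact hx.1
  rw [this]
  exact hC.union (hfin.subset inter_subset_right).isClosed

theorem isClosed_singleton_space (p : Γ.Space) : IsClosed {p} := by
  obtain ⟨x, rfl⟩ := isQuotientMap_proj.surjective p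
  rw [← image_singleton]
  exact isClosedMap_proj _ isClosed_singleton

theorem isProperMap_proj : IsProperMap (proj : Γ.Pieces → Γ.Space) :=
  isProperMap_iff_isClosedMap_and_compact_fibers.2 ⟨isQuotientMap_proj.continuous,
    isClosedMap_proj, fun p =>
      ((isClosed_singleton_space p).preimage isQuotientMap_proj.continuous).isCompact⟩

/-- Proper maps are universally closed, so the product with any parameter space is again a quotient
map. Homotopies on the graph can therefore be defined on the pieces. -/
theorem isQuotientMap_prodMap_proj (T : Type*) [TopologicalSpace T] :
    Topology.IsQuotientMap (Prod.map id proj : T × Γ.Pieces → T × Γ.Space) := by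
  have hp : IsProperMap (Prod.map id proj : T × Γ.Pieces → T × Γ.Space) :=
    (Homeomorph.refl T).isProperMap.prodMap isProperMap_proj
  exact hp.isClosedMap.isQuotientMap hp.continuous
    (surjective_id.prodMap isQuotientMap_proj.surjective)

theorem continuous_pieces {T Z : Type*} [TopologicalSpace T] [TopologicalSpace Z]
    (F : T → Γ.Pieces → Z) (hV : ∀ w, Continuous fun s => F s (.inl w))
    (hE : ∀ e, Continuous fun x : T × unitInterval => F x.1 (.inr (e, x.2))) :
    Continuous fun x : T × Γ.Pieces => F x.1 x.2 := by
  rw [← (Homeomorph.prodSumDistrib (X := T) (Y := Γ.V) (Z := Γ.E × unitInterval)).symm.comp_continuous_iff']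
  refine continuous_sum_dom.2 ⟨?_, ?_⟩
  · exact continuous_prod_of_discrete_right.2 hV
  · have : Continuous fun x : Γ.E × (T × unitInterval) => F x.2.1 (.inr (x.1, x.2.2)) :=
      continuous_prod_of_discrete_left.2 hE
    exact this.comp (f := fun x : T × (Γ.E × unitInterval) => (x.2.1, (x.1, x.2.2))) (by fun_prop)

/-- The function on the space of the graph that is given by `F` on the vertices and on the interiors
of the edges. -/
def spaceLift {Z : Type*} (F : Γ.Pieces → Z) : Γ.Space → Z :=
  Quotient.lift (fun x => F (Γ.attach x)) fun _ _ h => congrArg F h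

theorem spaceLift_pt {Z : Type*} (F : Γ.Pieces → Z) (e : Γ.E) {t : unitInterval} (h0 : t ≠ 0)
    (h1 : t ≠ 1) : spaceLift F (pt e t) = F (.inr (e, t)) := by
  change F (Γ.attach (.inr (e, t))) = _
  rw [attach_interior e h0 h1]

theorem pt_zero (e : Γ.E) : (pt e 0 : Γ.Space) = vert (Γ.ends e false) :=
  proj_eq.2 (by rw [attach_zero]; rfl)

theorem pt_one (e : Γ.E) : (pt e 1 : Γ.Space) = vert (Γ.ends e true) :=
  proj_eq.2 (by rw [attach_one]; rfl)

/-- Compatibility with the gluing is needed only at the vertices in `W`. In the applications to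
shrinking and flowing, `W` is the complement of `v`, where these maps may be discontinuous. -/
theorem continuousOn_spaceLift {T Z : Type*} [TopologicalSpace T] [TopologicalSpace Z]
    (F : T → Γ.Pieces → Z) (hV : ∀ w, Continuous fun s => F s (.inl w))
    (hE : ∀ e, Continuous fun x : T × unitInterval => F x.1 (.inr (e, x.2)))
    {W : Set Γ.Space} (hW : IsOpen W)
    (h0 : ∀ e, vert (Γ.ends e false) ∈ W → ∀ s, F s (.inr (e, 0)) = F s (.inl (Γ.ends e false)))
    (h1 : ∀ e, vert (Γ.ends e true) ∈ W → ∀ s, F s (.inr (e, 1)) = F s (.inl (Γ.ends e true))) :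
    ContinuousOn (fun x : T × Γ.Space => spaceLift (F x.1) x.2) (Prod.snd ⁻¹' W) := by
  rw [(isQuotientMap_prodMap_proj T).continuousOn_isOpen_iff (hW.preimage continuous_snd)]
  refine (continuous_pieces F hV hE).continuousOn.congr ?_
  rintro ⟨s, x⟩ hx
  change F s (Γ.attach x) = F s x
  change proj x ∈ W at hx
  rcases x with w | ⟨e, t⟩
  · rfl
  by_cases ht0 : t = 0
  · subst ht0
    rw [attach_zero, h0 e (by rw [← pt_zero]; exact hx)]
  by_cases ht1 : t = 1
  · subst ht1
    rw [attach_one, h1 e (by rw [← pt_one]; exact hx)]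
  rw [attach_interior e ht0 ht1]

theorem continuous_spaceLift {Z : Type*} [TopologicalSpace Z]
    (F : Γ.Pieces → Z) (hE : ∀ e, Continuous fun t : unitInterval => F (.inr (e, t)))
    (h0 : ∀ e, F (.inr (e, 0)) = F (.inl (Γ.ends e false)))
    (h1 : ∀ e, F (.inr (e, 1)) = F (.inl (Γ.ends e true))) : Continuous (spaceLift F) := by
  have h := continuousOn_spaceLift (T := Unit) (fun _ => F) (fun _ => continuous_const)
    (fun e => (hE e).comp continuous_snd) isOpen_univ (fun e _ _ => h0 e) (fun e _ _ => h1 e)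
  have h' : Continuous fun x : Unit × Γ.Space => spaceLift F x.2 :=
    continuousOn_univ.1 (h.mono fun _ _ => mem_univ _)
  exact h'.comp (f := fun p : Γ.Space => ((), p)) (by fun_prop)

def edgePieces (μ : Γ.E → unitInterval → unitInterval) : Γ.Pieces → Γ.Space
  | .inl w => vert w
  | .inr (e, t) => pt e (μ e t)

/-- The map that fixes the vertices and is given by `μ e` on the interior of the edge `e`. -/
def edgeFun (μ : Γ.E → unitInterval → unitInterval) : Γ.Space → Γ.Space :=
  spaceLift (edgePieces μ)

section EdgeFun

variable (μ : Γ.E → unitInterval → unitInterval)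

theorem edgeFun_vert (w : Γ.V) : edgeFun μ (vert w) = vert w := rfl

theorem edgeFun_pt (e : Γ.E) {t : unitInterval} (h0 : t ≠ 0) (h1 : t ≠ 1) :
    edgeFun μ (pt e t) = pt e (μ e t) :=
  spaceLift_pt _ e h0 h1

theorem continuous_pt (e : Γ.E) : Continuous (pt e : unitInterval → Γ.Space) :=
  isQuotientMap_proj.continuous.comp (continuous_inr.comp (by fun_prop))

theorem continuousOn_edgeFun {T : Type*} [TopologicalSpace T]
    (μ : T → Γ.E → unitInterval → unitInterval)
    (hμ : ∀ e, Continuous fun x : T × unitInterval => μ x.1 e x.2)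
    {W : Set Γ.Space} (hW : IsOpen W)
    (h0 : ∀ e, vert (Γ.ends e false) ∈ W → ∀ s, μ s e 0 = 0)
    (h1 : ∀ e, vert (Γ.ends e true) ∈ W → ∀ s, μ s e 1 = 1) :
    ContinuousOn (fun x : T × Γ.Space => edgeFun (μ x.1) x.2) (Prod.snd ⁻¹' W) := by
  refine continuousOn_spaceLift (fun s => edgePieces (μ s)) (fun w => continuous_const)
    (fun e => (continuous_pt e).comp (hμ e)) hW (fun e hw s => ?_) (fun e hw s => ?_)
  · change pt e (μ s e 0) = vert _
    rw [h0 e hw, pt_zero]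
  · change pt e (μ s e 1) = vert _
    rw [h1 e hw, pt_one]

theorem edgeFun_injective (D : HalfEdgeData.{u}) {μ : D.Γ.E → unitInterval → unitInterval}
    (hμ : ∀ e, Injective (μ e)) (hi : ∀ e t, t ≠ 0 → t ≠ 1 → μ e t ≠ 0 ∧ μ e t ≠ 1) :
    Injective (edgeFun μ) := by
  intro p q h
  rcases D.exists_rep p with ⟨w, rfl⟩ | ⟨e, t, h0, h1, rfl⟩ <;>
    rcases D.exists_rep q with ⟨w', rfl⟩ | ⟨e', t', h0', h1', rfl⟩
  · exact h
  · rw [edgeFun_vert, edgeFun_pt μ e' h0' h1'] at h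
    exact absurd h.symm (D.pt_ne_vert e' (hi e' t' h0' h1').1 (hi e' t' h0' h1').2 w)
  · rw [edgeFun_vert, edgeFun_pt μ e h0 h1] at h
    exact absurd h (D.pt_ne_vert e (hi e t h0 h1).1 (hi e t h0 h1).2 w')
  · rw [edgeFun_pt μ e h0 h1, edgeFun_pt μ e' h0' h1'] at h
    obtain ⟨rfl, ht⟩ := D.pt_inj (hi e' t' h0' h1').1 (hi e' t' h0' h1').2 h
    rw [hμ _ ht]

end EdgeFun

end FinGraph

theorem HalfEdgeData.shrinkFun_eq (D : HalfEdgeData.{u}) : D.shrinkFun = edgeFun D.shrink := by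
  funext p
  rcases D.exists_rep p with ⟨w, rfl⟩ | ⟨e, t, h0, h1, rfl⟩
  · rfl
  · rw [D.shrinkFun_pt e h0 h1, edgeFun_pt _ e h0 h1]

namespace FinGraph

theorem fromEnd_fromEnd (b : Bool) (t : unitInterval) : fromEnd b (fromEnd b t) = t := by
  cases b <;> simp [fromEnd]

theorem coe_fromEnd_not (b : Bool) (t : unitInterval) :
    (fromEnd (!b) t : ℝ) = 1 - fromEnd b t := by
  cases b <;> simp [fromEnd]

theorem fromEnd_interior {b : Bool} {t : unitInterval} (h0 : t ≠ 0) (h1 : t ≠ 1) :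
    fromEnd b t ≠ 0 ∧ fromEnd b t ≠ 1 := by
  cases b <;> simp [fromEnd, h0, h1]

end FinGraph

/-! ### The star of the vertex `v`: distance and sign. -/

/-- The nearest point of the unit interval. -/
def clampI (x : ℝ) : unitInterval := projIcc 0 1 zero_le_one x

theorem continuous_clampI : Continuous clampI := continuous_projIcc (h := zero_le_one)

theorem clampI_of_mem {x : ℝ} (h0 : 0 ≤ x) (h1 : x ≤ 1) : (clampI x : ℝ) = x := by
  simp [clampI, coe_projIcc, h0, h1]

theorem clampI_of_ge {x : ℝ} (h1 : 1 ≤ x) : clampI x = 1 := projIcc_of_right_le _ h1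

theorem clampI_zero : clampI 0 = 0 := projIcc_left _

/-- A function that is positive exactly on the open unit interval. -/
def bump (x : ℝ) : ℝ := max 0 (x * (1 - x))

theorem bump_of_ge {x : ℝ} (h1 : 1 ≤ x) : bump x = 0 := max_eq_left (by nlinarith)

theorem bump_zero : bump 0 = 0 := by simp [bump]

theorem bump_pos {x : ℝ} (h0 : 0 < x) (h1 : x < 1) : 0 < bump x :=
  lt_max_of_lt_right (mul_pos h0 (by linarith))

namespace HalfEdgeData

variable (D : HalfEdgeData.{u})

/-- The radius of the star of the vertex `v`. -/
def rad : ℝ := D.ρ / 2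

theorem rad_pos : 0 < D.rad := half_pos D.ρ_pos
-- The bound 1/4 keeps the stars at the two ends of an edge apart, even for a loop at `v`. By
-- `rad_lt` the far end of a half-edge in `H` lies outside the star.
theorem rad_le : D.rad ≤ 1 / 4 := by have := D.ρ_le; unfold rad; linarith
theorem rad_lt : D.rad < D.ρ := half_lt_self D.ρ_pos

open Classical in
def endDist (e : D.Γ.E) (b : Bool) (x : unitInterval) : unitInterval :=
  if D.Γ.ends e b = D.v then clampI (x / D.rad) else 1

open Classical in
def distPieces : D.Γ.Pieces → unitInterval
  | .inl w => if w = D.v then 0 else 1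
  | .inr (e, t) => min (D.endDist e false (fromEnd false t)) (D.endDist e true (fromEnd true t))

/-- The distance to the vertex `v` in units of the radius of the star, truncated at `1`. -/
def dist : D.Γ.Space → unitInterval := spaceLift D.distPieces

-- Half-edges at `v` outside `H` get −1 instead of 0, so that within the star the sign vanishes only
-- at `v`. The proof that the intermediate configurations form a closed set depends on this.
open Classical in
def endSign (e : D.Γ.E) (b : Bool) : ℝ :=
  if (e, b) ∈ D.H then 1 else if D.Γ.ends e b = D.v then -1 else 0

def signPieces : D.Γ.Pieces → ℝ
  | .inl _ => 0
  | .inr (e, t) => D.endSign e false * bump (fromEnd false t / D.rad) +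
      D.endSign e true * bump (fromEnd true t / D.rad)

/-- A function that is positive on the parts of the star of `v` in the half-edges in `H`, negative
on the other half-edges at `v`, and zero at `v` and outside the star. -/
def sign : D.Γ.Space → ℝ := spaceLift D.signPieces

theorem continuous_endDist (e : D.Γ.E) (b : Bool) : Continuous (D.endDist e b) := by
  unfold endDist
  split_ifs
  · exact continuous_clampI.comp (by fun_prop)
  · exact continuous_const

theorem endDist_zero {e : D.Γ.E} {b : Bool} (h : D.Γ.ends e b = D.v) : D.endDist e b 0 = 0 := by
  rw [endDist, if_pos h]
  simp [clampI_zero]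

theorem endDist_of_ge {e : D.Γ.E} {b : Bool} {x : unitInterval}
    (h : D.Γ.ends e b = D.v → D.rad ≤ x) : D.endDist e b x = 1 := by
  unfold endDist
  split_ifs with h'
  · exact clampI_of_ge ((one_le_div D.rad_pos).2 (h h'))
  · rfl

theorem distPieces_end (e : D.Γ.E) (b : Bool) :
    D.distPieces (.inr (e, fromEnd b 0)) = D.distPieces (.inl (D.Γ.ends e b)) := by
  have hr : D.rad ≤ ((1 : unitInterval) : ℝ) := D.rad_le.trans (by norm_num)
  have h1 : D.endDist e (!b) 1 = 1 := D.endDist_of_ge fun _ => hr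
  have h2 : D.distPieces (.inr (e, fromEnd b 0)) = D.endDist e b 0 := by
    cases b
    · change min (D.endDist e false 0) (D.endDist e true (unitInterval.symm 0)) = _
      rw [unitInterval.symm_zero, show D.endDist e true 1 = 1 from h1]
      exact min_eq_left unitInterval.le_one'
    · change min (D.endDist e false (unitInterval.symm 0)) (D.endDist e true
        (unitInterval.symm (unitInterval.symm 0))) = _
      rw [unitInterval.symm_zero, unitInterval.symm_one, show D.endDist e false 1 = 1 from h1]
      exact min_eq_right unitInterval.le_one'
  rw [h2]
  by_cases h : D.Γ.ends e b = D.v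
  · exact (D.endDist_zero h).trans (if_pos h).symm
  · exact (D.endDist_of_ge fun h' => absurd h' h).trans (if_neg h).symm

theorem continuous_dist : Continuous D.dist := by
  refine continuous_spaceLift _ (fun e => ?_) (fun e => D.distPieces_end e false) (fun e => ?_)
  · exact ((D.continuous_endDist e false).comp (continuous_fromEnd false)).min
      ((D.continuous_endDist e true).comp (continuous_fromEnd true))
  · have := D.distPieces_end e true
    rwa [show fromEnd true 0 = 1 from unitInterval.symm_zero] at this

theorem one_le_inv_rad : 1 ≤ 1 / D.rad := by
  rw [one_le_div D.rad_pos]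
  linarith [D.rad_le]

theorem continuous_sign : Continuous D.sign := by
  have h1 := bump_of_ge D.one_le_inv_rad
  rw [one_div] at h1
  refine continuous_spaceLift _ (fun e => ?_) (fun e => ?_) (fun e => ?_)
  · unfold signPieces bump
    have := continuous_fromEnd true
    have := continuous_fromEnd false
    fun_prop
  · change D.endSign e false * bump ((0 : unitInterval) / D.rad) +
      D.endSign e true * bump ((unitInterval.symm 0 : unitInterval) / D.rad) = 0
    rw [unitInterval.symm_zero]
    simp [bump_zero, h1]
  · change D.endSign e false * bump ((1 : unitInterval) / D.rad) +
      D.endSign e true * bump ((unitInterval.symm 1 : unitInterval) / D.rad) = 0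
    rw [unitInterval.symm_one]
    simp [bump_zero, h1]

/-- The point lies outside the star of `v`. -/
def Far (p : D.Γ.Space) : Prop :=
  (∃ w, w ≠ D.v ∧ p = vert w) ∨ ∃ e, ∃ t : unitInterval, t ≠ 0 ∧ t ≠ 1 ∧ p = pt e t ∧
    ∀ b, D.Γ.ends e b = D.v → D.rad ≤ fromEnd b t

/-- Statements about single points are proved by these three cases: the vertex, the punctured open
star, and the rest, where the distance is 1 and the sign is 0. -/
theorem trichotomy (p : D.Γ.Space) : p = vert D.v ∨ (∃ e b, ∃ x : unitInterval,
    D.Γ.ends e b = D.v ∧ 0 < (x : ℝ) ∧ (x : ℝ) < D.rad ∧ p = pt e (fromEnd b x)) ∨ D.Far p := by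
  rcases D.exists_rep p with ⟨w, rfl⟩ | ⟨e, t, h0, h1, rfl⟩
  · by_cases hw : w = D.v
    · exact Or.inl (hw ▸ rfl)
    · exact Or.inr (Or.inr (Or.inl ⟨w, hw, rfl⟩))
  · by_cases h : ∀ b, D.Γ.ends e b = D.v → D.rad ≤ fromEnd b t
    · exact Or.inr (Or.inr (Or.inr ⟨e, t, h0, h1, rfl, h⟩))
    · push Not at h
      obtain ⟨b, hb, hr⟩ := h
      refine Or.inr (Or.inl ⟨e, b, fromEnd b t, hb, ?_, hr, by rw [fromEnd_fromEnd]⟩)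
      exact (interior_iff.1 (fromEnd_interior h0 h1)).1

theorem dist_v : D.dist (vert D.v) = 0 := if_pos rfl

theorem sign_v : D.sign (vert D.v) = 0 := rfl

variable {D}

theorem Far.dist {p : D.Γ.Space} (h : D.Far p) : D.dist p = 1 := by
  rcases h with ⟨w, hw, rfl⟩ | ⟨e, t, h0, h1, rfl, h⟩
  · exact if_neg hw
  · rw [HalfEdgeData.dist, spaceLift_pt _ e h0 h1]
    change min _ _ = _
    rw [D.endDist_of_ge (h false), D.endDist_of_ge (h true), min_self]

theorem endSign_of_ne {e : D.Γ.E} {b : Bool} (h : D.Γ.ends e b ≠ D.v) : D.endSign e b = 0 := by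
  rw [endSign, if_neg fun h' => h (D.incident _ h'), if_neg h]

theorem Far.sign {p : D.Γ.Space} (h : D.Far p) : D.sign p = 0 := by
  rcases h with ⟨w, hw, rfl⟩ | ⟨e, t, h0, h1, rfl, h⟩
  · rfl
  · rw [HalfEdgeData.sign, spaceLift_pt _ e h0 h1]
    have : ∀ b, D.endSign e b * bump (fromEnd b t / D.rad) = 0 := fun b => by
      by_cases hb : D.Γ.ends e b = D.v
      · rw [bump_of_ge ((one_le_div D.rad_pos).2 (h b hb)), mul_zero]
      · rw [endSign_of_ne hb, zero_mul]
    change D.endSign e false * bump (fromEnd false t / D.rad) +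
      D.endSign e true * bump (fromEnd true t / D.rad) = 0
    rw [this, this, add_zero]

section Star

variable {e : D.Γ.E} {b : Bool} {x : unitInterval}

theorem star_interior (h0 : 0 < (x : ℝ)) (h1 : (x : ℝ) < D.rad) :
    fromEnd b x ≠ 0 ∧ fromEnd b x ≠ 1 := by
  have hx := interior_iff.2 ⟨h0, by linarith [D.rad_le]⟩
  exact fromEnd_interior hx.1 hx.2

theorem star_dist (hb : D.Γ.ends e b = D.v) (h0 : 0 < (x : ℝ)) (h1 : (x : ℝ) < D.rad) :
    (D.dist (pt e (fromEnd b x)) : ℝ) = x / D.rad := by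
  have hi := star_interior (b := b) h0 h1
  rw [dist, spaceLift_pt _ e hi.1 hi.2]
  have h2 : D.endDist e (!b) (fromEnd (!b) (fromEnd b x)) = 1 := D.endDist_of_ge fun _ => by
    rw [coe_fromEnd_not, fromEnd_fromEnd]
    linarith [D.rad_le]
  have h3 : D.distPieces (.inr (e, fromEnd b x)) = D.endDist e b x := by
    cases b
    · change min (D.endDist e false x) _ = _
      rw [show D.endDist e true (fromEnd true (fromEnd false x)) = 1 from h2]
      exact min_eq_left unitInterval.le_one'
    · change min _ (D.endDist e true (fromEnd true (fromEnd true x))) = _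
      rw [show D.endDist e false (fromEnd false (fromEnd true x)) = 1 from h2, fromEnd_fromEnd]
      exact min_eq_right unitInterval.le_one'
  rw [h3, endDist, if_pos hb, clampI_of_mem (div_nonneg h0.le D.rad_pos.le)
    ((div_le_one D.rad_pos).2 h1.le)]

theorem star_sign (h0 : 0 < (x : ℝ)) (h1 : (x : ℝ) < D.rad) :
    D.sign (pt e (fromEnd b x)) = D.endSign e b * bump (x / D.rad) := by
  have hi := star_interior (b := b) h0 h1
  rw [sign, spaceLift_pt _ e hi.1 hi.2]
  have h2 : bump (fromEnd (!b) (fromEnd b x) / D.rad) = 0 := bump_of_ge (by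
    rw [coe_fromEnd_not, fromEnd_fromEnd, one_le_div D.rad_pos]
    linarith [D.rad_le])
  change D.endSign e false * bump (fromEnd false (fromEnd b x) / D.rad) +
      D.endSign e true * bump (fromEnd true (fromEnd b x) / D.rad) = _
  cases b
  · rw [show bump (fromEnd true (fromEnd false x) / D.rad) = 0 from h2, fromEnd_fromEnd,
      mul_zero, add_zero]
  · rw [show bump (fromEnd false (fromEnd true x) / D.rad) = 0 from h2, fromEnd_fromEnd,
      mul_zero, zero_add]

theorem star_bump_pos (h0 : 0 < (x : ℝ)) (h1 : (x : ℝ) < D.rad) : 0 < bump (x / D.rad) :=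
  bump_pos (div_pos h0 D.rad_pos) ((div_lt_one D.rad_pos).2 h1)

theorem star_sign_pos (h0 : 0 < (x : ℝ)) (h1 : (x : ℝ) < D.rad) :
    0 < D.sign (pt e (fromEnd b x)) ↔ (e, b) ∈ D.H := by
  rw [star_sign h0 h1, mul_pos_iff_of_pos_right (star_bump_pos h0 h1)]
  unfold endSign
  split_ifs <;> simp_all

end Star

theorem sign_pos_iff {p : D.Γ.Space} : 0 < D.sign p ↔ ∃ h ∈ D.H, ∃ x : unitInterval,
    0 < (x : ℝ) ∧ (x : ℝ) < D.rad ∧ p = pt h.1 (fromEnd h.2 x) := by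
  constructor
  · intro h
    rcases D.trichotomy p with rfl | ⟨e, b, x, hb, h0, h1, rfl⟩ | hf
    · exact absurd h (by rw [sign_v]; exact lt_irrefl _)
    · exact ⟨(e, b), (star_sign_pos h0 h1).1 h, x, h0, h1, rfl⟩
    · exact absurd h (by rw [hf.sign]; exact lt_irrefl _)
  · rintro ⟨⟨e, b⟩, hh, x, h0, h1, rfl⟩
    exact (star_sign_pos h0 h1).2 hh

theorem dist_pos {p : D.Γ.Space} (hp : p ≠ vert D.v) : 0 < D.dist p := by
  rcases D.trichotomy p with rfl | ⟨e, b, x, hb, h0, h1, rfl⟩ | hf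
  · exact absurd rfl hp
  · have := star_dist hb h0 h1
    exact_mod_cast this ▸ div_pos h0 D.rad_pos
  · rw [hf.dist]
    exact zero_lt_one

/-- Whether the interior point of an edge lies outside the half-edges in `H`. -/
theorem pt_notMem_iff {e : D.Γ.E} {t : unitInterval} (h0 : t ≠ 0) (h1 : t ≠ 1) :
    (∀ h ∈ D.H, (pt e t : D.Γ.Space) ∉ halfEdge D.ρ h) ↔ ∀ b, (e, b) ∈ D.H → D.ρ ≤ fromEnd b t := by
  constructor
  · intro h b hb
    by_contra hlt
    push Not at hlt
    exact h (e, b) hb ⟨fromEnd b t, (interior_iff.1 (fromEnd_interior h0 h1)).1, hlt,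
      by rw [fromEnd_fromEnd]⟩
  · intro h
    apply D.pt_notMem
    · by_cases hb : (e, false) ∈ D.H
      · rw [cut, if_pos hb]
        exact h false hb
      · rw [cut, if_neg hb]
        exact t.2.1
    · by_cases hb : (e, true) ∈ D.H
      · rw [cut, if_pos hb]
        have := h true hb
        change D.ρ ≤ 1 - (t : ℝ) at this
        linarith
      · rw [cut, if_neg hb, sub_zero]
        exact t.2.2

theorem sign_nonpos_of_notMem {p : D.Γ.Space} (hp : ∀ h ∈ D.H, p ∉ halfEdge D.ρ h) :
    D.sign p ≤ 0 := by
  by_contra hs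
  push Not at hs
  obtain ⟨h, hh, x, h0, h1, rfl⟩ := sign_pos_iff.1 hs
  exact hp h hh ⟨x, h0, h1.trans D.rad_lt, rfl⟩

end HalfEdgeData

namespace HalfEdgeData

variable (D : HalfEdgeData.{u})

/-! ### The flow that empties the half-edges -/

open Classical in
/-- The final position under the flow, in terms of the distance from the end `b` of the edge. -/
def target (e : D.Γ.E) (b : Bool) (x : ℝ) : ℝ :=
  -- With both half-edges in `H`, the edge is mapped affinely onto [ρ, 1 − ρ]. With only one of
  -- them, its points move to distance at least 1/2 ≥ ρ and those beyond 2/3 are fixed; the two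
  -- one-sided formulas are mirror images of each other.
  if (e, b) ∈ D.H then
    if (e, !b) ∈ D.H then D.ρ + (1 - 2 * D.ρ) * x else max x (1 / 2 + x / 4)
  else if (e, !b) ∈ D.H then min x (1 / 4 + x / 4) else x

theorem both_lt {e : D.Γ.E} {b : Bool} (h : (e, b) ∈ D.H) (h' : (e, !b) ∈ D.H) : D.ρ < 1 / 2 := by
  cases b
  · exact D.loops e h h'
  · exact D.loops e h' h

theorem target_strictMono (e : D.Γ.E) (b : Bool) : StrictMono (D.target e b) := by
  intro x y hxy
  unfold target
  split_ifs with h h' h'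
  · have := D.both_lt h h'
    nlinarith
  · exact max_lt_max hxy (by linarith)
  · exact min_lt_min hxy (by linarith)
  · exact hxy

theorem target_nonneg (e : D.Γ.E) (b : Bool) {x : ℝ} (h0 : 0 ≤ x) : 0 ≤ D.target e b x := by
  have := D.ρ_le
  have := D.ρ_pos
  unfold target
  split_ifs with h h' h'
  · nlinarith
  · exact le_max_of_le_left h0
  · exact le_min h0 (by linarith)
  · exact h0

theorem target_not (e : D.Γ.E) (b : Bool) (x : ℝ) :
    D.target e (!b) (1 - x) = 1 - D.target e b x := by
  unfold target
  rw [Bool.not_not]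
  split_ifs with h h' h'
  · ring
  · rw [← max_sub_sub_left]
    congr 1; ring
  · rw [← min_sub_sub_left]
    congr 1; ring
  · rfl

theorem continuous_target (e : D.Γ.E) (b : Bool) : Continuous (D.target e b) := by
  unfold target
  split_ifs <;> fun_prop

/-- The position at the time `s`, in terms of the distance from the end `b` of the edge. -/
def flowR (e : D.Γ.E) (b : Bool) (s x : ℝ) : ℝ := max (x - s) (min (x + s) (D.target e b x))

/-- The position is the target truncated to [x − s, x + s], that is, motion of speed at most one
towards the target. This description is symmetric under reversal of the edge, and so is the target
by `target_not`. -/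
theorem flowR_not (e : D.Γ.E) (b : Bool) {s : ℝ} (hs : 0 ≤ s) (x : ℝ) :
    D.flowR e (!b) s (1 - x) = 1 - D.flowR e b s x := by
  unfold flowR
  rw [target_not]
  rcases le_total (x - s) (D.target e b x) with h1 | h1 <;>
    rcases le_total (x + s) (D.target e b x) with h2 | h2
  · rw [min_eq_left h2, min_eq_right (by linarith), max_eq_left (by linarith),
      max_eq_right (by linarith)]
    ring
  · rw [min_eq_right h2, min_eq_right (by linarith), max_eq_right (by linarith), max_eq_right h1]
  · rw [min_eq_left h2, min_eq_right (by linarith), max_eq_left (by linarith),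
      max_eq_right (by linarith)]
    ring
  · rw [min_eq_right h2, min_eq_left (by linarith), max_eq_right (by linarith), max_eq_left h1]
    ring

theorem flowR_nonneg (e : D.Γ.E) (b : Bool) {s x : ℝ} (hs : 0 ≤ s) (hx : 0 ≤ x) :
    0 ≤ D.flowR e b s x :=
  le_max_of_le_right (le_min (by linarith) (D.target_nonneg e b hx))

theorem flowR_le_one (e : D.Γ.E) (b : Bool) {s x : ℝ} (hs : 0 ≤ s) (hx : x ≤ 1) :
    D.flowR e b s x ≤ 1 := by
  have h := D.flowR_nonneg e (!b) hs (x := 1 - x) (by linarith)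
  rw [flowR_not D e b hs] at h
  linarith

theorem flowR_strictMono (e : D.Γ.E) (b : Bool) (s : ℝ) : StrictMono (D.flowR e b s) := by
  intro x y h
  exact max_lt_max (by linarith) (min_lt_min (by linarith) (D.target_strictMono e b h))

def flowI (s : unitInterval) (e : D.Γ.E) (t : unitInterval) : unitInterval :=
  ⟨D.flowR e false s t, D.flowR_nonneg e false s.2.1 t.2.1, D.flowR_le_one e false s.2.1 t.2.2⟩

theorem fromEnd_flowI (s : unitInterval) (e : D.Γ.E) (b : Bool) (t : unitInterval) :
    (fromEnd b (D.flowI s e t) : ℝ) = D.flowR e b s (fromEnd b t) := by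
  cases b
  · rfl
  · exact (D.flowR_not e false s.2.1 t).symm

theorem continuous_flowI (e : D.Γ.E) :
    Continuous fun x : unitInterval × unitInterval => D.flowI x.1 e x.2 := by
  have := D.continuous_target e false
  unfold flowI flowR
  refine Continuous.subtype_mk ?_ _
  fun_prop

theorem flowI_injective (s : unitInterval) (e : D.Γ.E) : Injective (D.flowI s e) := fun t t' h =>
  Subtype.ext ((D.flowR_strictMono e false s).injective (congrArg Subtype.val h))

theorem flowI_interior (s : unitInterval) (e : D.Γ.E) (t : unitInterval) (h0 : t ≠ 0) (h1 : t ≠ 1) :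
    D.flowI s e t ≠ 0 ∧ D.flowI s e t ≠ 1 := by
  obtain ⟨h0, h1⟩ := interior_iff.1 ⟨h0, h1⟩
  refine interior_iff.2 ⟨?_, ?_⟩
  · exact (D.flowR_nonneg e false s.2.1 le_rfl).trans_lt (D.flowR_strictMono e false s h0)
  · exact (D.flowR_strictMono e false s h1).trans_le (D.flowR_le_one e false s.2.1 le_rfl)

theorem flowR_zero (e : D.Γ.E) (b : Bool) (x : ℝ) : D.flowR e b 0 x = x := by
  unfold flowR
  rw [sub_zero, add_zero]
  exact max_eq_left (min_le_left _ _)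

theorem flowR_le (e : D.Γ.E) (b : Bool) {s : ℝ} (hs : 0 ≤ s) (x : ℝ) : D.flowR e b s x ≤ x + s :=
  max_le (by linarith) (min_le_left _ _)

theorem flowR_outer {e : D.Γ.E} {b : Bool} {s x : ℝ} (hs : 0 ≤ s) (hx : 0 ≤ x) (h : (e, b) ∉ D.H)
    (hr : x ≤ 1 / 4) : D.flowR e b s x = x := by
  have : D.target e b x = x := by
    unfold target
    rw [if_neg h]
    split_ifs
    · exact min_eq_left (by linarith)
    · rfl
  unfold flowR
  rw [this, min_eq_right (by linarith), max_eq_right (by linarith)]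

theorem target_ge {e : D.Γ.E} {b : Bool} {x : ℝ} (hx : 0 ≤ x) (h : (e, b) ∈ D.H) :
    D.ρ ≤ D.target e b x := by
  have := D.ρ_le
  unfold target
  rw [if_pos h]
  split_ifs with h'
  · nlinarith
  · exact le_max_of_le_right (by linarith)

theorem flowR_ge_ρ {e : D.Γ.E} {b : Bool} {s x : ℝ} (hs : 0 ≤ s) (hx : D.ρ ≤ x) (h : (e, b) ∈ D.H) :
    D.ρ ≤ D.flowR e b s x :=
  le_max_of_le_right (le_min (by linarith) (D.target_ge (D.ρ_pos.le.trans hx) h))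

theorem flowR_one_ge {e : D.Γ.E} {b : Bool} {x : ℝ} (hx : 0 ≤ x) (h : (e, b) ∈ D.H) :
    D.ρ ≤ D.flowR e b 1 x :=
  le_max_of_le_right (le_min (by linarith [D.ρ_le]) (D.target_ge hx h))

theorem flowR_ge_rad {e : D.Γ.E} {b : Bool} {s x : ℝ} (hs : 0 ≤ s) (hx : D.rad ≤ x) :
    D.rad ≤ D.flowR e b s x := by
  have hr := D.rad_le
  have hr0 := D.rad_pos
  refine le_max_of_le_right (le_min (by linarith) ?_)
  by_cases h : (e, b) ∈ D.H
  · exact D.rad_lt.le.trans (D.target_ge (by linarith) h)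
  · unfold target
    rw [if_neg h]
    split_ifs
    · exact le_min hx (by linarith)
    · exact hx

/-- In a half-edge in `H`, the flow has constant speed until it leaves the star. -/
theorem flowR_inner {e : D.Γ.E} {b : Bool} {s x : ℝ} (hs : 0 ≤ s) (hx : 0 ≤ x) (hr : x < D.rad)
    (h : (e, b) ∈ D.H) : x ≤ D.flowR e b s x ∧ (D.flowR e b s x < D.rad → D.flowR e b s x = x + s) ∧
      D.flowR e b s x ≤ 1 - D.rad := by
  have hr4 := D.rad_le
  have hlt := D.rad_lt
  have hρ := D.ρ_le
  have ht := D.target_ge hx h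
  have h1 : D.flowR e b s x = min (x + s) (D.target e b x) :=
    max_eq_right (le_min (by linarith) (by linarith))
  rw [h1]
  refine ⟨le_min (by linarith) (by linarith), fun h' => ?_, min_le_of_right_le ?_⟩
  · rcases min_lt_iff.1 h' with h' | h'
    · exact min_eq_left (by linarith)
    · linarith
  · unfold target
    rw [if_pos h]
    split_ifs with h'
    · nlinarith [D.both_lt h h']
    · exact max_le (by linarith) (by linarith)

/-- The flow on the graph, which is not continuous at `v`. -/
def flow (s : unitInterval) : D.Γ.Space → D.Γ.Space := edgeFun (D.flowI s)

theorem flow_v (s : unitInterval) : D.flow s (vert D.v) = vert D.v := rfl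

theorem flow_injective (s : unitInterval) : Injective (D.flow s) :=
  edgeFun_injective D (D.flowI_injective s) (D.flowI_interior s)

theorem flow_zero (p : D.Γ.Space) : D.flow 0 p = p := by
  rcases D.exists_rep p with ⟨w, rfl⟩ | ⟨e, t, h0, h1, rfl⟩
  · rfl
  · rw [flow, edgeFun_pt _ e h0 h1]
    congr 1
    exact Subtype.ext (D.flowR_zero e false t)

/-- An end of an edge at a vertex other than `v` is not in `H`, and such ends are fixed by the flow.
Only the half-edges in `H` jump away from their end, and that end is `v`. -/
theorem continuousOn_flow : ContinuousOn (fun x : unitInterval × D.Γ.Space => D.flow x.1 x.2)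
    (Prod.snd ⁻¹' {p | p ≠ vert D.v}) := by
  refine continuousOn_edgeFun D.flowI D.continuous_flowI D.isOpen_punctured
    (fun e he s => ?_) (fun e he s => ?_)
  · have h : (e, false) ∉ D.H := fun h => he (congrArg vert (D.incident _ h))
    exact Subtype.ext (D.flowR_outer s.2.1 le_rfl h (by norm_num))
  · have h : (e, true) ∉ D.H := fun h => he (congrArg vert (D.incident _ h))
    have h1 := D.flowR_outer (e := e) (b := true) s.2.1 le_rfl h (by norm_num)
    have h2 := D.flowR_not e true s.2.1 0
    rw [h1] at h2
    refine Subtype.ext ?_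
    change D.flowR e false s 1 = 1
    simpa using h2

variable {D}

theorem flow_pt (s : unitInterval) (e : D.Γ.E) {t : unitInterval} (h0 : t ≠ 0) (h1 : t ≠ 1) :
    D.flow s (pt e t) = pt e (D.flowI s e t) := edgeFun_pt _ e h0 h1

theorem Far.flow {p : D.Γ.Space} (h : D.Far p) (s : unitInterval) : D.Far (D.flow s p) := by
  rcases h with ⟨w, hw, rfl⟩ | ⟨e, t, h0, h1, rfl, h⟩
  · exact Or.inl ⟨w, hw, rfl⟩
  · have hi := D.flowI_interior s e t h0 h1
    refine Or.inr ⟨e, D.flowI s e t, hi.1, hi.2, flow_pt s e h0 h1, fun b hb => ?_⟩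
    rw [fromEnd_flowI]
    exact D.flowR_ge_rad s.2.1 (h b hb)

theorem flow_outer {e : D.Γ.E} {b : Bool} {x : unitInterval} (s : unitInterval)
    (h0 : 0 < (x : ℝ)) (h1 : (x : ℝ) < D.rad) (h : (e, b) ∉ D.H) :
    D.flow s (pt e (fromEnd b x)) = pt e (fromEnd b x) := by
  have hi := star_interior (b := b) h0 h1
  rw [flow_pt s e hi.1 hi.2]
  congr 1
  rw [← fromEnd_fromEnd b (D.flowI s e (fromEnd b x))]
  congr 1
  apply Subtype.ext
  rw [fromEnd_flowI, fromEnd_fromEnd]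
  exact D.flowR_outer s.2.1 h0.le h (by linarith [D.rad_le])

theorem flow_inner {e : D.Γ.E} {b : Bool} {x : unitInterval} (s : unitInterval)
    (h0 : 0 < (x : ℝ)) (h1 : (x : ℝ) < D.rad) (h : (e, b) ∈ D.H) :
    (∃ y : unitInterval, (y : ℝ) = x + s ∧ (y : ℝ) < D.rad ∧
      D.flow s (pt e (fromEnd b x)) = pt e (fromEnd b y)) ∨
    D.Far (D.flow s (pt e (fromEnd b x))) ∧ D.rad ≤ x + s := by
  have hi := star_interior (b := b) h0 h1
  have hf := D.flowI_interior s e _ hi.1 hi.2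
  rw [flow_pt s e hi.1 hi.2]
  set y := D.flowI s e (fromEnd b x) with hy
  have hyb : (fromEnd b y : ℝ) = D.flowR e b s x := by
    rw [hy, fromEnd_flowI, fromEnd_fromEnd]
  obtain ⟨h2, h3, h4⟩ := D.flowR_inner s.2.1 h0.le h1 h
  by_cases hlt : D.flowR e b s x < D.rad
  · left
    refine ⟨fromEnd b y, ?_, ?_, by rw [fromEnd_fromEnd]⟩
    · rw [hyb, h3 hlt]
    · rw [hyb]; exact hlt
  · right
    push Not at hlt
    refine ⟨Or.inr ⟨e, y, hf.1, hf.2, rfl, fun b' hb' => ?_⟩,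
      hlt.trans (D.flowR_le e b s.2.1 x)⟩
    by_cases hbb : b' = b
    · rw [hbb, hyb]; exact hlt
    · have : b' = !b := Bool.eq_not.2 hbb
      rw [this, coe_fromEnd_not, hyb]
      linarith

/-- The effect of the flow on the distance to `v`. -/
theorem flow_spec (s : unitInterval) (p : D.Γ.Space) :
    D.dist p ≤ D.dist (D.flow s p) ∧ (D.dist (D.flow s p) : ℝ) ≤ D.dist p + s / D.rad ∧
    (0 < D.sign (D.flow s p) →
      0 < D.sign p ∧ (D.dist (D.flow s p) : ℝ) = D.dist p + s / D.rad) ∧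
    (D.sign p ≤ 0 → (D.dist p : ℝ) < 1 → D.flow s p = p) := by
  have hs : 0 ≤ (s : ℝ) / D.rad := div_nonneg s.2.1 D.rad_pos.le
  rcases D.trichotomy p with rfl | ⟨e, b, x, hb, h0, h1, rfl⟩ | hf
  · rw [flow_v]
    refine ⟨le_rfl, by linarith, fun h => ?_, fun _ _ => rfl⟩
    rw [sign_v] at h
    exact absurd h (lt_irrefl _)
  · by_cases hH : (e, b) ∈ D.H
    · have hsg : 0 < D.sign (pt e (fromEnd b x)) := (star_sign_pos h0 h1).2 hH
      have hd := star_dist hb h0 h1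
      rcases flow_inner s h0 h1 hH with ⟨y, hy, hyr, hyf⟩ | ⟨hF, hr⟩
      · have hy0 : 0 < (y : ℝ) := by linarith [s.2.1]
        have hd' := star_dist hb hy0 hyr
        rw [← hyf, hy] at hd'
        have e1 : (D.dist (D.flow s (pt e (fromEnd b x))) : ℝ) =
          D.dist (pt e (fromEnd b x)) + s / D.rad := by rw [hd', hd]; ring
        refine ⟨?_, e1.le, fun _ => ⟨hsg, e1⟩, fun h => absurd hsg (not_lt.2 h)⟩
        change (D.dist _ : ℝ) ≤ D.dist _
        linarith
      · refine ⟨?_, ?_, fun h => ?_, fun h => absurd hsg (not_lt.2 h)⟩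
        · rw [hF.dist]; exact unitInterval.le_one'
        · rw [hF.dist, hd, ← add_div]
          exact (one_le_div D.rad_pos).2 hr
        · rw [hF.sign] at h
          exact absurd h (lt_irrefl _)
    · have hfl := flow_outer s h0 h1 hH
      rw [hfl]
      refine ⟨le_rfl, by linarith, fun h => ?_, fun _ _ => rfl⟩
      exact absurd ((star_sign_pos h0 h1).1 h) hH
  · rw [(hf.flow s).dist, hf.dist]
    refine ⟨le_rfl, by linarith, fun h => ?_, fun _ h => ?_⟩
    · rw [(hf.flow s).sign] at h
      exact absurd h (lt_irrefl _)
    · exact absurd h (lt_irrefl _)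

theorem flow_notMem {p : D.Γ.Space} (s : unitInterval) (hp : ∀ h ∈ D.H, p ∉ halfEdge D.ρ h) :
    ∀ h ∈ D.H, D.flow s p ∉ halfEdge D.ρ h := by
  rcases D.exists_rep p with ⟨w, rfl⟩ | ⟨e, t, h0, h1, rfl⟩
  · exact hp
  · have hi := D.flowI_interior s e t h0 h1
    rw [flow_pt s e h0 h1, pt_notMem_iff hi.1 hi.2]
    intro b hb
    rw [fromEnd_flowI]
    exact D.flowR_ge_ρ s.2.1 ((pt_notMem_iff h0 h1).1 hp b hb) hb

theorem flow_one_notMem (p : D.Γ.Space) : ∀ h ∈ D.H, D.flow 1 p ∉ halfEdge D.ρ h := by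
  rcases D.exists_rep p with ⟨w, rfl⟩ | ⟨e, t, h0, h1, rfl⟩
  · exact D.vert_notMem w
  · have hi := D.flowI_interior 1 e t h0 h1
    rw [flow_pt 1 e h0 h1, pt_notMem_iff hi.1 hi.2]
    intro b hb
    rw [fromEnd_flowI]
    exact D.flowR_one_ge (fromEnd b t).2.1 hb

/-! ### The contraction of the half-edges to the vertex -/

variable (D)

/-- A tent that equals `x` up to 1/4 and vanishes from 1/2 on. Subtracting a multiple of it scales
the star linearly and does not affect the other half of the edge. -/
def hat (x : ℝ) : ℝ := min x (max 0 (1 / 2 - x))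

theorem hat_nonneg {x : ℝ} (hx : 0 ≤ x) : 0 ≤ hat x := le_min hx (le_max_left _ _)

theorem hat_le (x : ℝ) : hat x ≤ x := min_le_left _ _

theorem hat_of_ge {x : ℝ} (hx : 1 / 2 ≤ x) : hat x = 0 := by
  unfold hat
  rw [max_eq_left (by linarith), min_eq_right (by linarith)]

theorem hat_of_le {x : ℝ} (hx : x ≤ 1 / 4) : hat x = x := by
  unfold hat
  exact min_eq_left (le_max_of_le_right (by linarith))

open Classical in
def inH (e : D.Γ.E) (b : Bool) : ℝ := if (e, b) ∈ D.H then 1 else 0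

/-- The corrections from the two ends have disjoint supports. At `s = 1` the map is not injective
near an end in `H`; this is harmless, since at most one point of a configuration is contracted. -/
def contractR (e : D.Γ.E) (b : Bool) (s x : ℝ) : ℝ :=
  x - s * D.inH e b * hat x + s * D.inH e (!b) * hat (1 - x)

theorem inH_mem (e : D.Γ.E) (b : Bool) : 0 ≤ D.inH e b ∧ D.inH e b ≤ 1 := by
  unfold inH; split_ifs <;> norm_num

theorem contractR_not (e : D.Γ.E) (b : Bool) (s x : ℝ) :
    D.contractR e (!b) s (1 - x) = 1 - D.contractR e b s x := by
  unfold contractR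
  rw [Bool.not_not, sub_sub_cancel]
  ring

theorem contractR_nonneg (e : D.Γ.E) (b : Bool) {s x : ℝ} (hs : 0 ≤ s) (hs1 : s ≤ 1) (hx : 0 ≤ x)
    (hx1 : x ≤ 1) : 0 ≤ D.contractR e b s x := by
  have h1 := D.inH_mem e b
  have h2 := D.inH_mem e (!b)
  have h3 : 0 ≤ s * D.inH e (!b) * hat (1 - x) :=
    mul_nonneg (mul_nonneg hs h2.1) (hat_nonneg (by linarith))
  have h4 : s * D.inH e b ≤ 1 := mul_le_one₀ hs1 h1.1 h1.2
  have h5 : s * D.inH e b * hat x ≤ 1 * x :=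
    mul_le_mul h4 (hat_le x) (hat_nonneg hx) zero_le_one
  unfold contractR
  linarith

def contractI (s : unitInterval) (e : D.Γ.E) (t : unitInterval) : unitInterval :=
  ⟨D.contractR e false s t, D.contractR_nonneg e false s.2.1 s.2.2 t.2.1 t.2.2, by
    have h := D.contractR_nonneg e true s.2.1 s.2.2 (x := 1 - t) (by linarith [t.2.2])
      (by linarith [t.2.1])
    have := D.contractR_not e false s t
    rw [Bool.not_false] at this
    linarith⟩

theorem fromEnd_contractI (s : unitInterval) (e : D.Γ.E) (b : Bool) (t : unitInterval) :
    (fromEnd b (D.contractI s e t) : ℝ) = D.contractR e b s (fromEnd b t) := by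
  cases b
  · rfl
  · exact (D.contractR_not e false s t).symm

/-- The contraction of the half-edges in `H` to `v`. -/
def contract (s : unitInterval) : D.Γ.Space → D.Γ.Space := edgeFun (D.contractI s)

/-- Unlike the flow, the contraction is continuous at `v` too, because all ends of the edges stay
fixed. -/
theorem continuous_contract :
    Continuous fun x : unitInterval × D.Γ.Space => D.contract x.1 x.2 := by
  have h := continuousOn_edgeFun D.contractI (fun e => ?_) isOpen_univ
    (fun e _ s => ?_) (fun e _ s => ?_)
  · exact continuousOn_univ.1 (h.mono fun _ _ => mem_univ _)
  · unfold contractI contractR hat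
    refine Continuous.subtype_mk ?_ _
    fun_prop
  · refine Subtype.ext ?_
    change (0 : ℝ) - s * _ * hat 0 + s * _ * hat (1 - 0) = 0
    rw [hat_of_le (by norm_num), hat_of_ge (by norm_num)]
    ring
  · refine Subtype.ext ?_
    change (1 : ℝ) - s * _ * hat 1 + s * _ * hat (1 - 1) = 1
    rw [hat_of_ge (by norm_num), hat_of_le (by norm_num)]
    ring

theorem contract_v (s : unitInterval) : D.contract s (vert D.v) = vert D.v := rfl

variable {D}

/-- The effect of the contraction near `v`. -/
theorem contract_spec (s : unitInterval) {p : D.Γ.Space} (hp : (D.dist p : ℝ) ≤ 1 / 2) :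
    (D.sign p ≤ 0 → D.contract s p = p) ∧ D.dist (D.contract s p) ≤ D.dist p ∧
    (0 < D.sign (D.contract s p) →
      0 < D.sign p ∧ (D.dist (D.contract s p) : ℝ) = (1 - s) * D.dist p) ∧
    (s = 0 → D.contract s p = p) ∧ (s = 1 → ∀ h ∈ D.H, D.contract s p ∉ halfEdge D.ρ h) := by
  rcases D.trichotomy p with rfl | ⟨e, b, x, hb, h0, h1, rfl⟩ | hf
  · rw [contract_v]
    refine ⟨fun _ => rfl, le_rfl, fun h => ?_, fun _ => rfl, fun _ => D.vert_notMem _⟩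
    rw [sign_v] at h
    exact absurd h (lt_irrefl _)
  · have hr := D.rad_le
    have hi := star_interior (b := b) h0 h1
    have hc : D.contract s (pt e (fromEnd b x)) = pt e (D.contractI s e (fromEnd b x)) :=
      edgeFun_pt _ e hi.1 hi.2
    set y := fromEnd b (D.contractI s e (fromEnd b x)) with hy
    have hc' : D.contract s (pt e (fromEnd b x)) = pt e (fromEnd b y) := by
      rw [hc, hy, fromEnd_fromEnd]
    have hyv : (y : ℝ) = x - s * D.inH e b * x := by
      rw [hy, fromEnd_contractI, fromEnd_fromEnd, contractR, hat_of_le (by linarith),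
        hat_of_ge (x := 1 - x) (by linarith)]
      ring
    by_cases hH : (e, b) ∈ D.H
    · have hsg : 0 < D.sign (pt e (fromEnd b x)) := (star_sign_pos h0 h1).2 hH
      rw [inH, if_pos hH] at hyv
      have hs := s.2.1
      have hs1 := s.2.2
      have hyr : (y : ℝ) < D.rad := by nlinarith
      refine ⟨fun h => absurd hsg (not_lt.2 h), ?_⟩
      -- Here `y = (1 - s) x` with `x` positive, so `y = 0` happens only at `s = 1`, when the point
      -- has arrived at `v`.
      rcases y.2.1.eq_or_lt with hy0 | hy0
      · have hyz : y = 0 := Subtype.ext hy0.symm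
        have hcv : D.contract s (pt e (fromEnd b x)) = vert D.v := by
          rw [hc', hyz, ← hb]
          cases b
          · exact pt_zero e
          · refine Eq.trans ?_ (pt_one e)
            change pt e (unitInterval.symm 0) = _
            rw [unitInterval.symm_zero]
        rw [hcv, sign_v, dist_v]
        refine ⟨unitInterval.nonneg', fun h => absurd h (lt_irrefl _), fun h => ?_,
          fun _ => D.vert_notMem _⟩
        subst h
        rw [← hy0] at hyv
        simp at hyv
        linarith
      · have hd' := star_dist hb hy0 hyr
        have hd := star_dist hb h0 h1
        rw [hc']
        have hdd : (D.dist (pt e (fromEnd b y)) : ℝ) = (1 - s) * D.dist (pt e (fromEnd b x)) := by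
          rw [hd', hd, hyv]; ring
        refine ⟨?_, fun _ => ⟨hsg, hdd⟩, fun h => ?_, fun h => ?_⟩
        · change (D.dist _ : ℝ) ≤ D.dist _
          rw [hdd]
          nlinarith [(D.dist (pt e (fromEnd b x))).2.1]
        · subst h
          have : y = x := Subtype.ext (by rw [hyv]; simp)
          rw [this]
        · subst h
          simp at hyv
          exact absurd hy0 (by rw [hyv]; simp)
    · rw [inH, if_neg hH] at hyv
      have hyx : y = x := Subtype.ext (by rw [hyv]; ring)
      rw [hc', hyx]
      refine ⟨fun _ => rfl, le_rfl, fun h => absurd ((star_sign_pos h0 h1).1 h) hH, fun _ => rfl,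
        fun _ => (pt_notMem_iff hi.1 hi.2).2 fun b' hb' => ?_⟩
      have : b' = !b := Bool.eq_not.2 fun h => hH (h ▸ hb')
      rw [this, coe_fromEnd_not, fromEnd_fromEnd]
      linarith [D.ρ_le]
  · rw [hf.dist] at hp
    norm_num at hp

end HalfEdgeData

namespace HalfEdgeData

variable (D : HalfEdgeData.{u})

/-! ### Shrinking the edges by variable amounts -/

/-- Lengths to be removed from the edges at their ends, at most those of the half-edges in `H`. -/
structure Cuts where
  c : D.Γ.E → Bool → ℝ
  nonneg : ∀ e b, 0 ≤ c e b
  le_cut : ∀ e b, c e b ≤ D.cut e b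

namespace Cuts

variable {D} (c : D.Cuts)

theorem sum_lt (e : D.Γ.E) : c.c e false + c.c e true < 1 :=
  (add_le_add (c.le_cut e false) (c.le_cut e true)).trans_lt (D.cut_add_lt e)

theorem eq_zero {e : D.Γ.E} {b : Bool} (h : D.Γ.ends e b ≠ D.v) : c.c e b = 0 :=
  le_antisymm ((c.le_cut e b).trans (D.cut_eq_zero h).le) (c.nonneg e b)

def shrinkI (e : D.Γ.E) (t : unitInterval) : unitInterval :=
  ⟨c.c e false + (1 - c.c e false - c.c e true) * t, by
    have h0 := c.nonneg e false
    have h1 := c.nonneg e true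
    have h2 := c.sum_lt e
    have := t.2.1
    have := t.2.2
    constructor <;> nlinarith⟩

theorem fromEnd_shrinkI (e : D.Γ.E) (b : Bool) (t : unitInterval) :
    (fromEnd b (c.shrinkI e t) : ℝ) = c.c e b + (1 - c.c e false - c.c e true) * fromEnd b t := by
  cases b
  · rfl
  · change 1 - (c.c e false + (1 - c.c e false - c.c e true) * (t : ℝ)) =
      c.c e true + (1 - c.c e false - c.c e true) * (1 - t)
    ring

theorem shrinkI_injective (e : D.Γ.E) : Injective (c.shrinkI e) := by
  intro t t' h
  have h1 : c.c e false + (1 - c.c e false - c.c e true) * (t : ℝ) =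
    c.c e false + (1 - c.c e false - c.c e true) * (t' : ℝ) := congrArg Subtype.val h
  have h2 : 1 - c.c e false - c.c e true ≠ 0 := by linarith [c.sum_lt e]
  exact Subtype.ext (mul_left_cancel₀ h2 (by linarith))

theorem lt_fromEnd_shrinkI (e : D.Γ.E) (b : Bool) {t : unitInterval} (h0 : t ≠ 0) (h1 : t ≠ 1) :
    c.c e b < fromEnd b (c.shrinkI e t) := by
  rw [fromEnd_shrinkI]
  have h := (interior_iff.1 (fromEnd_interior (b := b) h0 h1)).1
  have := mul_pos (by linarith [c.sum_lt e] : 0 < 1 - c.c e false - c.c e true) h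
  linarith

theorem shrinkI_interior (e : D.Γ.E) (t : unitInterval) (h0 : t ≠ 0) (h1 : t ≠ 1) :
    c.shrinkI e t ≠ 0 ∧ c.shrinkI e t ≠ 1 := by
  have h2 := (c.nonneg e false).trans_lt (c.lt_fromEnd_shrinkI e false h0 h1)
  have h3 := (c.nonneg e true).trans_lt (c.lt_fromEnd_shrinkI e true h0 h1)
  change 0 < (c.shrinkI e t : ℝ) at h2
  change 0 < 1 - (c.shrinkI e t : ℝ) at h3
  exact interior_iff.2 ⟨h2, by linarith⟩

/-- The map that shrinks the edges. -/
def map : D.Γ.Space → D.Γ.Space := edgeFun c.shrinkI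

theorem map_pt (e : D.Γ.E) {t : unitInterval} (h0 : t ≠ 0) (h1 : t ≠ 1) :
    c.map (pt e t) = pt e (c.shrinkI e t) := edgeFun_pt _ e h0 h1

theorem map_injective : Injective c.map :=
  edgeFun_injective D c.shrinkI_injective c.shrinkI_interior

theorem map_ne {p : D.Γ.Space} (hp : p ≠ vert D.v) : c.map p ≠ vert D.v :=
  fun h => hp (c.map_injective h)

/-- The image avoids the points that are removed. -/
theorem map_ne_pt {p : D.Γ.Space} (hp : p ≠ vert D.v) {e : D.Γ.E} {b : Bool} (hb : (e, b) ∈ D.H)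
    {x : unitInterval} (hx : (x : ℝ) ≤ c.c e b) : c.map p ≠ pt e (fromEnd b x) := by
  intro h
  have hcut : (x : ℝ) ≤ 1 / 2 := hx.trans ((c.le_cut e b).trans (D.cut_le e b))
  rcases x.2.1.eq_or_lt with h0 | h0
  · have hx0 : x = 0 := Subtype.ext h0.symm
    refine c.map_ne hp (h.trans ?_)
    rw [hx0, ← D.incident _ hb]
    cases b
    · exact pt_zero e
    · refine Eq.trans ?_ (pt_one e)
      change pt e (unitInterval.symm 0) = _
      rw [unitInterval.symm_zero]
  · have hxi := interior_iff.2 ⟨h0, by linarith⟩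
    have hi := fromEnd_interior (b := b) hxi.1 hxi.2
    rcases D.exists_rep p with ⟨w, rfl⟩ | ⟨e', t, h0', h1', rfl⟩
    · exact D.pt_ne_vert e hi.1 hi.2 w h.symm
    · rw [c.map_pt e' h0' h1'] at h
      obtain ⟨rfl, h2⟩ := D.pt_inj hi.1 hi.2 h
      have h3 := c.lt_fromEnd_shrinkI e' b h0' h1'
      rw [h2, fromEnd_fromEnd] at h3
      linarith

theorem continuousOn_map {T : Type*} [TopologicalSpace T] (c : T → D.Cuts)
    (hc : ∀ e b, Continuous fun s => (c s).c e b) :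
    ContinuousOn (fun x : T × D.Γ.Space => (c x.1).map x.2) (Prod.snd ⁻¹' {p | p ≠ vert D.v}) := by
  refine continuousOn_edgeFun (fun s => (c s).shrinkI) (fun e => ?_) D.isOpen_punctured
    (fun e he s => ?_) (fun e he s => ?_)
  · have h1 := (hc e false).comp (continuous_fst (X := T) (Y := unitInterval))
    have h2 := (hc e true).comp (continuous_fst (X := T) (Y := unitInterval))
    exact Continuous.subtype_mk (h1.add (((continuous_const.sub h1).sub h2).mul
      (continuous_subtype_val.comp continuous_snd))) _
  · have h : (c s).c e false = 0 := (c s).eq_zero fun h => he (congrArg vert h)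
    refine Subtype.ext ?_
    change (c s).c e false + (1 - (c s).c e false - (c s).c e true) * 0 = 0
    rw [h]; ring
  · have h : (c s).c e true = 0 := (c s).eq_zero fun h => he (congrArg vert h)
    refine Subtype.ext ?_
    change (c s).c e false + (1 - (c s).c e false - (c s).c e true) * 1 = 1
    rw [h]; ring

variable (D)

/-- The full cuts. -/
def full : D.Cuts := ⟨D.cut, D.cut_nonneg, fun _ _ => le_rfl⟩

theorem full_map : (full D).map = D.shrinkFun := D.shrinkFun_eq.symm

def scale (s : unitInterval) : D.Cuts where
  c e b := s * D.cut e b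
  nonneg e b := mul_nonneg s.2.1 (D.cut_nonneg e b)
  le_cut e b := mul_le_of_le_one_left (D.cut_nonneg e b) s.2.2

theorem scale_one : (scale D 1).map = D.shrinkFun := by
  rw [← full_map]
  congr 1
  unfold scale full
  congr 1
  funext e b
  simp

theorem scale_zero (p : D.Γ.Space) : (scale D 0).map p = p := by
  rcases D.exists_rep p with ⟨w, rfl⟩ | ⟨e, t, h0, h1, rfl⟩
  · rfl
  · rw [map_pt _ e h0 h1]
    congr 1
    apply Subtype.ext
    change (0 : ℝ) * _ + (1 - 0 * _ - 0 * _) * t = t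
    ring

end Cuts

/-! ### Points on the half-edges -/

variable {D}

theorem hpt_zero {h : D.Γ.E × Bool} (hh : h ∈ D.H) {x : unitInterval} (hx : x = 0) :
    (pt h.1 (fromEnd h.2 x) : D.Γ.Space) = vert D.v := by
  subst hx
  obtain ⟨e, b⟩ := h
  rw [← D.incident _ hh]
  cases b
  · exact pt_zero e
  · refine Eq.trans ?_ (pt_one e)
    change pt e (unitInterval.symm 0) = _
    rw [unitInterval.symm_zero]

theorem hpt_far {h : D.Γ.E × Bool} {x : unitInterval} (hx : D.rad ≤ x)
    (hx1 : (x : ℝ) ≤ 1 / 2) : D.Far (pt h.1 (fromEnd h.2 x)) := by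
  have hx0 := interior_iff.2 ⟨D.rad_pos.trans_le hx, by linarith⟩
  have hi := fromEnd_interior (b := h.2) hx0.1 hx0.2
  refine Or.inr ⟨h.1, _, hi.1, hi.2, rfl, fun b _ => ?_⟩
  by_cases hb : b = h.2
  · rw [hb, fromEnd_fromEnd]
    exact hx
  · rw [Bool.eq_not.2 hb, coe_fromEnd_not, fromEnd_fromEnd]
    linarith [D.rad_le]

/-- The distance to `v` of a point on a half-edge. -/
theorem hpt_dist {h : D.Γ.E × Bool} (hh : h ∈ D.H) {x : unitInterval} (hx : (x : ℝ) ≤ D.rad) :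
    (D.dist (pt h.1 (fromEnd h.2 x)) : ℝ) = x / D.rad := by
  rcases x.2.1.eq_or_lt with h0 | h0
  · rw [hpt_zero hh (Subtype.ext h0.symm), dist_v, ← h0]
    simp
  rcases hx.eq_or_lt with h1 | h1
  · rw [(hpt_far h1.ge (by linarith [D.rad_le])).dist, h1, div_self D.rad_pos.ne']
    rfl
  · exact star_dist (D.incident _ hh) h0 h1

theorem hpt_sign_pos {h : D.Γ.E × Bool} (hh : h ∈ D.H) {x : unitInterval}
    (hx : (x : ℝ) ≤ 1 / 2) :
    0 < D.sign (pt h.1 (fromEnd h.2 x)) ↔ 0 < (x : ℝ) ∧ (x : ℝ) < D.rad := by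
  constructor
  · intro hs
    constructor
    · by_contra h0
      rw [hpt_zero hh (Subtype.ext (le_antisymm (not_lt.1 h0) x.2.1)), sign_v] at hs
      exact lt_irrefl _ hs
    · by_contra h1
      rw [(hpt_far (not_lt.1 h1) hx).sign] at hs
      exact lt_irrefl _ hs
  · rintro ⟨h0, h1⟩
    exact (star_sign_pos h0 h1).2 hh

/-- Points within 1/4 of the two opposite ends of an edge are different, so the half-edge is
determined by the point. -/
theorem hpt_inj {h h' : D.Γ.E × Bool} {x x' : unitInterval} (h0 : 0 < (x : ℝ))
    (h1 : (x : ℝ) < D.rad) (h1' : (x' : ℝ) < D.rad)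
    (he : (pt h.1 (fromEnd h.2 x) : D.Γ.Space) = pt h'.1 (fromEnd h'.2 x')) : h = h' ∧ x = x' := by
  have hi := star_interior (b := h.2) h0 h1
  obtain ⟨e1, e2⟩ := D.pt_inj hi.1 hi.2 he.symm
  have hb : h'.2 = h.2 := by
    by_contra hb
    have e3 : (fromEnd h'.2 (fromEnd h'.2 x') : ℝ) = fromEnd h'.2 (fromEnd h.2 x) := by rw [e2]
    rw [fromEnd_fromEnd, Bool.eq_not.2 hb, coe_fromEnd_not, fromEnd_fromEnd] at e3
    linarith [D.rad_le]
  refine ⟨Prod.ext e1.symm hb.symm, ?_⟩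
  rw [hb] at e2
  exact (GraphEmbedding.fromEnd_injective _ e2).symm

theorem isOpen_star (h : D.Γ.E × Bool) : IsOpen {p : D.Γ.Space | ∃ x : unitInterval,
    0 < (x : ℝ) ∧ (x : ℝ) < D.rad ∧ p = pt h.1 (fromEnd h.2 x)} := by
  rw [← isQuotientMap_proj.isOpen_preimage]
  have : (proj ⁻¹' {p : D.Γ.Space | ∃ x : unitInterval,
      0 < (x : ℝ) ∧ (x : ℝ) < D.rad ∧ p = pt h.1 (fromEnd h.2 x)}) =
      Sum.inr '' {y : D.Γ.E × unitInterval | y.1 = h.1 ∧ 0 < (fromEnd h.2 y.2 : ℝ) ∧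
        (fromEnd h.2 y.2 : ℝ) < D.rad} := by
    ext y
    constructor
    · rintro ⟨x, h0, h1, hx⟩
      have hi := star_interior (b := h.2) h0 h1
      rcases y with w | ⟨e, t⟩
      · exact absurd hx.symm (D.pt_ne_vert h.1 hi.1 hi.2 w)
      · obtain ⟨e1, e2⟩ := D.pt_inj hi.1 hi.2 hx
        have e3 : fromEnd h.2 t = x := by rw [e2, fromEnd_fromEnd]
        exact ⟨(e, t), ⟨e1, by rwa [e3], by rwa [e3]⟩, rfl⟩
    · rintro ⟨⟨e, t⟩, ⟨rfl, h0, h1⟩, rfl⟩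
      exact ⟨fromEnd h.2 t, h0, h1, by rw [fromEnd_fromEnd]; rfl⟩
  rw [this]
  refine isOpenMap_inr _ ?_
  have hc := (continuous_fromEnd h.2).comp (continuous_snd (X := D.Γ.E))
  have hc' : Continuous fun y : D.Γ.E × unitInterval => (fromEnd h.2 y.2 : ℝ) :=
    continuous_subtype_val.comp hc
  exact ((isOpen_discrete {h.1}).preimage continuous_fst).inter
    ((isOpen_lt continuous_const hc').inter (isOpen_lt hc' continuous_const))

theorem eq_v_or_dist_of_sign_eq_zero {p : D.Γ.Space} (h : D.sign p = 0) :
    p = vert D.v ∨ D.dist p = 1 := by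
  rcases D.trichotomy p with hp | ⟨e, b, x, hb, h0, h1, rfl⟩ | hf
  · exact Or.inl hp
  · rw [star_sign h0 h1] at h
    rcases mul_eq_zero.1 h with h | h
    · unfold endSign at h
      split_ifs at h <;> norm_num at h
    · exact absurd h (star_bump_pos h0 h1).ne'
  · exact Or.inr hf.dist

end HalfEdgeData

theorem Conf.continuous_eval {ι X : Type*} [TopologicalSpace X] (k : ι) :
    Continuous fun x : Conf ι X => x.1 k :=
  (continuous_apply k).comp continuous_subtype_val

namespace HalfEdgeData

variable {D : HalfEdgeData.{u}} {ι : Type*} [Fintype ι]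

/-! ### Configurations with a point close to the vertex -/

open Classical in
/-- The least distance to `v` of the points with labels different from `k`. -/
def minDist (x : Conf ι D.Γ.Space) (k : ι) : unitInterval :=
  -- The infimum over the empty set is ⊤ = 1, so a single point is compared with the radius of the
  -- star.
  (Finset.univ.filter (· ≠ k)).inf fun i => D.dist (x.1 i)

theorem le_minDist {x : Conf ι D.Γ.Space} {k : ι} {c : unitInterval} :
    c ≤ minDist x k ↔ ∀ i, i ≠ k → c ≤ D.dist (x.1 i) := by
  simp [minDist, Finset.le_inf_iff]

theorem minDist_le (x : Conf ι D.Γ.Space) {i k : ι} (h : i ≠ k) : minDist x k ≤ D.dist (x.1 i) :=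
  le_minDist.1 le_rfl i h

theorem continuous_minDist (k : ι) : Continuous fun x : Conf ι D.Γ.Space => minDist x k := by
  unfold minDist
  exact Continuous.finset_inf_apply fun i _ => D.continuous_dist.comp (Conf.continuous_eval i)

theorem minDist_pos {x : Conf ι D.Γ.Space} {k : ι} (h : ∀ i, i ≠ k → x.1 i ≠ vert D.v) :
    0 < minDist x k := by
  unfold minDist
  rw [Finset.lt_inf_iff (show (0 : unitInterval) < ⊤ from zero_lt_one)]
  intro i hi
  exact dist_pos (h i (by simpa using hi))

theorem minDist_pos_of_eq {x : Conf ι D.Γ.Space} {k : ι} (h : x.1 k = vert D.v) :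
    0 < minDist x k :=
  minDist_pos fun _ hi hv => hi (x.2 (hv.trans h.symm))

theorem minDist_smul (σ : Equiv.Perm ι) (x : Conf ι D.Γ.Space) (k : ι) :
    minDist (σ • x) k = minDist x (σ⁻¹ k) := by
  refine eq_of_forall_le_iff fun c => ?_
  rw [le_minDist, le_minDist]
  constructor
  · intro h i hi
    have := h (σ i) fun hs => hi (by rw [← hs]; exact (σ.symm_apply_apply i).symm)
    change c ≤ D.dist (x.1 (σ.symm (σ i))) at this
    rwa [Equiv.symm_apply_apply] at this
  · intro h i hi
    exact h (σ⁻¹ i) fun hs => hi (σ⁻¹.injective hs)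

/-- A point on one of the half-edges in `H` is closer to `v` than the other points, with ratio of
the distances in the closed interval `[1/3, 2/3]`. -/
def Intermediate (x : Conf ι D.Γ.Space) : Prop :=
  ∃ k, 0 < D.sign (x.1 k) ∧ (minDist x k : ℝ) ≤ 3 * D.dist (x.1 k) ∧
    3 * (D.dist (x.1 k) : ℝ) ≤ 2 * minDist x k

theorem Intermediate.smul {x : Conf ι D.Γ.Space} (h : Intermediate x) (σ : Equiv.Perm ι) :
    Intermediate (σ • x) := by
  obtain ⟨k, hk⟩ := h
  refine ⟨σ k, ?_⟩
  rw [minDist_smul]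
  change 0 < D.sign (x.1 (σ.symm (σ k))) ∧
    (minDist x (σ.symm (σ k)) : ℝ) ≤ 3 * (D.dist (x.1 (σ.symm (σ k))) : ℝ) ∧
    3 * (D.dist (x.1 (σ.symm (σ k))) : ℝ) ≤ 2 * minDist x (σ.symm (σ k))
  rwa [Equiv.symm_apply_apply]

/-- The strict inequality for the sign can be weakened. If the sign is zero, the point is `v`, whose
ratio is 0 because the others have positive distance, or it has distance 1 and its ratio is at least
1; neither lies in [1/3, 2/3]. -/
theorem isClosed_intermediate : IsClosed {x : Conf ι D.Γ.Space | Intermediate x} := by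
  have : {x : Conf ι D.Γ.Space | Intermediate x} = ⋃ k, {x | 0 ≤ D.sign (x.1 k) ∧
      (minDist x k : ℝ) ≤ 3 * D.dist (x.1 k) ∧ 3 * (D.dist (x.1 k) : ℝ) ≤ 2 * minDist x k} := by
    ext x
    rw [mem_iUnion]
    constructor
    · rintro ⟨k, hk⟩
      exact ⟨k, hk.1.le, hk.2⟩
    · rintro ⟨k, h1, h2, h3⟩
      refine ⟨k, h1.lt_of_ne fun h0 => ?_, h2, h3⟩
      rcases eq_v_or_dist_of_sign_eq_zero h0.symm with h | h
      · have h4 : 0 < (minDist x k : ℝ) := minDist_pos_of_eq h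
        rw [h, dist_v] at h2
        norm_num at h2
        exact absurd h2 (not_le.2 (minDist_pos_of_eq h))
      · rw [h] at h3
        have := (minDist x k).2.2
        norm_num at h3
        linarith
  rw [this]
  refine isClosed_iUnion_of_finite fun k => ?_
  have h1 := D.continuous_sign.comp (Conf.continuous_eval (ι := ι) k)
  have h2 : Continuous fun x : Conf ι D.Γ.Space => (D.dist (x.1 k) : ℝ) :=
    continuous_subtype_val.comp (D.continuous_dist.comp (Conf.continuous_eval k))
  have h3 : Continuous fun x : Conf ι D.Γ.Space => (minDist x k : ℝ) :=
    continuous_subtype_val.comp (continuous_minDist k)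
  exact (isClosed_le continuous_const h1).inter ((isClosed_le h3 (continuous_const.mul h2)).inter
    (isClosed_le (continuous_const.mul h2) (continuous_const.mul h3)))

theorem not_intermediate_of_notMem {x : Conf ι D.Γ.Space}
    (hx : ∀ k, ∀ h ∈ D.H, x.1 k ∉ halfEdge D.ρ h) : ¬ Intermediate x := by
  rintro ⟨k, hk, -⟩
  exact absurd hk (not_lt.2 (sign_nonpos_of_notMem (hx k)))

/-! ### The deformation -/

/-- The point with label `k` is at most half as far from `v` as all others. -/
def Close (x : Conf ι D.Γ.Space) (k : ι) : Prop := 2 * (D.dist (x.1 k) : ℝ) ≤ minDist x k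

/-- Two close points would each have at most half the distance of the other, so both would be `v`.
-/
theorem Close.eq {x : Conf ι D.Γ.Space} {i j : ι} (hi : Close x i) (hj : Close x j) : i = j := by
  by_contra h
  have h1 : (minDist x j : ℝ) ≤ D.dist (x.1 i) := minDist_le x h
  have h2 : (minDist x i : ℝ) ≤ D.dist (x.1 j) := minDist_le x (Ne.symm h)
  have h3 := (D.dist (x.1 i)).2.1
  have h4 := (D.dist (x.1 j)).2.1
  unfold Close at hi hj
  have hv : ∀ k, (D.dist (x.1 k) : ℝ) ≤ 0 → x.1 k = vert D.v := fun k hk => by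
    by_contra hne
    exact absurd hk (not_le.2 (dist_pos hne))
  exact h (x.2 ((hv i (by linarith)).trans (hv j (by linarith)).symm))

open Classical in
/-- Contracts the half-edge of a close point and moves the other points away from `v`. -/
def deformFun (s : unitInterval) (x : Conf ι D.Γ.Space) (k : ι) : D.Γ.Space :=
  if 2 * (D.dist (x.1 k) : ℝ) ≤ minDist x k then D.contract s (x.1 k) else D.flow s (x.1 k)

variable {s : unitInterval} {x : Conf ι D.Γ.Space} {i k : ι}

theorem Close.deformFun_eq (h : Close x k) : deformFun s x k = D.contract s (x.1 k) := if_pos h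

theorem deformFun_of_not_close (h : ¬ Close x k) : deformFun s x k = D.flow s (x.1 k) := if_neg h

theorem Close.dist_le (h : Close x k) : (D.dist (x.1 k) : ℝ) ≤ 1 / 2 := by
  unfold Close at h
  linarith [(minDist x k).2.2]

/-- Contraction does not increase the distance to `v` and the flow does not decrease it. A collision
would force the point that is not close to have had distance at most that of the close one, hence
both distance 0, which makes it close. -/
theorem deformFun_ne (hi : Close x i) (hk : ¬ Close x k) : deformFun s x i ≠ deformFun s x k := by
  have hik : k ≠ i := fun h => hk (h ▸ hi)
  rw [hi.deformFun_eq, deformFun_of_not_close hk]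
  intro h
  have h1 : (D.dist (D.contract s (x.1 i)) : ℝ) ≤ D.dist (x.1 i) := (contract_spec s hi.dist_le).2.1
  have h2 : (D.dist (x.1 k) : ℝ) ≤ D.dist (D.flow s (x.1 k)) := (flow_spec s (x.1 k)).1
  have h3 : (minDist x i : ℝ) ≤ D.dist (x.1 k) := minDist_le x hik
  have h4 : 2 * (D.dist (x.1 i) : ℝ) ≤ minDist x i := hi
  have h5 : (minDist x k : ℝ) < 2 * D.dist (x.1 k) := not_le.1 hk
  rw [h] at h1
  linarith [(minDist x k).2.1]

theorem deformFun_injective (s : unitInterval) (x : Conf ι D.Γ.Space) :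
    Injective (deformFun s x) := by
  intro i j h
  by_cases hi : Close x i <;> by_cases hj : Close x j
  · exact hi.eq hj
  · exact absurd h (deformFun_ne hi hj)
  · exact absurd h.symm (deformFun_ne hj hi)
  · rw [deformFun_of_not_close hi, deformFun_of_not_close hj] at h
    exact x.2 (D.flow_injective s h)

def deform (s : unitInterval) (x : Conf ι D.Γ.Space) : Conf ι D.Γ.Space :=
  ⟨deformFun s x, deformFun_injective s x⟩

theorem deform_smul (σ : Equiv.Perm ι) (s : unitInterval) (x : Conf ι D.Γ.Space) :
    deform s (σ • x) = σ • deform s x := by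
  refine Subtype.ext (funext fun k => ?_)
  change deformFun s (σ • x) k = deformFun s x (σ⁻¹ k)
  unfold deformFun
  rw [minDist_smul]
  rfl

theorem deform_zero (x : Conf ι D.Γ.Space) : deform 0 x = x := by
  refine Subtype.ext (funext fun k => ?_)
  change deformFun 0 x k = x.1 k
  by_cases hk : Close x k
  · rw [hk.deformFun_eq]
    exact (contract_spec 0 hk.dist_le).2.2.2.1 rfl
  · rw [deformFun_of_not_close hk, flow_zero]

theorem deform_one (x : Conf ι D.Γ.Space) (k : ι) :
    ∀ h ∈ D.H, (deform 1 x).1 k ∉ halfEdge D.ρ h := by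
  change ∀ h ∈ D.H, deformFun 1 x k ∉ halfEdge D.ρ h
  by_cases hk : Close x k
  · rw [hk.deformFun_eq]
    exact (contract_spec 1 hk.dist_le).2.2.2.2 rfl
  · rw [deformFun_of_not_close hk]
    exact flow_one_notMem _

theorem deform_notMem (s : unitInterval) (hx : ∀ h ∈ D.H, x.1 k ∉ halfEdge D.ρ h) :
    ∀ h ∈ D.H, (deform s x).1 k ∉ halfEdge D.ρ h := by
  change ∀ h ∈ D.H, deformFun s x k ∉ halfEdge D.ρ h
  by_cases hk : Close x k
  · rw [hk.deformFun_eq, (contract_spec s hk.dist_le).1 (sign_nonpos_of_notMem hx)]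
    exact hx
  · rw [deformFun_of_not_close hk]
    exact flow_notMem s hx

/-- If the ratio of a point of `H` is in [1/3, 2/3] after the deformation, it was so before. For a
close point, its own distance does not grow and the others do not approach, so the old ratio is at
least the new one, and at most 1/2. Any other point had ratio above 1/2; still in the star, it has
gained exactly `s / rad`, while the least distance of the others has gained at most that, so the old
ratio was at most 2/3. -/
theorem deform_not_intermediate (s : unitInterval) (hx : ¬ Intermediate x) :
    ¬ Intermediate (deform s x) := by
  rintro ⟨k, h0, h1, h2⟩
  apply hx
  change 0 < D.sign (deformFun s x k) at h0
  change (minDist (deform s x) k : ℝ) ≤ 3 * D.dist (deformFun s x k) at h1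
  change 3 * (D.dist (deformFun s x k) : ℝ) ≤ _ at h2
  have hd := (D.dist (x.1 k)).2.1
  by_cases hk : Close x k
  · have hspec := contract_spec s hk.dist_le
    rw [hk.deformFun_eq] at h0 h1
    obtain ⟨h3, -⟩ := hspec.2.2.1 h0
    have h4 : (D.dist (D.contract s (x.1 k)) : ℝ) ≤ D.dist (x.1 k) := hspec.2.1
    have h5 : (minDist x k : ℝ) ≤ minDist (deform s x) k := le_minDist.2 fun i hi => by
      change _ ≤ D.dist (deformFun s x i)
      rw [deformFun_of_not_close fun h => hi (h.eq hk)]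
      exact (minDist_le x hi).trans (flow_spec s _).1
    have h6 : 2 * (D.dist (x.1 k) : ℝ) ≤ minDist x k := hk
    exact ⟨k, h3, by linarith, by linarith⟩
  · have hspec := flow_spec s (x.1 k)
    rw [deformFun_of_not_close hk] at h0 h1 h2
    obtain ⟨h3, h4⟩ := hspec.2.2.1 h0
    have h5 : (minDist x k : ℝ) < 2 * D.dist (x.1 k) := not_le.1 hk
    have hs : 0 ≤ (s : ℝ) / D.rad := div_nonneg s.2.1 D.rad_pos.le
    have h6 : (minDist (deform s x) k : ℝ) ≤ minDist x k + s / D.rad := by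
      by_contra hlt
      push Not at hlt
      have hm0 := (minDist x k).2.1
      have hm1 := (minDist (deform s x) k).2.2
      -- The least distance is characterized by its lower bounds in the unit interval; the
      -- assumption to be refuted ensures that this candidate is not negative.
      let c : unitInterval := ⟨minDist (deform s x) k - s / D.rad, by linarith, by linarith⟩
      have hc : c ≤ minDist x k := le_minDist.2 fun i hi => by
        change (minDist (deform s x) k : ℝ) - s / D.rad ≤ D.dist (x.1 i)
        have h7 : (minDist (deform s x) k : ℝ) ≤ D.dist (deformFun s x i) := minDist_le _ hi
        by_cases hi : Close x i
        · have h8 : (D.dist (D.contract s (x.1 i)) : ℝ) ≤ D.dist (x.1 i) :=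
            (contract_spec s hi.dist_le).2.1
          rw [hi.deformFun_eq] at h7
          linarith
        · rw [deformFun_of_not_close hi] at h7
          linarith [(flow_spec s (x.1 i)).2.1]
      change (minDist (deform s x) k : ℝ) - s / D.rad ≤ minDist x k at hc
      linarith
    exact ⟨k, h3, by linarith, by linarith⟩

/-- The two rules are glued where the ratio is 1/2. On a good configuration such a point has sign at
most 0 and distance below 1, so both rules fix it. The flow is used only for points away from `v`,
since `v` itself is strictly close. -/
theorem continuous_deform : Continuous
    fun x : unitInterval × {x : Conf ι D.Γ.Space // ¬ Intermediate x} => deform x.1 x.2.1 := by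
  refine Continuous.subtype_mk (continuous_pi fun k => ?_) _
  have he : Continuous fun x : unitInterval × {x : Conf ι D.Γ.Space // ¬ Intermediate x} =>
      (x.1, x.2.1.1 k) := continuous_fst.prodMk
    ((Conf.continuous_eval k).comp (continuous_subtype_val.comp continuous_snd))
  refine continuous_if_le (continuous_const.mul
    (continuous_subtype_val.comp (D.continuous_dist.comp (continuous_snd.comp he))))
    (continuous_subtype_val.comp ((continuous_minDist k).comp
      (continuous_subtype_val.comp continuous_snd)))
    (D.continuous_contract.comp he).continuousOn
    (D.continuousOn_flow.comp he.continuousOn fun x hx => ?_) fun x hx => ?_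
  · intro hv
    change x.2.1.1 k = vert D.v at hv
    have h1 : (minDist x.2.1 k : ℝ) ≤ 2 * D.dist (x.2.1.1 k) := hx
    rw [hv, dist_v] at h1
    norm_num at h1
    exact absurd h1 (not_le.2 (minDist_pos_of_eq hv))
  · have hd := (D.dist (x.2.1.1 k)).2.1
    have hd1 := (minDist x.2.1 k).2.2
    have hs : D.sign (x.2.1.1 k) ≤ 0 := by
      by_contra hs
      exact x.2.2 ⟨k, not_le.1 hs, by linarith, by linarith⟩
    rw [(contract_spec x.1 (by linarith : (D.dist (x.2.1.1 k) : ℝ) ≤ 1 / 2)).1 hs,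
      (flow_spec x.1 (x.2.1.1 k)).2.2.2 hs (by linarith)]

end HalfEdgeData

namespace HalfEdgeData

/-! ### Insertion of a point on a half-edge -/

/-- A family of maps that shrink the edges and add a point of the half-edge `h`. The position of
the new point may depend on the least distance to `v` of the others. -/
structure Insertion (D : HalfEdgeData.{u}) (T : Type*) [TopologicalSpace T]
    (h : D.Γ.E × Bool) where
  cuts : T → D.Cuts
  continuous_cuts : ∀ e b, Continuous fun s => (cuts s).c e b
  pos : C(T × unitInterval, unitInterval)
  avoid : ∀ s m p, p ≠ vert D.v → 0 < m → m ≤ D.dist ((cuts s).map p) →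
    (cuts s).map p ≠ pt h.1 (fromEnd h.2 (pos (s, m)))

/-- One of two ways to keep the new point apart from the old ones: it lies in the part of the
half-edge that the cut has vacated. -/
theorem avoid_of_pos_le_cut {D : HalfEdgeData.{u}} {c : D.Cuts} {h : D.Γ.E × Bool} (hh : h ∈ D.H)
    {x : unitInterval} (hx : (x : ℝ) ≤ c.c h.1 h.2) {p : D.Γ.Space} (hp : p ≠ vert D.v) :
    c.map p ≠ pt h.1 (fromEnd h.2 x) := c.map_ne_pt hp hh hx

/-- The other way: the new point is nearer to `v` than all old points. -/
theorem avoid_of_dist_lt {D : HalfEdgeData.{u}} {h : D.Γ.E × Bool} (hh : h ∈ D.H)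
    {x m : unitInterval} (hx : (x : ℝ) < D.rad * m) {p : D.Γ.Space} (hp : m ≤ D.dist p) :
    p ≠ pt h.1 (fromEnd h.2 x) := by
  rintro rfl
  have h1 : (m : ℝ) ≤ D.dist (pt h.1 (fromEnd h.2 x)) := hp
  have hr := D.rad_pos
  rw [hpt_dist hh (by nlinarith [m.2.2]), le_div_iff₀ hr] at h1
  linarith

namespace Insertion

variable {D : HalfEdgeData.{u}} {T : Type*} [TopologicalSpace T] {h : D.Γ.E × Bool}
  (I : Insertion D T h) {ι : Type*} {k : ι}

theorem continuous_old (i : {i : ι // i ≠ k}) :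
    Continuous fun x : Conf {i : ι // i ≠ k} D.Punctured × T => (I.cuts x.2).map (x.1.1 i).1 := by
  have := (Cuts.continuousOn_map I.cuts I.continuous_cuts).comp_continuous
    (f := fun x : Conf {i : ι // i ≠ k} D.Punctured × T => (x.2, (x.1.1 i).1))
    (continuous_snd.prodMk (continuous_subtype_val.comp
      ((Conf.continuous_eval i).comp continuous_fst))) fun x => (x.1.1 i).2
  exact this

variable [Fintype ι]

open Classical in
/-- The least distance to `v` of the old points. -/
def gap (y : Conf {i : ι // i ≠ k} D.Punctured) (s : T) : unitInterval :=
  Finset.univ.inf fun i => D.dist ((I.cuts s).map (y.1 i).1)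

theorem le_gap {y : Conf {i : ι // i ≠ k} D.Punctured} {s : T} {c : unitInterval} :
    c ≤ I.gap y s ↔ ∀ i, c ≤ D.dist ((I.cuts s).map (y.1 i).1) := by
  simp [gap, Finset.le_inf_iff]

theorem gap_pos (y : Conf {i : ι // i ≠ k} D.Punctured) (s : T) : 0 < I.gap y s := by
  unfold gap
  rw [Finset.lt_inf_iff (show (0 : unitInterval) < ⊤ from zero_lt_one)]
  exact fun i _ => dist_pos ((I.cuts s).map_ne (y.1 i).2)

theorem continuous_gap :
    Continuous fun x : Conf {i : ι // i ≠ k} D.Punctured × T => I.gap x.1 x.2 := by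
  unfold gap
  exact Continuous.finset_inf_apply fun i _ => D.continuous_dist.comp (I.continuous_old i)

/-- The new point. -/
def newPt (y : Conf {i : ι // i ≠ k} D.Punctured) (s : T) : D.Γ.Space :=
  pt h.1 (fromEnd h.2 (I.pos (s, I.gap y s)))

theorem newPt_ne (y : Conf {i : ι // i ≠ k} D.Punctured) (s : T) (i : {i : ι // i ≠ k}) :
    (I.cuts s).map (y.1 i).1 ≠ I.newPt y s :=
  I.avoid s _ _ (y.1 i).2 (I.gap_pos y s) (I.le_gap.1 le_rfl i)

open Classical in
def insFun (y : Conf {i : ι // i ≠ k} D.Punctured) (s : T) (j : ι) : D.Γ.Space :=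
  if hj : j = k then I.newPt y s else (I.cuts s).map (y.1 ⟨j, hj⟩).1

theorem insFun_self (y : Conf {i : ι // i ≠ k} D.Punctured) (s : T) :
    I.insFun y s k = I.newPt y s := dif_pos rfl

theorem insFun_old (y : Conf {i : ι // i ≠ k} D.Punctured) (s : T) (i : {i : ι // i ≠ k}) :
    I.insFun y s i = (I.cuts s).map (y.1 i).1 := dif_neg i.2

theorem insFun_injective (y : Conf {i : ι // i ≠ k} D.Punctured) (s : T) :
    Injective (I.insFun y s) := by
  intro i j hij
  by_cases hi : i = k <;> by_cases hj : j = k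
  · rw [hi, hj]
  · rw [hi, insFun_self, I.insFun_old y s ⟨j, hj⟩] at hij
    exact absurd hij.symm (I.newPt_ne y s _)
  · rw [hj, insFun_self, I.insFun_old y s ⟨i, hi⟩] at hij
    exact absurd hij (I.newPt_ne y s _)
  · rw [I.insFun_old y s ⟨j, hj⟩, I.insFun_old y s ⟨i, hi⟩] at hij
    exact congrArg Subtype.val (y.2 (Subtype.ext ((I.cuts s).map_injective hij)))

/-- The map that adds a point with label `k`. -/
def ins : C(Conf {i : ι // i ≠ k} D.Punctured × T, Conf ι D.Γ.Space) where
  toFun x := ⟨I.insFun x.1 x.2, I.insFun_injective x.1 x.2⟩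
  continuous_toFun := by
    refine Continuous.subtype_mk (continuous_pi fun j => ?_) _
    by_cases hj : j = k
    · subst hj
      simp only [insFun_self]
      exact (continuous_pt h.1).comp ((continuous_fromEnd h.2).comp
        (I.pos.continuous.comp (continuous_snd.prodMk I.continuous_gap)))
    · simp only [I.insFun_old _ _ ⟨j, hj⟩]
      exact I.continuous_old _

theorem ins_self (y : Conf {i : ι // i ≠ k} D.Punctured) (s : T) :
    (I.ins (y, s)).1 k = I.newPt y s := I.insFun_self y s

theorem ins_old (y : Conf {i : ι // i ≠ k} D.Punctured) (s : T) {i : ι} (hi : i ≠ k) :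
    (I.ins (y, s)).1 i = (I.cuts s).map (y.1 ⟨i, hi⟩).1 := I.insFun_old y s ⟨i, hi⟩

theorem minDist_ins (y : Conf {i : ι // i ≠ k} D.Punctured) (s : T) :
    minDist (I.ins (y, s)) k = I.gap y s := by
  refine eq_of_forall_le_iff fun c => ?_
  rw [le_minDist, le_gap]
  constructor
  · intro hc i
    rw [← I.ins_old y s i.2]
    exact hc i i.2
  · intro hc i hi
    rw [I.ins_old y s hi]
    exact hc _

theorem gap_le (y : Conf {i : ι // i ≠ k} D.Punctured) (s : T) {i : ι} (hi : i ≠ k) :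
    I.gap y s ≤ D.dist ((I.ins (y, s)).1 i) := by
  rw [← minDist_ins]
  exact minDist_le _ hi

/-- Insertion and relabelling. -/
theorem ins_relabel {k' : ι} {σ : Equiv.Perm ι} (hσ : σ k = k')
    {y : Conf {i : ι // i ≠ k} D.Punctured} {y' : Conf {i : ι // i ≠ k'} D.Punctured}
    (hy : ∀ (i : {i : ι // i ≠ k}) (i' : {i : ι // i ≠ k'}), σ i = i' → y'.1 i' = y.1 i) (s : T) :
    σ • I.ins (y, s) = I.ins (y', s) := by
  have hgap : I.gap y s = I.gap y' s := by
    refine eq_of_forall_le_iff fun c => ?_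
    rw [le_gap, le_gap]
    constructor
    · intro hc i'
      have hi : σ.symm i'.1 ≠ k := fun hi => i'.2 (((σ.symm_apply_eq).1 hi).trans hσ)
      rw [hy ⟨_, hi⟩ i' (Equiv.apply_symm_apply _ _)]
      exact hc _
    · intro hc i
      have hi : σ i.1 ≠ k' := fun hi => i.2 (σ.injective (hi.trans hσ.symm))
      rw [← hy i ⟨_, hi⟩ rfl]
      exact hc _
  refine Subtype.ext (funext fun j => ?_)
  change (I.ins (y, s)).1 (σ.symm j) = _
  by_cases hj : j = k'
  · subst hj
    have : σ.symm j = k := by rw [← hσ, Equiv.symm_apply_apply]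
    rw [this, ins_self, ins_self, newPt, newPt, hgap]
  · have hi : σ.symm j ≠ k := fun hi => hj (by rw [← hσ, ← hi, Equiv.apply_symm_apply])
    rw [I.ins_old _ _ hi, I.ins_old _ _ hj, hy ⟨_, hi⟩ ⟨j, hj⟩ (Equiv.apply_symm_apply _ _)]

/-- When the old points lie outside the half-edges in `H`, only the new point matters. -/
theorem not_intermediate_of_old (y : Conf {i : ι // i ≠ k} D.Punctured) (s : T)
    (hold : ∀ p, D.sign ((I.cuts s).map p) ≤ 0)
    (hnew : 0 < D.sign (I.newPt y s) → (2 * I.gap y s : ℝ) < 3 * D.dist (I.newPt y s)) :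
    ¬ Intermediate (I.ins (y, s)) := by
  rintro ⟨i, h1, h2, h3⟩
  by_cases hi : i = k
  · subst hi
    rw [ins_self] at h1 h3
    rw [minDist_ins] at h3
    linarith [hnew h1]
  · rw [I.ins_old _ _ hi] at h1
    exact absurd h1 (not_lt.2 (hold _))

/-- The case of a new point at a fixed ratio of the least distance of the others. -/
theorem intermediate_iff (hh : h ∈ D.H) (y : Conf {i : ι // i ≠ k} D.Punctured) (s : T)
    {c : unitInterval} (hc : (I.pos (s, I.gap y s) : ℝ) = D.rad * c * I.gap y s) :
    Intermediate (I.ins (y, s)) ↔ 1 / 3 ≤ (c : ℝ) ∧ (c : ℝ) ≤ 2 / 3 := by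
  have hr := D.rad_pos
  have hr4 := D.rad_le
  have hg : 0 < (I.gap y s : ℝ) := I.gap_pos y s
  have hg1 := (I.gap y s).2.2
  have hcg : (c : ℝ) * I.gap y s ≤ 1 := mul_le_one₀ c.2.2 hg.le hg1
  have hle : (I.pos (s, I.gap y s) : ℝ) ≤ D.rad := by
    rw [hc, mul_assoc]
    exact mul_le_of_le_one_right hr.le hcg
  have hd : (D.dist (I.newPt y s) : ℝ) = c * I.gap y s := by
    rw [newPt, hpt_dist hh hle, hc, mul_assoc, mul_div_cancel_left₀ _ hr.ne']
  constructor
  · rintro ⟨i, h1, h2, h3⟩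
    by_cases hi : i = k
    · subst hi
      rw [ins_self, minDist_ins, hd] at h2 h3
      constructor <;> nlinarith
    -- An old point cannot be the intermediate one, since the new point is no farther from `v` than
    -- any old point.
    · have h4 : (minDist (I.ins (y, s)) i : ℝ) ≤ D.dist ((I.ins (y, s)).1 k) :=
        minDist_le _ (Ne.symm hi)
      have h5 : (I.gap y s : ℝ) ≤ D.dist ((I.ins (y, s)).1 i) := I.gap_le y s hi
      rw [ins_self, hd] at h4
      have h6 : (c : ℝ) * I.gap y s ≤ I.gap y s := mul_le_of_le_one_left hg.le c.2.2
      linarith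
  · rintro ⟨h1, h2⟩
    refine ⟨k, ?_, ?_, ?_⟩
    · rw [ins_self, newPt, hpt_sign_pos hh (by linarith), hc]
      have : 0 < (c : ℝ) := by linarith
      refine ⟨by positivity, ?_⟩
      have : (c : ℝ) * I.gap y s < 1 := by nlinarith
      rw [mul_assoc]
      nlinarith
    · rw [ins_self, minDist_ins, hd]
      nlinarith
    · rw [ins_self, minDist_ins, hd]
      nlinarith

end Insertion

end HalfEdgeData

/-! ### The tracks, the radial cylinders, and the homotopy between them. -/

namespace HalfEdgeData

variable {D : HalfEdgeData.{u}} {h : D.Γ.E × Bool}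

theorem cut_of_mem (hh : h ∈ D.H) : D.cut h.1 h.2 = D.ρ := if_pos hh

variable (D) in
/-- The number `ρ / 2`, as an element of `[0, 1]`. -/
def radI : unitInterval := ⟨D.rad, D.rad_pos.le, by linarith [D.rad_le]⟩

theorem sign_full_nonpos (p : D.Γ.Space) : D.sign ((Cuts.full D).map p) ≤ 0 := by
  rw [Cuts.full_map]
  exact sign_nonpos_of_notMem (D.shrinkFun_notMem p)

namespace Insertion

/-- The new point moves from `v` to the other end of the half-edge. -/
def track (hh : h ∈ D.H) : Insertion D unitInterval h where
  cuts _ := Cuts.full D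
  continuous_cuts _ _ := continuous_const
  pos := ⟨fun x => x.1 * D.ρI, by fun_prop⟩
  avoid s m p hp _ _ := by
    refine avoid_of_pos_le_cut hh ?_ hp
    change (s : ℝ) * D.ρ ≤ D.cut h.1 h.2
    rw [cut_of_mem hh]
    exact mul_le_of_le_one_left D.ρ_pos.le s.2.2

/-- The new point is closer to `v` than the others, at a given ratio. -/
def radial (hh : h ∈ D.H) : Insertion D OpenInterval h where
  cuts _ := Cuts.scale D 0
  continuous_cuts _ _ := continuous_const
  pos := ⟨fun x => D.radI * x.1.1 * x.2, by fun_prop⟩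
  avoid q m p hp hm hd := by
    refine avoid_of_dist_lt hh ?_ hd
    change D.rad * q.1 * m < D.rad * m
    have : 0 < D.rad * (m : ℝ) := mul_pos D.rad_pos hm
    nlinarith [q.2.2]

/-- The first stage of the homotopy between `radial` and `track`. -/
def stageOne (hh : h ∈ D.H) : Insertion D (unitInterval × unitInterval) h where
  cuts s := Cuts.scale D s.1
  continuous_cuts e b := (continuous_subtype_val.comp continuous_fst).mul continuous_const
  pos := ⟨fun x => D.radI * lerp x.1.1 (middle x.1.2) x.1.2 * x.2, by
    have := continuous_middle
    fun_prop⟩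
  avoid s m p hp hm hd := by
    obtain ⟨s, t⟩ := s
    have hr := D.rad_pos
    have hm' : 0 < (m : ℝ) := hm
    -- While the ratio is below 1, the new point is nearer than the others. Ratio 1 forces `s = 1`;
    -- then the cut has its full length ρ, and the new point lies within it.
    rcases (lerp s (middle t) t).2.2.lt_or_eq with hl | hl
    · refine avoid_of_dist_lt hh ?_ hd
      change D.rad * lerp s (middle t) t * m < D.rad * m
      have : 0 < D.rad * (m : ℝ) := mul_pos hr hm'
      nlinarith
    · refine avoid_of_pos_le_cut hh ?_ hp
      change D.rad * lerp s (middle t) t * m ≤ s * D.cut h.1 h.2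
      have hs : (s : ℝ) = 1 := by
        rw [coe_lerp, coe_middle] at hl
        have h1 := t.2.2
        have h2 := s.2.2
        have h3 := s.2.1
        nlinarith
      rw [cut_of_mem hh, hl, hs, mul_one, one_mul]
      exact (mul_le_of_le_one_right hr.le m.2.2).trans D.rad_lt.le

/-- The second stage of the homotopy between `radial` and `track`. -/
def stageTwo (hh : h ∈ D.H) : Insertion D (unitInterval × unitInterval) h where
  cuts _ := Cuts.full D
  continuous_cuts _ _ := continuous_const
  -- At `s = 0` this is the end of the first stage, with ratio `t` to the least distance; at `s = 1`
  -- it is the track, which no longer depends on the other points.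
  pos := ⟨fun x => x.1.2 * lerp x.1.1 (D.radI * x.2) D.ρI, by fun_prop⟩
  avoid s m p hp hm _ := by
    obtain ⟨s, t⟩ := s
    refine avoid_of_pos_le_cut hh ?_ hp
    change (t : ℝ) * ((1 - s) * (D.rad * m) + s * D.ρ) ≤ D.cut h.1 h.2
    rw [cut_of_mem hh]
    have h1 : D.rad * m ≤ D.ρ := (mul_le_of_le_one_right D.rad_pos.le m.2.2).trans D.rad_lt.le
    have h2 := s.2.2
    have h3 := s.2.1
    have h4 : (1 - (s : ℝ)) * (D.rad * m) + s * D.ρ ≤ D.ρ := by nlinarith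
    have h5 : 0 ≤ (1 - (s : ℝ)) * (D.rad * m) + s * D.ρ :=
      add_nonneg (mul_nonneg (by linarith) (mul_nonneg D.rad_pos.le m.2.1))
        (mul_nonneg h3 D.ρ_pos.le)
    exact (mul_le_of_le_one_left h5 t.2.2).trans h4

variable {ι : Type*} [Fintype ι] {k : ι}

theorem intermediate_radial_iff (hh : h ∈ D.H) (y : Conf {i : ι // i ≠ k} D.Punctured)
    (q : OpenInterval) :
    Intermediate ((radial hh).ins (y, q)) ↔ 1 / 3 ≤ (q.1 : ℝ) ∧ (q.1 : ℝ) ≤ 2 / 3 :=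
  (radial hh).intermediate_iff hh y q rfl

/-- The ratio at this end is (1 − s)/4, below 1/3. -/
theorem stageOne_zero (hh : h ∈ D.H) (y : Conf {i : ι // i ≠ k} D.Punctured) (s : unitInterval) :
    ¬ Intermediate ((stageOne hh).ins (y, (s, 0))) := by
  rw [(stageOne hh).intermediate_iff hh y (s, 0) (c := lerp s (middle 0) 0) rfl, coe_lerp,
    coe_middle]
  rintro ⟨h1, -⟩
  have := s.2.1
  norm_num at h1
  linarith

/-- The ratio at this end is (3 + s)/4, above 2/3. -/
theorem stageOne_one (hh : h ∈ D.H) (y : Conf {i : ι // i ≠ k} D.Punctured) (s : unitInterval) :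
    ¬ Intermediate ((stageOne hh).ins (y, (s, 1))) := by
  rw [(stageOne hh).intermediate_iff hh y (s, 1) (c := lerp s (middle 1) 1) rfl, coe_lerp,
    coe_middle]
  rintro ⟨-, h1⟩
  have := s.2.1
  norm_num at h1
  linarith

theorem stageTwo_zero (hh : h ∈ D.H) (y : Conf {i : ι // i ≠ k} D.Punctured) (s : unitInterval) :
    ¬ Intermediate ((stageTwo hh).ins (y, (s, 0))) := by
  refine (stageTwo hh).not_intermediate_of_old y _ sign_full_nonpos fun h0 => ?_
  rw [newPt, hpt_zero hh (Subtype.ext (zero_mul _)), sign_v] at h0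
  exact absurd h0 (lt_irrefl _)

/-- The position interpolates between `rad` times the gap and ρ, so the new point, if still in the
star, is at least as far from `v` as the nearest old point. -/
theorem stageTwo_one (hh : h ∈ D.H) (y : Conf {i : ι // i ≠ k} D.Punctured) (s : unitInterval) :
    ¬ Intermediate ((stageTwo hh).ins (y, (s, 1))) := by
  refine (stageTwo hh).not_intermediate_of_old y _ sign_full_nonpos fun h0 => ?_
  have hg : 0 < ((stageTwo hh).gap y (s, 1) : ℝ) := (stageTwo hh).gap_pos y _
  have hg1 := ((stageTwo hh).gap y (s, 1)).2.2
  have hr := D.rad_pos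
  have hp : ((stageTwo hh).pos ((s, 1), (stageTwo hh).gap y (s, 1)) : ℝ) =
      (1 - s) * (D.rad * (stageTwo hh).gap y (s, 1)) + s * D.ρ := one_mul _
  have h1 : D.rad * (stageTwo hh).gap y (s, 1) ≤ D.ρ :=
    (mul_le_of_le_one_right hr.le hg1).trans D.rad_lt.le
  have h2 := s.2.2
  have h3 := s.2.1
  have h4 := D.ρ_le
  have hle : ((stageTwo hh).pos ((s, 1), (stageTwo hh).gap y (s, 1)) : ℝ) ≤ 1 / 2 := by
    rw [hp]; nlinarith
  have hlt := ((hpt_sign_pos hh hle).1 h0).2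
  rw [newPt, hpt_dist hh hlt.le]
  have : ((stageTwo hh).gap y (s, 1) : ℝ) ≤
      (stageTwo hh).pos ((s, 1), (stageTwo hh).gap y (s, 1)) / D.rad := by
    rw [le_div_iff₀ hr, hp]
    nlinarith
  linarith

/-! ### The open cylinders -/

variable (h k) in
/-- The configurations whose point with label `k` lies on the half-edge `h`, close to `v` and closer
than all others. -/
def nearest : Set (Conf ι D.Γ.Space) := {x | (∃ t : unitInterval, 0 < (t : ℝ) ∧ (t : ℝ) < D.rad ∧
  x.1 k = pt h.1 (fromEnd h.2 t)) ∧ D.dist (x.1 k) < minDist x k}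

theorem isOpen_nearest : IsOpen (nearest h k) :=
  ((isOpen_star h).preimage (Conf.continuous_eval k)).inter
    (isOpen_lt (continuous_subtype_val.comp (D.continuous_dist.comp (Conf.continuous_eval k)))
      (continuous_subtype_val.comp (continuous_minDist k)))

theorem minDist_pos_of_nearest {x : Conf ι D.Γ.Space} (hx : x ∈ nearest h k) :
    0 < (minDist x k : ℝ) :=
  lt_of_le_of_lt (D.dist (x.1 k)).2.1 (show (D.dist (x.1 k) : ℝ) < minDist x k from hx.2)

theorem dist_pos_of_nearest (hh : h ∈ D.H) {x : Conf ι D.Γ.Space} (hx : x ∈ nearest h k) :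
    0 < (D.dist (x.1 k) : ℝ) := by
  obtain ⟨⟨t, h0, h1, ht⟩, -⟩ := hx
  rw [ht, hpt_dist hh h1.le]
  exact div_pos h0 D.rad_pos

/-- The old points of a configuration with a nearest point. -/
def oldPoints (x : nearest h k (ι := ι)) : Conf {i : ι // i ≠ k} D.Punctured :=
  ⟨fun i => ⟨x.1.1 i, fun hv => by
    have h1 : D.dist (x.1.1 k) < D.dist (x.1.1 i) := x.2.2.trans_le (minDist_le _ i.2)
    rw [hv, dist_v] at h1
    exact absurd h1 (not_lt.2 unitInterval.nonneg')⟩,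
    fun i j hij => Subtype.ext (x.1.2 (congrArg Subtype.val hij))⟩

/-- The ratio of the distances from `v` of the nearest point and the others. -/
def ratio (hh : h ∈ D.H) (x : nearest h k (ι := ι)) : OpenInterval :=
  ⟨⟨D.dist (x.1.1 k) / minDist x.1 k, div_nonneg (D.dist _).2.1 (minDist _ _).2.1,
    (div_le_one (minDist_pos_of_nearest x.2)).2 (le_of_lt x.2.2)⟩,
    div_pos (dist_pos_of_nearest hh x.2) (minDist_pos_of_nearest x.2),
    (div_lt_one (minDist_pos_of_nearest x.2)).2 x.2.2⟩

theorem continuous_oldPoints : Continuous (oldPoints (ι := ι) (h := h) (k := k)) :=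
  Continuous.subtype_mk (continuous_pi fun i : {i : ι // i ≠ k} => Continuous.subtype_mk
    ((Conf.continuous_eval i.1).comp continuous_subtype_val) _) _

theorem continuous_ratio (hh : h ∈ D.H) : Continuous (ratio (ι := ι) (k := k) hh) := by
  refine Continuous.subtype_mk (Continuous.subtype_mk (Continuous.div ?_ ?_ fun x => ?_) _) _
  · exact continuous_subtype_val.comp (D.continuous_dist.comp
      ((Conf.continuous_eval k).comp continuous_subtype_val))
  · exact continuous_subtype_val.comp ((continuous_minDist k).comp continuous_subtype_val)
  · exact (minDist_pos_of_nearest x.2).ne'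

theorem gap_oldPoints (hh : h ∈ D.H) (x : nearest h k (ι := ι)) (q : OpenInterval) :
    (radial hh).gap (oldPoints x) q = minDist x.1 k := by
  refine eq_of_forall_le_iff fun c => ?_
  rw [le_gap, le_minDist]
  have key : ∀ p, ((radial hh).cuts q).map p = p := Cuts.scale_zero D
  constructor
  · intro hc i hi
    have := hc ⟨i, hi⟩
    rwa [key] at this
  · intro hc i
    rw [key]
    exact hc i.1 i.2

theorem radial_oldPoints (hh : h ∈ D.H) (x : nearest h k (ι := ι)) :
    (radial hh).ins (oldPoints x, ratio hh x) = x.1 := by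
  refine Subtype.ext (funext fun i => ?_)
  by_cases hi : i = k
  · subst hi
    rw [ins_self, newPt, gap_oldPoints]
    obtain ⟨t, h0, h1, ht⟩ := x.2.1
    rw [ht]
    congr 2
    refine Subtype.ext ?_
    change D.rad * (D.dist (x.1.1 i) / minDist x.1 i) * minDist x.1 i = (t : ℝ)
    have hm := (minDist_pos_of_nearest x.2).ne'
    have hr := D.rad_pos.ne'
    rw [ht, hpt_dist hh h1.le]
    field_simp
  · rw [ins_old _ _ _ hi]
    exact Cuts.scale_zero D _

theorem dist_radial (hh : h ∈ D.H) (y : Conf {i : ι // i ≠ k} D.Punctured) (q : OpenInterval) :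
    (D.dist (((radial hh).ins (y, q)).1 k) : ℝ) = q.1 * (radial hh).gap y q := by
  have hp : ((radial hh).pos (q, (radial hh).gap y q) : ℝ) =
    D.rad * (q.1 * (radial hh).gap y q) := mul_assoc _ _ _
  have hg := ((radial hh).gap y q).2
  have hle : (q.1 : ℝ) * (radial hh).gap y q ≤ 1 := mul_le_one₀ q.2.2.le hg.1 hg.2
  rw [ins_self, newPt, hpt_dist hh, hp, mul_div_cancel_left₀ _ D.rad_pos.ne']
  rw [hp]
  exact mul_le_of_le_one_right D.rad_pos.le hle

theorem radial_mem_nearest (hh : h ∈ D.H) (z : Conf {i : ι // i ≠ k} D.Punctured × OpenInterval) :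
    (radial hh).ins z ∈ nearest h k := by
  obtain ⟨y, q⟩ := z
  have hg : 0 < ((radial hh).gap y q : ℝ) := (radial hh).gap_pos y q
  have hg1 := ((radial hh).gap y q).2.2
  have hq := q.2
  have hr := D.rad_pos
  have hlt : (q.1 : ℝ) * (radial hh).gap y q < (radial hh).gap y q :=
    mul_lt_of_lt_one_left hg hq.2
  refine ⟨⟨_, ?_, ?_, ins_self _ _ _⟩, ?_⟩
  · change 0 < D.rad * q.1 * (radial hh).gap y q
    exact mul_pos (mul_pos hr hq.1) hg
  · change D.rad * q.1 * (radial hh).gap y q < D.rad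
    rw [mul_assoc]
    nlinarith
  · change (D.dist _ : ℝ) < minDist _ _
    rw [minDist_ins, dist_radial]
    exact hlt

theorem oldPoints_radial (hh : h ∈ D.H) (y : Conf {i : ι // i ≠ k} D.Punctured)
    (q : OpenInterval) : oldPoints ⟨_, radial_mem_nearest hh (y, q)⟩ = y := by
  refine Subtype.ext (funext fun i => Subtype.ext ?_)
  exact ((radial hh).ins_old y q i.2).trans (Cuts.scale_zero D _)

theorem ratio_radial (hh : h ∈ D.H) (y : Conf {i : ι // i ≠ k} D.Punctured)
    (q : OpenInterval) : ratio hh ⟨_, radial_mem_nearest hh (y, q)⟩ = q := by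
  refine Subtype.ext (Subtype.ext ?_)
  change (D.dist (((radial hh).ins (y, q)).1 k) : ℝ) / minDist ((radial hh).ins (y, q)) k = q.1
  rw [minDist_ins, dist_radial]
  exact mul_div_cancel_right₀ _ (show 0 < ((radial hh).gap y q : ℝ) from
    (radial hh).gap_pos y q).ne'

/-- On the open set `nearest h k`, the pair of `oldPoints` and `ratio` is a continuous inverse, so
images of open sets are preimages under it. -/
theorem isOpenMap_radial (hh : h ∈ D.H) : IsOpenMap ((radial hh).ins (ι := ι) (k := k)) := by
  intro W hW
  have : (radial hh).ins '' W = Subtype.val ''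
      ((fun x : nearest h k (ι := ι) => (oldPoints x, ratio hh x)) ⁻¹' W) := by
    ext x
    constructor
    · rintro ⟨⟨y, q⟩, hz, rfl⟩
      refine ⟨⟨_, radial_mem_nearest hh (y, q)⟩, ?_, rfl⟩
      change (_, _) ∈ W
      rwa [oldPoints_radial, ratio_radial]
    · rintro ⟨x, hx, rfl⟩
      exact ⟨_, hx, radial_oldPoints hh x⟩
  rw [this]
  exact isOpen_nearest.isOpenMap_subtype_val _
    (hW.preimage (continuous_oldPoints.prodMk (continuous_ratio hh)))

theorem exists_nearest {x : Conf ι D.Γ.Space} (hx : Intermediate x) :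
    ∃ k, ∃ h ∈ D.H, x ∈ nearest h k := by
  obtain ⟨k, h1, h2, h3⟩ := hx
  obtain ⟨h, hh, t, h0, hr, ht⟩ := sign_pos_iff.1 h1
  refine ⟨k, h, hh, ⟨t, h0, hr, ht⟩, ?_⟩
  change (D.dist (x.1 k) : ℝ) < minDist x k
  have h4 : 0 < (D.dist (x.1 k) : ℝ) := by
    rw [ht, hpt_dist hh hr.le]
    exact div_pos h0 D.rad_pos
  linarith

/-- The label is determined because the nearest point is strictly nearest, and the half-edge because
the point lies in the open star. This makes the cylinders disjoint. -/
theorem nearest_unique {h' : D.Γ.E × Bool} {k' : ι} {x : Conf ι D.Γ.Space} (hx : x ∈ nearest h k)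
    (hx' : x ∈ nearest h' k') : k = k' ∧ h = h' := by
  have hk : k = k' := by
    by_contra hne
    have h1 := hx.2.trans_le (minDist_le x (Ne.symm hne))
    have h2 := hx'.2.trans_le (minDist_le x hne)
    exact lt_asymm h1 h2
  subst hk
  obtain ⟨⟨t, h0, h1, ht⟩, -⟩ := hx
  obtain ⟨⟨t', h0', h1', ht'⟩, -⟩ := hx'
  exact ⟨rfl, (hpt_inj h0 h1 h1' (ht.symm.trans ht')).1⟩

theorem smul_mem_nearest {σ : Equiv.Perm ι} {x : Conf ι D.Γ.Space} (hx : x ∈ nearest h k) :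
    σ • x ∈ nearest h (σ k) := by
  have hk : (σ • x).1 (σ k) = x.1 k := congrArg x.1 (σ.symm_apply_apply k)
  have hm : minDist (σ • x) (σ k) = minDist x k := by
    rw [minDist_smul]
    exact congrArg _ (σ.symm_apply_apply k)
  refine ⟨?_, ?_⟩
  · rw [hk]; exact hx.1
  · rw [hk, hm]; exact hx.2

end Insertion

end HalfEdgeData

theorem quotientLift_apply {P Q Z : Type*} [TopologicalSpace P] [TopologicalSpace Q]
    [TopologicalSpace Z] (π : C(P, Q)) (hπ : Topology.IsQuotientMap π) (g : C(P, Z))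
    (h : FactorsThrough g π) (p : P) : hπ.lift g h (π p) = g p :=
  DFunLike.congr_fun (hπ.lift_comp g h) p

namespace HalfEdgeData

/-! ### Diagrams presented by ordered configurations -/

/-- A description of a diagram as a quotient of ordered configuration spaces by a group of
permutations of the labels. The summand `j` belongs to the insertion of a point with label `k j` on
the half-edge `h j`, and the summands are the orbits of such insertions. -/
structure Presentation (D : HalfEdgeData.{u}) (S : SequenceDiagram.{u}) where
  ι : Type
  [fin : Fintype ι]
  G : Subgroup (Equiv.Perm ι)
  πX : C(Conf ι D.Γ.Space, S.X)
  πA : C(Conf ι D.Deleted, S.A)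
  k : S.J → ι
  h : S.J → D.H
  πY : ∀ j, C(Conf {i : ι // i ≠ k j} D.Punctured, S.Y j)
  πX_open : IsOpenQuotientMap πX
  πX_eq : ∀ x x', πX x = πX x' ↔ ∃ σ ∈ G, σ • x = x'
  πA_surjective : Surjective πA
  πA_smul : ∀ σ ∈ G, ∀ z, πA (σ • z) = πA z
  πY_open : ∀ j, IsOpenQuotientMap (πY j)
  πY_eq : ∀ j y y', πY j y = πY j y' ↔ ∃ σ ∈ G, σ (k j) = k j ∧
    ∀ i i' : {i : ι // i ≠ k j}, σ i = i' → y'.1 i' = y.1 i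
  inc_πA : ∀ z, S.inc (πA z) =
    πX (Conf.map D.deletedIncl D.deletedIncl_injective (Equiv.refl ι) z)
  p_πY : ∀ j y, S.p j (πY j y) =
    πA (Conf.insert (k j) D.shrinkMap D.shrinkMap_injective D.vertexPt D.shrinkMap_ne_vertexPt y)
  q_πY : ∀ j y, S.q j (πY j y) = πA (Conf.insert (k j) D.shrinkMap D.shrinkMap_injective
    (D.endPt (h j)) (D.shrinkMap_ne_endPt (h j)) y)
  exists_index : ∀ k₀ h₀, ∃ j, h j = h₀ ∧ ∃ σ ∈ G, σ (k j) = k₀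
  index_unique : ∀ j j', ∀ σ ∈ G, σ (k j) = k j' → h j = h j' → j = j'

attribute [instance] Presentation.fin

namespace Presentation

variable {D : HalfEdgeData.{u}} {S : SequenceDiagram.{u}} (P : Presentation D S)

abbrev toConf : C(Conf P.ι D.Deleted, Conf P.ι D.Γ.Space) :=
  Conf.map D.deletedIncl D.deletedIncl_injective (Equiv.refl P.ι)

theorem isInducing_toConf : Topology.IsInducing P.toConf := by
  have h1 : Topology.IsInducing fun z : Conf P.ι D.Deleted => fun i => (z.1 i).1 :=
    (Topology.IsInducing.piMap fun _ : P.ι => Topology.IsInducing.subtypeVal).comp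
      Topology.IsInducing.subtypeVal
  exact Topology.IsInducing.of_comp P.toConf.continuous continuous_subtype_val h1

theorem toConf_injective : Injective P.toConf := fun _ _ hz =>
  Subtype.ext (funext fun i => Subtype.ext (congrFun (congrArg Subtype.val hz) i))

theorem toConf_smul (σ : Equiv.Perm P.ι) (z : Conf P.ι D.Deleted) :
    P.toConf (σ • z) = σ • P.toConf z := rfl

theorem mem_range_inc {x : Conf P.ι D.Γ.Space} (hx : ∀ i, ∀ h ∈ D.H, x.1 i ∉ halfEdge D.ρ h) :
    P.πX x ∈ range S.inc :=
  ⟨P.πA ⟨fun i => ⟨x.1 i, hx i⟩, fun _ _ hij => x.2 (congrArg Subtype.val hij)⟩, P.inc_πA _⟩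

theorem notMem_of_mem_range_inc {x : Conf P.ι D.Γ.Space} (hx : P.πX x ∈ range S.inc) (i : P.ι) :
    ∀ h ∈ D.H, x.1 i ∉ halfEdge D.ρ h := by
  obtain ⟨a, ha⟩ := hx
  obtain ⟨z, rfl⟩ := P.πA_surjective a
  rw [P.inc_πA] at ha
  obtain ⟨σ, -, rfl⟩ := (P.πX_eq _ _).1 ha
  exact (z.1 (σ⁻¹ i)).2

theorem inc_injective (P : Presentation D S) : Injective S.inc := by
  intro a a' h
  obtain ⟨z, rfl⟩ := P.πA_surjective a
  obtain ⟨z', rfl⟩ := P.πA_surjective a'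
  rw [P.inc_πA, P.inc_πA] at h
  obtain ⟨σ, hσ, hz⟩ := (P.πX_eq _ _).1 h
  have hz' : σ • z = z' := P.toConf_injective hz
  rw [← hz', P.πA_smul σ hσ]

/-- The preimage in ordered configurations of an open `V` is the trace of an open `W`, and `πX '' W`
is open. A point of `A` mapped into it has a representative with a translate in `W`; as `πA` is
invariant, the point lies in `V`. -/
theorem isEmbedding_inc (P : Presentation D S) : Topology.IsEmbedding S.inc := by
  refine ⟨Topology.isInducing_iff_nhds.2 fun a => le_antisymm S.inc.continuous.continuousAt.le_comap
    fun U hU => ?_, P.inc_injective⟩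
  obtain ⟨V, hVU, hV, haV⟩ := mem_nhds_iff.1 hU
  obtain ⟨W, hW, hWV⟩ := P.isInducing_toConf.isOpen_iff.1 (hV.preimage P.πA.continuous)
  refine Filter.mem_comap.2 ⟨P.πX '' W, (P.πX_open.isOpenMap W hW).mem_nhds ?_, ?_⟩
  · obtain ⟨z, rfl⟩ := P.πA_surjective a
    have hz : z ∈ P.toConf ⁻¹' W := by rw [hWV]; exact haV
    exact ⟨_, hz, (P.inc_πA z).symm⟩
  · rintro b ⟨x, hx, hxb⟩
    obtain ⟨z, rfl⟩ := P.πA_surjective b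
    rw [P.inc_πA] at hxb
    obtain ⟨σ, hσ, hz⟩ := (P.πX_eq _ _).1 hxb.symm
    have h1 : σ • z ∈ P.toConf ⁻¹' W := by
      change P.toConf (σ • z) ∈ W
      rw [toConf_smul, hz]
      exact hx
    rw [hWV] at h1
    have h2 : P.πA (σ • z) ∈ V := h1
    rw [P.πA_smul σ hσ] at h2
    exact hVU h2

section Descend

variable {T : Type*} [TopologicalSpace T] (j : S.J) (I : Insertion D T (P.h j).1)

/-- The insertion of a point, as a map on the quotients. -/
def descend : C(S.Y j × T, S.X) :=
  Topology.IsQuotientMap.lift (f := (P.πY j).prodMap (ContinuousMap.id T))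
    ((P.πY_open j).prodMap .id).isQuotientMap (P.πX.comp I.ins) (by
      rintro ⟨y, s⟩ ⟨y', s'⟩ hy
      have hs : s = s' := congrArg Prod.snd hy
      subst hs
      obtain ⟨σ, hσ, hk, hi⟩ := (P.πY_eq j y y').1 (congrArg Prod.fst hy)
      exact (P.πX_eq _ _).2 ⟨σ, hσ, I.ins_relabel hk hi s⟩)

theorem descend_apply (y : Conf {i : P.ι // i ≠ P.k j} D.Punctured) (s : T) :
    P.descend j I (P.πY j y, s) = P.πX (I.ins (y, s)) :=
  quotientLift_apply ((P.πY j).prodMap (ContinuousMap.id T))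
    ((P.πY_open j).prodMap .id).isQuotientMap (P.πX.comp I.ins) _ (y, s)

end Descend

/-- The homotopies that move a point along a half-edge. -/
def tracks : S.Tracks where
  emb := P.isEmbedding_inc
  T j := P.descend j (.track (P.h j).2)
  T_zero j y := by
    obtain ⟨y, rfl⟩ := (P.πY_open j).surjective y
    rw [descend_apply, P.p_πY, P.inc_πA]
    congr 1
    refine Subtype.ext (funext fun i => ?_)
    by_cases hi : i = P.k j
    · subst hi
      rw [Insertion.ins_self]
      refine (hpt_zero (P.h j).2 (Subtype.ext (zero_mul _))).trans ?_
      exact (congrArg Subtype.val (dif_pos rfl :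
        (Conf.insert (P.k j) D.shrinkMap D.shrinkMap_injective D.vertexPt
          D.shrinkMap_ne_vertexPt y).1 (P.k j) = _)).symm
    · rw [Insertion.ins_old _ _ _ hi]
      refine (congrFun (Cuts.full_map D) _).trans ?_
      exact (congrArg Subtype.val (dif_neg hi :
        (Conf.insert (P.k j) D.shrinkMap D.shrinkMap_injective D.vertexPt
          D.shrinkMap_ne_vertexPt y).1 i = _)).symm
  T_one j y := by
    obtain ⟨y, rfl⟩ := (P.πY_open j).surjective y
    rw [descend_apply, P.q_πY, P.inc_πA]
    congr 1
    refine Subtype.ext (funext fun i => ?_)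
    by_cases hi : i = P.k j
    · subst hi
      rw [Insertion.ins_self]
      refine Eq.trans ?_ (congrArg Subtype.val (dif_pos rfl :
        (Conf.insert (P.k j) D.shrinkMap D.shrinkMap_injective (D.endPt (P.h j))
          (D.shrinkMap_ne_endPt (P.h j)) y).1 (P.k j) = _)).symm
      change pt _ (fromEnd _ (1 * D.ρI)) = pt _ (fromEnd _ D.ρI)
      rw [one_mul]
    · rw [Insertion.ins_old _ _ _ hi]
      refine (congrFun (Cuts.full_map D) _).trans ?_
      exact (congrArg Subtype.val (dif_neg hi :
        (Conf.insert (P.k j) D.shrinkMap D.shrinkMap_injective (D.endPt (P.h j))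
          (D.shrinkMap_ne_endPt (P.h j)) y).1 i = _)).symm

/-! ### The cohomology of the pair -/

/-- The configurations without a point at intermediate distance. -/
def good : Set S.X := P.πX '' {x | ¬ Intermediate x}

theorem mem_good {x : Conf P.ι D.Γ.Space} : P.πX x ∈ P.good ↔ ¬ Intermediate x := by
  constructor
  · rintro ⟨x', hx', h⟩ hx
    obtain ⟨σ, -, rfl⟩ := (P.πX_eq _ _).1 h.symm
    exact hx' (hx.smul σ)
  · exact fun hx => ⟨x, hx, rfl⟩

theorem isOpen_good : IsOpen P.good :=
  P.πX_open.isOpenMap _ isClosed_intermediate.isOpen_compl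

def goodProj : C(P.πX ⁻¹' P.good, P.good) :=
  ⟨P.good.restrictPreimage P.πX, P.πX.continuous.restrictPreimage⟩

theorem goodProj_open : IsOpenQuotientMap P.goodProj := P.πX_open.restrictPreimage P.good

/-- The deformation of the good part into the image of `A`. -/
def deformation : C(unitInterval × P.good, P.good) :=
  Topology.IsQuotientMap.lift
    (f := (ContinuousMap.id unitInterval).prodMap P.goodProj)
    (IsOpenQuotientMap.prodMap .id P.goodProj_open).isQuotientMap
    ⟨fun x => ⟨P.πX (deform x.1 x.2.1),
      P.mem_good.2 (deform_not_intermediate _ (P.mem_good.1 x.2.2))⟩,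
      Continuous.subtype_mk (P.πX.continuous.comp (continuous_deform.comp
        (continuous_fst.prodMk (Continuous.subtype_mk
          (continuous_subtype_val.comp continuous_snd) fun x => P.mem_good.1 x.2.2)))) _⟩ (by
      rintro ⟨s, x⟩ ⟨s', x'⟩ h
      have hs : s = s' := congrArg Prod.fst h
      subst hs
      have h1 : P.πX x.1 = P.πX x'.1 := congrArg Subtype.val (congrArg Prod.snd h)
      obtain ⟨σ, hσ, hx⟩ := (P.πX_eq _ _).1 h1
      refine Subtype.ext ((P.πX_eq _ _).2 ⟨σ, hσ, ?_⟩)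
      rw [← deform_smul, hx])

theorem deformation_apply (s : unitInterval) (x : Conf P.ι D.Γ.Space) (hx : P.πX x ∈ P.good) :
    (P.deformation (s, ⟨P.πX x, hx⟩)).1 = P.πX (deform s x) :=
  congrArg Subtype.val (quotientLift_apply ((ContinuousMap.id unitInterval).prodMap P.goodProj)
    (IsOpenQuotientMap.prodMap .id P.goodProj_open).isQuotientMap _ _ (s, ⟨x, hx⟩))

/-- A permutation relating two radial configurations maps the nearest point to the nearest point, so
it fixes `k j`. It then preserves the ratio and relates the old points, so both come from the same
point of the quotient cylinder. -/
theorem isOpenEmbedding_descend_radial (j : S.J) :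
    Topology.IsOpenEmbedding (P.descend j (.radial (P.h j).2)) := by
  refine .of_continuous_injective_isOpenMap (P.descend j _).continuous ?_ ?_
  · rintro ⟨y, q⟩ ⟨y', q'⟩ hz
    obtain ⟨y, rfl⟩ := (P.πY_open j).surjective y
    obtain ⟨y', rfl⟩ := (P.πY_open j).surjective y'
    rw [descend_apply, descend_apply] at hz
    obtain ⟨σ, hσ, hx⟩ := (P.πX_eq _ _).1 hz
    have hm := Insertion.radial_mem_nearest (P.h j).2 (y, q)
    have hm' := Insertion.radial_mem_nearest (P.h j).2 (y', q')
    have hs := Insertion.smul_mem_nearest (σ := σ) hm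
    rw [hx] at hs
    have hk : σ (P.k j) = P.k j := (Insertion.nearest_unique hs hm').1
    have hr : ∀ z z' : Conf {i : P.ι // i ≠ P.k j} D.Punctured × OpenInterval,
        σ • (Insertion.radial (P.h j).2).ins z = (Insertion.radial (P.h j).2).ins z' →
        z.2 = z'.2 := by
      rintro ⟨y, q⟩ ⟨y', q'⟩ hx
      have h1 := congrArg (fun x : Conf P.ι D.Γ.Space => D.dist (x.1 (P.k j))) hx
      have h2 := congrArg (fun x => minDist x (P.k j)) hx
      have h3 : σ⁻¹ (P.k j) = P.k j := σ.symm_apply_eq.2 hk.symm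
      simp only [minDist_smul, h3] at h2
      change D.dist (((Insertion.radial (P.h j).2).ins (y, q)).1 (σ⁻¹ (P.k j))) =
        D.dist (((Insertion.radial (P.h j).2).ins (y', q')).1 (P.k j)) at h1
      rw [h3] at h1
      rw [← Insertion.ratio_radial (P.h j).2 y q, ← Insertion.ratio_radial (P.h j).2 y' q']
      refine Subtype.ext (Subtype.ext ?_)
      simp only [Insertion.ratio, h1, h2]
    refine Prod.ext ?_ (hr _ _ hx)
    refine (P.πY_eq j y y').2 ⟨σ, hσ, hk, fun i i' hi => ?_⟩
    have h1 := congrArg (fun x : Conf P.ι D.Γ.Space => x.1 i'.1) hx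
    have h3 : σ⁻¹ i'.1 = i.1 := σ.symm_apply_eq.2 hi.symm
    change ((Insertion.radial (P.h j).2).ins (y, q)).1 (σ⁻¹ i'.1) =
      ((Insertion.radial (P.h j).2).ins (y', q')).1 i'.1 at h1
    rw [h3, Insertion.ins_old _ _ _ i.2, Insertion.ins_old _ _ _ i'.2] at h1
    exact Subtype.ext ((Cuts.map_injective _ h1).symm)
  · have hq : IsOpenQuotientMap (Prod.map (P.πY j) (id : OpenInterval → OpenInterval)) :=
      (P.πY_open j).prodMap .id
    refine hq.isOpenMap_iff.2 ?_
    have : P.descend j (.radial (P.h j).2) ∘ Prod.map (P.πY j) id =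
        P.πX ∘ (Insertion.radial (P.h j).2).ins :=
      funext fun z => P.descend_apply j _ z.1 z.2
    rw [this]
    exact P.πX_open.isOpenMap.comp (Insertion.isOpenMap_radial _)

theorem exists_descend_radial {x : Conf P.ι D.Γ.Space} (hx : Intermediate x) :
    ∃ j z, P.descend j (.radial (P.h j).2) z = P.πX x := by
  obtain ⟨k₀, h₀, hh, hn⟩ := Insertion.exists_nearest hx
  obtain ⟨j, hj, σ, hσ, hk⟩ := P.exists_index k₀ ⟨h₀, hh⟩
  have hj' : (P.h j).1 = h₀ := congrArg Subtype.val hj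
  have h1 := Insertion.smul_mem_nearest (σ := σ⁻¹) hn
  have h2 : σ⁻¹ k₀ = P.k j := σ.symm_apply_eq.2 hk.symm
  rw [h2, ← hj'] at h1
  refine ⟨j, (P.πY j (Insertion.oldPoints ⟨_, h1⟩), Insertion.ratio (P.h j).2 ⟨_, h1⟩), ?_⟩
  rw [descend_apply, Insertion.radial_oldPoints]
  exact (P.πX_eq _ _).2 ⟨σ, hσ, smul_inv_smul σ x⟩

/-- The good part serves as the neighbourhood of `A`, and the complement of all radial cylinders is
excised. It is contained in the good part because an intermediate configuration has a nearest point
in `H`. -/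
theorem key : SequenceDiagram.Tracks.Key.{u, w} P.tracks := by
  refine SequenceDiagram.Tracks.key_of_cylinders (t := P.tracks) P.good
    (⋃ j, range (P.descend j (.radial (P.h j).2)))ᶜ P.isOpen_good
    (isOpen_iUnion fun j => (P.isOpenEmbedding_descend_radial j).isOpen_range).isClosed_compl
    ?_ ?_ P.deformation ?_ ?_ ?_ (fun j => P.descend j (.radial (P.h j).2))
    P.isOpenEmbedding_descend_radial ?_ ?_ ?_ ?_
  · intro x hx
    obtain ⟨x, rfl⟩ := P.πX_open.surjective x
    refine P.mem_good.2 fun hi => hx ?_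
    obtain ⟨j, z, hz⟩ := P.exists_descend_radial hi
    exact mem_iUnion.2 ⟨j, z, hz⟩
  · intro x hx
    obtain ⟨x, rfl⟩ := P.πX_open.surjective x
    exact P.mem_good.2 (not_intermediate_of_notMem (P.notMem_of_mem_range_inc hx))
  · rintro ⟨x, hx⟩
    obtain ⟨x, rfl⟩ := P.πX_open.surjective x
    refine Subtype.ext ?_
    rw [deformation_apply, deform_zero]
  · rintro ⟨x, hx⟩
    obtain ⟨x, rfl⟩ := P.πX_open.surjective x
    rw [deformation_apply]
    exact P.mem_range_inc (deform_one x)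
  · rintro s ⟨x, hx⟩ hA
    obtain ⟨x, rfl⟩ := P.πX_open.surjective x
    rw [deformation_apply]
    exact P.mem_range_inc fun i => deform_notMem s (P.notMem_of_mem_range_inc hA i)
  · rintro j j' ⟨y, q⟩ ⟨y', q'⟩ hz
    obtain ⟨y, rfl⟩ := (P.πY_open j).surjective y
    obtain ⟨y', rfl⟩ := (P.πY_open j').surjective y'
    rw [descend_apply, descend_apply] at hz
    obtain ⟨σ, hσ, hx⟩ := (P.πX_eq _ _).1 hz
    have hs := Insertion.smul_mem_nearest (σ := σ)
      (Insertion.radial_mem_nearest (P.h j).2 (y, q))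
    rw [hx] at hs
    obtain ⟨h1, h2⟩ := Insertion.nearest_unique hs
      (Insertion.radial_mem_nearest (P.h j').2 (y', q'))
    exact P.index_unique j j' σ hσ h1 (Subtype.ext h2)
  · intro x
    rw [notMem_compl_iff, mem_iUnion]
    rfl
  · rintro j ⟨y, q⟩
    obtain ⟨y, rfl⟩ := (P.πY_open j).surjective y
    rw [descend_apply, mem_good, Insertion.intermediate_radial_iff, not_and_or, not_le, not_le]
  · intro j
    let e : C(unitInterval × (S.Y j × unitInterval), S.Y j × (unitInterval × unitInterval)) :=
      ⟨fun x => (x.2.1, (x.1, x.2.2)), by fun_prop⟩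
    -- The first stage starts at the middle part of the radial cylinder, cuts the edges and ends at
    -- ratio `t`; the second leads from there to the track.
    refine ⟨(P.descend j (.stageTwo (P.h j).2)).comp e,
      (P.descend j (.stageOne (P.h j).2)).comp e, ?_, ?_, ?_, ?_⟩
    · rintro ⟨y, t⟩
      obtain ⟨y, rfl⟩ := (P.πY_open j).surjective y
      refine (P.descend_apply j _ y (1, t)).trans (Eq.trans ?_ (P.descend_apply j _ y t).symm)
      congr 1
      refine Subtype.ext (funext fun i => ?_)
      by_cases hi : i = P.k j
      · subst hi
        rw [Insertion.ins_self, Insertion.ins_self, Insertion.newPt, Insertion.newPt]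
        congr 2
        change t * lerp 1 _ _ = t * D.ρI
        rw [lerp_one]
      · rw [Insertion.ins_old _ _ _ hi, Insertion.ins_old _ _ _ hi]
        rfl
    · rintro ⟨y, t⟩
      obtain ⟨y, rfl⟩ := (P.πY_open j).surjective y
      refine (P.descend_apply j _ y (0, t)).trans (Eq.trans ?_ (P.descend_apply j _ y (1, t)).symm)
      have hc : ∀ p, (Cuts.full D).map p = (Cuts.scale D 1).map p := fun p => by
        rw [Cuts.full_map, Cuts.scale_one]
      have hg : (Insertion.stageTwo (P.h j).2).gap y (0, t) =
          (Insertion.stageOne (P.h j).2).gap y (1, t) := by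
        refine eq_of_forall_le_iff fun c => ?_
        rw [Insertion.le_gap, Insertion.le_gap]
        exact forall_congr' fun i => by
          change c ≤ D.dist ((Cuts.full D).map _) ↔ c ≤ D.dist ((Cuts.scale D 1).map _)
          rw [hc]
      congr 1
      refine Subtype.ext (funext fun i => ?_)
      by_cases hi : i = P.k j
      · subst hi
        rw [Insertion.ins_self, Insertion.ins_self, Insertion.newPt, Insertion.newPt, hg]
        congr 2
        change t * lerp 0 (D.radI * _) _ = D.radI * lerp 1 _ t * _
        rw [lerp_zero, lerp_one, mul_left_comm, mul_assoc]
      · rw [Insertion.ins_old _ _ _ hi, Insertion.ins_old _ _ _ hi]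
        exact hc _
    · rintro ⟨y, t⟩
      obtain ⟨y, rfl⟩ := (P.πY_open j).surjective y
      refine (P.descend_apply j _ y (0, t)).trans
        (Eq.trans ?_ (P.descend_apply j _ y (middleOpen t)).symm)
      congr 1
      have hg : (Insertion.stageOne (P.h j).2).gap y (0, t) =
          (Insertion.radial (P.h j).2).gap y (middleOpen t) := rfl
      refine Subtype.ext (funext fun i => ?_)
      by_cases hi : i = P.k j
      · subst hi
        rw [Insertion.ins_self, Insertion.ins_self, Insertion.newPt, Insertion.newPt, hg]
        congr 2
        change D.radI * lerp 0 _ t * _ = D.radI * (middleOpen t).1 * _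
        rw [lerp_zero]
        rfl
      · rw [Insertion.ins_old _ _ _ hi, Insertion.ins_old _ _ _ hi]
        rfl
    · intro s y
      obtain ⟨y, rfl⟩ := (P.πY_open j).surjective y
      refine ⟨?_, ?_, ?_, ?_⟩
      · change P.descend j _ (P.πY j y, (s, 0)) ∈ _
        rw [descend_apply, mem_good]
        exact Insertion.stageTwo_zero _ y s
      · change P.descend j _ (P.πY j y, (s, 1)) ∈ _
        rw [descend_apply, mem_good]
        exact Insertion.stageTwo_one _ y s
      · change P.descend j _ (P.πY j y, (s, 0)) ∈ _
        rw [descend_apply, mem_good]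
        exact Insertion.stageOne_zero _ y s
      · change P.descend j _ (P.πY j y, (s, 1)) ∈ _
        rw [descend_apply, mem_good]
        exact Insertion.stageOne_one _ y s

end Presentation

end HalfEdgeData

namespace HalfEdgeData

/-! ### Maps of presented diagrams -/

theorem Insertion.ins_congr {D : HalfEdgeData.{u}} {T T' : Type*} [TopologicalSpace T]
    [TopologicalSpace T'] {h : D.Γ.E × Bool} {I : Insertion D T h} {I' : Insertion D T' h}
    {ι : Type*} [Fintype ι] {k : ι} {s : T} {s' : T'}
    (hmap : ∀ p, (I.cuts s).map p = (I'.cuts s').map p)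
    (hpos : ∀ m, I.pos (s, m) = I'.pos (s', m)) (y : Conf {i : ι // i ≠ k} D.Punctured) :
    I.ins (y, s) = I'.ins (y, s') := by
  have hg : I.gap y s = I'.gap y s' := by
    refine eq_of_forall_le_iff fun c => ?_
    rw [le_gap, le_gap]
    exact forall_congr' fun i => by rw [hmap]
  refine Subtype.ext (funext fun i => ?_)
  by_cases hi : i = k
  · subst hi
    rw [ins_self, ins_self, newPt, newPt, hg, hpos]
  · rw [ins_old _ _ _ hi, ins_old _ _ _ hi, hmap]

theorem hpt_notMem (D : HalfEdgeData.{u}) {h : D.Γ.E × Bool} {x : unitInterval}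
    (hx : (x : ℝ) ≤ 1 / 2) (hh : h ∈ D.H → x = 0 ∨ D.ρ ≤ x) :
    ∀ h' ∈ D.H, (pt h.1 (fromEnd h.2 x) : D.Γ.Space) ∉ halfEdge D.ρ h' := by
  obtain ⟨e, b⟩ := h
  by_cases h0 : x = 0
  · subst h0
    have : (pt e (fromEnd b 0) : D.Γ.Space) = vert (D.Γ.ends e b) := by
      cases b
      · exact pt_zero e
      · refine Eq.trans ?_ (pt_one e)
        change pt e (unitInterval.symm 0) = _
        rw [unitInterval.symm_zero]
    rw [this]
    exact D.vert_notMem _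
  · have h1 : x ≠ 1 := by
      rintro rfl
      norm_num at hx
    have hi := fromEnd_interior (b := b) h0 h1
    rw [pt_notMem_iff hi.1 hi.2]
    intro b' hb'
    by_cases hbb : b' = b
    · subst hbb
      rw [fromEnd_fromEnd]
      exact (hh hb').resolve_left h0
    · rw [Bool.eq_not.2 hbb, coe_fromEnd_not, fromEnd_fromEnd]
      linarith [D.ρ_le]

theorem Cuts.map_congr {D : HalfEdgeData.{u}} {c c' : D.Cuts} (h : ∀ e b, c.c e b = c'.c e b)
    (p : D.Γ.Space) : c.map p = c'.map p := by
  obtain ⟨c, _, _⟩ := c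
  obtain ⟨c', _, _⟩ := c'
  obtain rfl : c = c' := funext fun e => funext fun b => h e b
  rfl

theorem fromEnd_xor (b b' : Bool) (x : unitInterval) :
    fromEnd b' (fromEnd b x) = fromEnd (xor b b') x := by
  cases b <;> cases b' <;> simp [fromEnd]

namespace Embedding

variable {D D' : HalfEdgeData.{u}} (f : Embedding D D')

theorem onSpace_hpt (h : D.Γ.E × Bool) (x : unitInterval) :
    f.onSpace (pt h.1 (fromEnd h.2 x)) = pt (f.onHalf h).1 (fromEnd (f.onHalf h).2 x) := by
  change pt (f.onE h.1) (fromEnd (f.flip h.1) (fromEnd h.2 x)) = _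
  rw [fromEnd_xor]
  rfl

/-- A half-edge sent into `H'` lies in `H`, and ρ' ≤ ρ. So the cuts of Γ' pulled back along `f` are
admissible for Γ, and so is every interpolation. -/
theorem cut_le_cut (h : D.Γ.E × Bool) :
    D'.cut (f.onHalf h).1 (f.onHalf h).2 ≤ D.cut h.1 h.2 := by
  by_cases hf : f.onHalf h ∈ D'.H
  · rw [cut_of_mem hf, cut_of_mem (f.mem_of_map_mem h hf)]
    exact f.ρ_le_ρ
  · rw [show D'.cut (f.onHalf h).1 (f.onHalf h).2 = 0 from if_neg hf]
    exact D.cut_nonneg _ _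

/-- The cuts that interpolate between those for `H` and those for `H'`. -/
def cuts (s : unitInterval) : D.Cuts where
  c e b := (1 - s) * D.cut e b + s * D'.cut (f.onHalf (e, b)).1 (f.onHalf (e, b)).2
  nonneg e b := add_nonneg (mul_nonneg (by linarith [s.2.2]) (D.cut_nonneg _ _))
    (mul_nonneg s.2.1 (D'.cut_nonneg _ _))
  le_cut e b := by
    have := mul_le_mul_of_nonneg_left (f.cut_le_cut (e, b)) s.2.1
    dsimp only at this
    linarith

theorem cuts_ge (s : unitInterval) (e : D.Γ.E) (b : Bool) :
    D'.cut (f.onHalf (e, b)).1 (f.onHalf (e, b)).2 ≤ (f.cuts s).c e b := by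
  change _ ≤ (1 - (s : ℝ)) * D.cut e b + s * D'.cut (f.onHalf (e, b)).1 (f.onHalf (e, b)).2
  have := mul_le_mul_of_nonneg_left (f.cut_le_cut (e, b)) (by linarith [s.2.2] : 0 ≤ 1 - (s : ℝ))
  dsimp only at this
  linarith

theorem cuts_zero (p : D.Γ.Space) : (f.cuts 0).map p = (Cuts.full D).map p :=
  Cuts.map_congr (fun e b => by
    change (1 - (0 : ℝ)) * D.cut e b + 0 * _ = D.cut e b
    ring) p

/-- At time 1 every edge is cut as its image in Γ' is, so shrinking commutes with the embedding,
with the two ends exchanged on reversed edges. -/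
theorem cuts_one (p : D.Γ.Space) : f.onSpace ((f.cuts 1).map p) =
    (Cuts.full D').map (f.onSpace p) := by
  rcases D.exists_rep p with ⟨w, rfl⟩ | ⟨e, t, h0, h1, rfl⟩
  · rfl
  · rw [Cuts.map_pt _ e h0 h1]
    have hi := fromEnd_interior (b := f.flip e) h0 h1
    refine Eq.trans ?_ (Cuts.map_pt (Cuts.full D') (f.onE e) hi.1 hi.2).symm
    change pt (f.onE e) (fromEnd (f.flip e) _) = _
    congr 1
    refine Subtype.ext ?_
    have hc : ∀ b, (f.cuts 1).c e b = D'.cut (f.onE e) (xor b (f.flip e)) := fun b => by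
      change (1 - (1 : ℝ)) * _ + 1 * D'.cut (f.onE e) (xor b (f.flip e)) = _
      ring
    rw [Cuts.fromEnd_shrinkI, hc, hc, hc]
    change _ = D'.cut (f.onE e) false + (1 - D'.cut (f.onE e) false - D'.cut (f.onE e) true) *
      (fromEnd (f.flip e) t : ℝ)
    cases f.flip e
    · rfl
    · simp only [Bool.xor_true, Bool.not_true, Bool.not_false]
      ring

theorem cuts_notMem (s : unitInterval) (p : D.Γ.Space) :
    ∀ h ∈ D'.H, f.onSpace ((f.cuts s).map p) ∉ halfEdge D'.ρ h := by
  rcases D.exists_rep p with ⟨w, rfl⟩ | ⟨e, t, h0, h1, rfl⟩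
  · exact D'.vert_notMem _
  · rw [Cuts.map_pt _ e h0 h1]
    have hi := (f.cuts s).shrinkI_interior e t h0 h1
    have hi' := fromEnd_interior (b := f.flip e) hi.1 hi.2
    change ∀ h ∈ D'.H, (pt (f.onE e) (fromEnd (f.flip e) _) : D'.Γ.Space) ∉ _
    rw [pt_notMem_iff hi'.1 hi'.2]
    intro b hb
    rw [fromEnd_xor]
    have h2 := (f.cuts s).lt_fromEnd_shrinkI e (xor (f.flip e) b) h0 h1
    have h3 := f.cuts_ge s e (xor (f.flip e) b)
    have h4 : f.onHalf (e, xor (f.flip e) b) = (f.onE e, b) := by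
      refine Prod.ext rfl ?_
      change xor (xor (f.flip e) b) (f.flip e) = b
      cases b <;> cases f.flip e <;> rfl
    rw [h4, cut_of_mem hb] at h3
    linarith

/-- The new point moves along the half-edge while the cuts are interpolated. -/
def relocate {h : D.Γ.E × Bool} (hf : f.onHalf h ∈ D'.H) :
    Insertion D (unitInterval × unitInterval) h where
  cuts s := f.cuts s.1
  continuous_cuts e b := by
    change Continuous fun s : unitInterval × unitInterval =>
      (1 - (s.1 : ℝ)) * D.cut e b + s.1 * D'.cut (f.onHalf (e, b)).1 (f.onHalf (e, b)).2
    fun_prop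
  pos := ⟨fun x => x.1.2 * lerp x.1.1 D.ρI D'.ρI, by fun_prop⟩
  avoid s m p hp _ _ := by
    have hh := f.mem_of_map_mem h hf
    refine avoid_of_pos_le_cut hh ?_ hp
    change (s.2 : ℝ) * lerp s.1 D.ρI D'.ρI ≤
      (1 - s.1) * D.cut h.1 h.2 + s.1 * D'.cut (f.onHalf h).1 (f.onHalf h).2
    rw [cut_of_mem hh, cut_of_mem hf]
    exact mul_le_of_le_one_left (lerp s.1 D.ρI D'.ρI).2.1 s.2.2.2

end Embedding

namespace Presentation

variable {D D' : HalfEdgeData.{u}} {S S' : SequenceDiagram.{u}}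

/-- The maps of diagrams are induced by an embedding of graphs and a bijection of the labels. -/
structure Matches (P : Presentation D S) (P' : Presentation D' S') (m : S.Hom S')
    (f : Embedding D D') (σ : P.ι ≃ P'.ι) : Prop where
  onX : ∀ x, m.onX (P.πX x) = P'.πX (Conf.map f.onSpace f.onSpace_injective σ x)
  onA : ∀ z, m.onA (P.πA z) = P'.πA (Conf.map f.onDeleted f.onDeleted_injective σ z)
  idx_some : ∀ j j', m.idx j = some j' →
    P'.k j' = σ (P.k j) ∧ (P'.h j').1 = f.onHalf (P.h j).1
  idx_none : ∀ j, m.idx j = none → f.onHalf (P.h j).1 ∉ D'.H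
  onY : ∀ j j' (hj : m.idx j = some j') y, ∃ y',
    (∀ (i : {i : P.ι // i ≠ P.k j}) (i' : {i : P'.ι // i ≠ P'.k j'}), σ i = i' →
      y'.1 i' = f.onPunctured (y.1 i)) ∧ m.onY j j' hj (P.πY j y) = P'.πY j' y'

variable {P : Presentation D S} {P' : Presentation D' S'} {m : S.Hom S'} {f : Embedding D D'}
  {σ : P.ι ≃ P'.ι}

theorem Matches.onX_mem_range (c : Matches P P' m f σ) {x : Conf P.ι D.Γ.Space}
    (hx : ∀ i, ∀ h ∈ D'.H, f.onSpace (x.1 i) ∉ halfEdge D'.ρ h) :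
    m.onX (P.πX x) ∈ range S'.inc := by
  rw [c.onX]
  exact P'.mem_range_inc fun i => hx (σ.symm i)

/-- The homotopy is the image of `relocate`, which starts at the track of Γ and ends where `f`
carries it to the track of Γ'. At the ends of the track the new point is `v` or at a distance
between ρ' and ρ, hence outside the half-edges of `H'`. If the half-edge is not sent into `H'`, the
image of the whole track avoids `H'`. -/
theorem Matches.compat (c : Matches P P' m f σ) : P.tracks.Compat P'.tracks m where
  comm a := by
    obtain ⟨z, rfl⟩ := P.πA_surjective a
    rw [P.inc_πA, c.onX, c.onA, P'.inc_πA]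
    rfl
  homot j j' hj := by
    obtain ⟨hk, hh⟩ := c.idx_some j j' hj
    have hf : f.onHalf (P.h j).1 ∈ D'.H := hh ▸ (P'.h j').2
    let e : C(unitInterval × (S.Y j × unitInterval), S.Y j × (unitInterval × unitInterval)) :=
      ⟨fun x => (x.2.1, (x.1, x.2.2)), by fun_prop⟩
    refine ⟨m.onX.comp ((P.descend j (f.relocate hf)).comp e), ?_, ?_, ?_⟩
    · rintro ⟨y, t⟩
      obtain ⟨y, rfl⟩ := (P.πY_open j).surjective y
      change m.onX (P.descend j _ (P.πY j y, (0, t))) = m.onX (P.descend j _ (P.πY j y, t))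
      rw [descend_apply, descend_apply]
      congr 2
      refine Insertion.ins_congr f.cuts_zero (fun _ => ?_) y
      change t * lerp 0 _ _ = t * _
      rw [lerp_zero]
    · rintro ⟨y, t⟩
      obtain ⟨y, rfl⟩ := (P.πY_open j).surjective y
      obtain ⟨y', hy', hm⟩ := c.onY j j' hj y
      change m.onX (P.descend j _ (P.πY j y, (1, t))) =
        P'.descend j' _ (m.onY j j' hj (P.πY j y), t)
      rw [hm, descend_apply, descend_apply, c.onX]
      congr 1
      refine Subtype.ext (funext fun i => ?_)
      change f.onSpace (((f.relocate hf).ins (y, (1, t))).1 (σ.symm i)) = _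
      by_cases hi : i = P'.k j'
      · subst hi
        have hs : σ.symm (P'.k j') = P.k j := by rw [hk, Equiv.symm_apply_apply]
        rw [hs, Insertion.ins_self, Insertion.ins_self, Insertion.newPt, f.onSpace_hpt]
        change pt _ (fromEnd _ (t * lerp 1 _ _)) =
          pt (P'.h j').1.1 (fromEnd (P'.h j').1.2 (t * D'.ρI))
        rw [lerp_one, hh]
      · have hs : σ.symm i ≠ P.k j := fun hs => hi (by rw [hk, ← hs, Equiv.apply_symm_apply])
        rw [Insertion.ins_old _ _ _ hs, Insertion.ins_old _ _ _ hi,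
          hy' ⟨_, hs⟩ ⟨i, hi⟩ (σ.apply_symm_apply i)]
        exact f.cuts_one _
    · intro s y
      obtain ⟨y, rfl⟩ := (P.πY_open j).surjective y
      have key : ∀ t : unitInterval, (∀ x : unitInterval, (x : ℝ) = t * lerp s D.ρI D'.ρI →
          x = 0 ∨ D'.ρ ≤ x) → m.onX (P.descend j (f.relocate hf) (P.πY j y, (s, t))) ∈
            range S'.inc := by
        intro t ht
        rw [descend_apply]
        refine c.onX_mem_range fun i => ?_
        by_cases hi : i = P.k j
        · subst hi
          rw [Insertion.ins_self, Insertion.newPt, f.onSpace_hpt]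
          refine D'.hpt_notMem ?_ fun _ => ht _ rfl
          change (t : ℝ) * ((1 - s) * D.ρ + s * D'.ρ) ≤ 1 / 2
          have h1 := D.ρ_le
          have h2 := D'.ρ_le
          have h3 := s.2.1
          have h4 := s.2.2
          have h5 : 0 ≤ (1 - (s : ℝ)) * D.ρ + s * D'.ρ :=
            add_nonneg (mul_nonneg (by linarith) D.ρ_pos.le) (mul_nonneg h3 D'.ρ_pos.le)
          refine (mul_le_of_le_one_left h5 t.2.2).trans ?_
          nlinarith
        · rw [Insertion.ins_old _ _ _ hi]
          exact f.cuts_notMem s _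
      refine ⟨key 0 fun x hx => Or.inl (Subtype.ext (hx.trans (zero_mul _))),
        key 1 fun x hx => Or.inr ?_⟩
      rw [hx]
      change D'.ρ ≤ 1 * ((1 - s) * D.ρ + s * D'.ρ)
      have := mul_le_mul_of_nonneg_left f.ρ_le_ρ (by linarith [s.2.2] : 0 ≤ 1 - (s : ℝ))
      linarith
  none j hj := by
    rintro ⟨y, t⟩
    obtain ⟨y, rfl⟩ := (P.πY_open j).surjective y
    change m.onX (P.descend j _ (P.πY j y, t)) ∈ _
    rw [descend_apply]
    refine c.onX_mem_range fun i => ?_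
    by_cases hi : i = P.k j
    · subst hi
      rw [Insertion.ins_self, Insertion.newPt, f.onSpace_hpt]
      refine D'.hpt_notMem ?_ fun hf => absurd hf (c.idx_none j hj)
      change (t : ℝ) * D.ρ ≤ 1 / 2
      exact (mul_le_of_le_one_left D.ρ_pos.le t.2.2).trans D.ρ_le
    · rw [Insertion.ins_old _ _ _ hi]
      change ∀ h ∈ D'.H, f.onSpace ((Cuts.full D).map _) ∉ _
      rw [Cuts.full_map]
      exact f.onSpace_notMem (D.shrinkFun_notMem _)

end Presentation

end HalfEdgeData

/-! ### Unordered configurations as a quotient -/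

namespace Conf

variable {ι ι' X : Type*} [TopologicalSpace X]

instance : ContinuousConstSMul (Equiv.Perm ι) (Conf ι X) where
  continuous_const_smul σ := Continuous.subtype_mk
    (continuous_pi fun i => Conf.continuous_eval (σ⁻¹ i)) _

/-- A bijection of the labels induces a homeomorphism. -/
def relabel (e : ι ≃ ι') : Conf ι X ≃ₜ Conf ι' X where
  toFun x := ⟨fun i => x.1 (e.symm i), x.2.comp e.symm.injective⟩
  invFun x := ⟨fun i => x.1 (e i), x.2.comp e.injective⟩
  left_inv x := Subtype.ext (funext fun i => congrArg x.1 (e.symm_apply_apply i))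
  right_inv x := Subtype.ext (funext fun i => congrArg x.1 (e.apply_symm_apply i))
  continuous_toFun := Continuous.subtype_mk (continuous_pi fun _ => Conf.continuous_eval _) _
  continuous_invFun := Continuous.subtype_mk (continuous_pi fun _ => Conf.continuous_eval _) _

end Conf

namespace UConf

variable {n : ℕ} {X : Type*} [TopologicalSpace X]

/-- The quotient map. -/
def mk : C(Conf (Fin n) X, UConf n X) := ⟨Quotient.mk _, continuous_quotient_mk'⟩

theorem mk_open : IsOpenQuotientMap (mk : C(Conf (Fin n) X, UConf n X)) :=
  MulAction.isOpenQuotientMap_quotientMk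

theorem mk_eq {x x' : Conf (Fin n) X} :
    mk x = mk x' ↔ ∃ σ : Equiv.Perm (Fin n), σ • x = x' := by
  refine Quotient.eq''.trans ((MulAction.orbitRel_apply).trans ?_)
  constructor
  · rintro ⟨σ, hσ⟩
    exact ⟨σ⁻¹, inv_smul_eq_iff.2 hσ.symm⟩
  · rintro ⟨σ, hσ⟩
    exact ⟨σ⁻¹, inv_smul_eq_iff.2 hσ.symm⟩

/-- The labels different from `0`, counted from `0`. -/
def tailEquiv (n : ℕ) : {i : Fin (n + 1) // i ≠ 0} ≃ Fin n where
  toFun i := i.1.pred i.2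
  invFun j := ⟨j.succ, j.succ_ne_zero⟩
  left_inv i := Subtype.ext (Fin.succ_pred i.1 i.2)
  right_inv j := Fin.pred_succ j

theorem coe_tailEquiv_symm (i : Fin n) : ((tailEquiv n).symm i : Fin (n + 1)) = i.succ := rfl

/-- Forgets the labels, which are different from `0`. -/
def tail : C(Conf {i : Fin (n + 1) // i ≠ 0} X, UConf n X) :=
  mk.comp ⟨Conf.relabel (tailEquiv n), (Conf.relabel (tailEquiv n)).continuous⟩

theorem tail_open : IsOpenQuotientMap (tail : C(Conf {i : Fin (n + 1) // i ≠ 0} X, UConf n X)) :=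
  mk_open.comp (Conf.relabel (tailEquiv n)).isOpenQuotientMap

/-- Permutations of the labels other than 0 are the permutations of all labels that fix 0, through
`Equiv.Perm.decomposeFin`. -/
theorem tail_eq {y y' : Conf {i : Fin (n + 1) // i ≠ 0} X} :
    tail y = tail y' ↔ ∃ σ : Equiv.Perm (Fin (n + 1)), σ 0 = 0 ∧
      ∀ i i' : {i : Fin (n + 1) // i ≠ 0}, σ i = i' → y'.1 i' = y.1 i := by
  refine mk_eq.trans ⟨?_, ?_⟩
  · rintro ⟨τ, hτ⟩
    refine ⟨Equiv.Perm.decomposeFin.symm (0, τ), by simp, fun i i' hi => ?_⟩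
    obtain ⟨a, rfl⟩ := (tailEquiv n).symm.surjective i
    obtain ⟨b, rfl⟩ := (tailEquiv n).symm.surjective i'
    rw [coe_tailEquiv_symm, coe_tailEquiv_symm, Equiv.Perm.decomposeFin_symm_apply_succ] at hi
    simp only [Equiv.swap_self, Equiv.refl_apply, Fin.succ_inj] at hi
    subst hi
    have h := congrFun (congrArg Subtype.val hτ) (τ a)
    change y.1 ((tailEquiv n).symm (τ.symm (τ a))) = y'.1 ((tailEquiv n).symm (τ a)) at h
    rw [← h, Equiv.symm_apply_apply]
  · rintro ⟨σ, h0, hi⟩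
    obtain ⟨⟨p, τ⟩, rfl⟩ := Equiv.Perm.decomposeFin.symm.surjective σ
    rw [Equiv.Perm.decomposeFin_symm_apply_zero] at h0
    subst h0
    refine ⟨τ, Subtype.ext (funext fun b => ?_)⟩
    change y.1 ((tailEquiv n).symm (τ.symm b)) = y'.1 ((tailEquiv n).symm b)
    refine (hi _ _ ?_).symm
    rw [coe_tailEquiv_symm, coe_tailEquiv_symm, Equiv.Perm.decomposeFin_symm_apply_succ]
    simp

theorem insert_tail {Y : Type*} [TopologicalSpace Y] (f : C(X, Y)) (hf : Injective f) (a : Y)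
    (ha : ∀ x, f x ≠ a) (y : Conf {i : Fin (n + 1) // i ≠ 0} X) :
    UConf.insert f hf a ha (tail y) = mk (Conf.insert 0 f hf a ha y) := by
  change mk (⟨Fin.cons a fun j => f (y.1 ((tailEquiv n).symm j)), _⟩ : Conf (Fin (n + 1)) Y) = _
  congr 1
  refine Subtype.ext (funext fun j => ?_)
  refine Fin.cases ?_ (fun j => ?_) j
  · exact (dif_pos rfl : (Conf.insert 0 f hf a ha y).1 0 = a).symm
  · exact (dif_neg j.succ_ne_zero : (Conf.insert 0 f hf a ha y).1 j.succ = _).symm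

end UConf

/-! ### The presentations of the unordered and ordered diagrams, and the theorem. -/

namespace HalfEdgeData

/-- All labels are equivalent under the full symmetric group, so the new point may be given the
label 0 and an index is just a half-edge. -/
def unorderedPresentation (n : ℕ) (D : HalfEdgeData.{u}) : Presentation D (D.unordered n) where
  ι := Fin (n + 1)
  G := ⊤
  πX := UConf.mk
  πA := UConf.mk
  k _ := 0
  h j := j
  πY _ := UConf.tail
  πX_open := UConf.mk_open
  πX_eq _ _ := UConf.mk_eq.trans (by simp)
  πA_surjective := UConf.mk_open.surjective
  πA_smul σ _ _ := UConf.mk_eq.2 ⟨σ⁻¹, inv_smul_smul σ _⟩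
  πY_open _ := UConf.tail_open
  πY_eq _ _ _ := UConf.tail_eq.trans (by simp)
  inc_πA _ := rfl
  p_πY _ y := UConf.insert_tail _ _ _ _ y
  q_πY _ y := UConf.insert_tail _ _ _ _ y
  exists_index k₀ h₀ := ⟨h₀, rfl, Equiv.swap 0 k₀, Subgroup.mem_top _, Equiv.swap_apply_left _ _⟩
  index_unique _ _ _ _ _ h := h

/-- Nothing is identified here. The permutation in `orderedHom` enters as the bijection of labels in
`Matches`, so equivariance is an instance of naturality. -/
def orderedPresentation (n : ℕ) (D : HalfEdgeData.{u}) : Presentation D (D.ordered n) where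
  ι := Fin n
  G := ⊥
  πX := ContinuousMap.id _
  πA := ContinuousMap.id _
  k j := j.1
  h j := j.2
  πY _ := ContinuousMap.id _
  πX_open := .id
  πX_eq x x' := by
    change x = x' ↔ _
    simp
  πA_surjective := surjective_id
  πA_smul σ hσ z := by
    rw [Subgroup.mem_bot.1 hσ, one_smul]
  πY_open _ := .id
  πY_eq j y y' := by
    constructor
    · rintro rfl
      exact ⟨1, Subgroup.mem_bot.2 rfl, rfl, fun i i' h => congrArg y.1 (Subtype.ext h.symm)⟩
    · rintro ⟨σ, hσ, -, h⟩
      obtain rfl := Subgroup.mem_bot.1 hσ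
      exact Subtype.ext (funext fun i => (h i i rfl).symm)
  inc_πA _ := rfl
  p_πY _ _ := rfl
  q_πY _ _ := rfl
  exists_index k₀ h₀ := ⟨(k₀, h₀), rfl, 1, Subgroup.mem_bot.2 rfl, rfl⟩
  index_unique j j' σ hσ hk hh := by
    obtain rfl := Subgroup.mem_bot.1 hσ
    exact Prod.ext hk hh

namespace Embedding

variable {D D' : HalfEdgeData.{u}} (f : Embedding D D')

theorem onH_eq_some {h : D.H} {h' : D'.H} (hh : f.onH h = some h') : h'.1 = f.onHalf h.1 := by
  unfold onH at hh
  split_ifs at hh with hm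
  exact (congrArg Subtype.val (Option.some.inj hh)).symm

theorem onH_eq_none {h : D.H} (hh : f.onH h = none) : f.onHalf h.1 ∉ D'.H := by
  unfold onH at hh
  split_ifs at hh with hm
  exact hm

theorem unordered_matches (n : ℕ) : (unorderedPresentation n D).Matches
    (unorderedPresentation n D') (f.unorderedHom n) f (Equiv.refl _) where
  onX _ := rfl
  onA _ := rfl
  idx_some _ _ h := ⟨rfl, f.onH_eq_some h⟩
  idx_none _ h := f.onH_eq_none h
  onY j j' hj y := by
    refine ⟨Conf.map f.onPunctured f.onPunctured_injective (Equiv.refl _) y, ?_, rfl⟩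
    rintro i i' h
    exact congrArg (fun i => f.onPunctured (y.1 i)) (Subtype.ext h.symm)

theorem ordered_matches (n : ℕ) (σ : Equiv.Perm (Fin n)) : (orderedPresentation n D).Matches
    (orderedPresentation n D') (f.orderedHom n σ) f σ where
  onX _ := rfl
  onA _ := rfl
  idx_some j j' h := by
    obtain ⟨h', hh, rfl⟩ := Option.map_eq_some_iff.1 h
    exact ⟨rfl, f.onH_eq_some hh⟩
  idx_none j h := f.onH_eq_none (Option.map_eq_none_iff.1 h)
  onY j j' hj y := by
    refine ⟨Conf.map f.onPunctured f.onPunctured_injective (σ.subtypeEquiv (f.label_eq hj)) y,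
      ?_, rfl⟩
    rintro i i' h
    refine congrArg (fun i => f.onPunctured (y.1 i)) (Subtype.ext ?_)
    exact σ.symm_apply_eq.2 h.symm

end Embedding

end HalfEdgeData

/-- The long exact sequences of the deletion of half-edges: for unordered configuration spaces in
cohomology and in homology, and for ordered configuration spaces in cohomology and in homology,
where naturality with respect to the permutations of the labels is the equivariance. -/
theorem theorem1p1 :
    (∀ n : ℕ, Nonempty (CohomologySequence.{u, w} (HalfEdgeData.unordered.{u} n)
      (Mor := HalfEdgeData.Embedding) fun f => f.unorderedHom n)) ∧
    (∀ n : ℕ, Nonempty (HomologySequence.{u, w} (HalfEdgeData.unordered.{u} n)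
      (Mor := HalfEdgeData.Embedding) fun f => f.unorderedHom n)) ∧
    (∀ n : ℕ, Nonempty (CohomologySequence.{u, w} (HalfEdgeData.ordered.{u} n)
      (Mor := fun D D' => HalfEdgeData.Embedding D D' × Equiv.Perm (Fin n))
      fun f => f.1.orderedHom n f.2)) ∧
    (∀ n : ℕ, Nonempty (HomologySequence.{u, w} (HalfEdgeData.ordered.{u} n)
      (Mor := fun D D' => HalfEdgeData.Embedding D D' × Equiv.Perm (Fin n))
      fun f => f.1.orderedHom n f.2)) :=
  ⟨fun n => nonempty_cohomologySequence
      (fun D => (HalfEdgeData.unorderedPresentation n D).tracks)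
      (fun D => (HalfEdgeData.unorderedPresentation n D).key)
      fun _ _ f => (f.unordered_matches n).compat,
    fun n => nonempty_homologySequence
      (fun D => (HalfEdgeData.unorderedPresentation n D).tracks)
      (fun D => (HalfEdgeData.unorderedPresentation n D).key)
      fun _ _ f => (f.unordered_matches n).compat,
    fun n => nonempty_cohomologySequence
      (fun D => (HalfEdgeData.orderedPresentation n D).tracks)
      (fun D => (HalfEdgeData.orderedPresentation n D).key)
      fun _ _ f => (f.1.ordered_matches n f.2).compat,
    fun n => nonempty_homologySequence
      (fun D => (HalfEdgeData.orderedPresentation n D).tracks)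
      (fun D => (HalfEdgeData.orderedPresentation n D).key)
      fun _ _ f => (f.1.ordered_matches n f.2).compat⟩
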